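/- A pushdown alphabet $\Sigma$ is the union of three pairwise disjoint finite alphabets: $\Sigma_c$ (call letters), $\Sigma_r$ (return letters) and $\Sigma_{int}$ (internal letters). A visibly pushdown automaton over $\Sigma$ is a deterministic automaton with a finite state set $Q$, an initial state $q_0 \in Q$, a set $F \subseteq Q$ of final states, a finite stack alphabet $\Gamma$ with a bottom symbol $\bot$, and transition functions $\delta_c : Q \times \Sigma_c \to (\Gamma \setminus \{\bot\}) \times Q$, $\delta_r : Q \times \Sigma_r \times \Gamma \to Q$ and $\delta_{int} : Q \times \Sigma_{int} \to Q$. A call letter pushes one symbol from $\Gamma \setminus \{\bot\}$, a return letter reads and pops the topmost symbol (if this is $\bot$, it is read but not popped), and an internal letter leaves the stack unchanged. A word is accepted if the automaton, started in $q_0$ with stack content $\bot$, is in a state from $F$ after reading the word. A language $L \subseteq \Sigma^*$ is a visibly pushdown language if it is the set of words accepted by some visibly pushdown automaton over $\Sigma$. A two-way variable-size ($\mathsf{2V}$) sliding window algorithm for $L$ maintains a word $w \in \Sigma^*$ (the window), initially empty, under an arbitrary sequence of the operations $\mathsf{rightpush}(a)$ (replace $w$ by $wa$), $\mathsf{leftpush}(a)$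 (replace $w$ by $aw$), $\mathsf{leftpop}$ and $\mathsf{rightpop}$ (remove the first, respectively last, symbol of $w$; no effect if $w$ is empty) for $a \in \Sigma$, and $\mathsf{query}$, which has to return $1$ if $w \in L$ and $0$ otherwise. The algorithm runs on a unit-cost random access machine (addition, subtraction, multiplication and integer division of natural numbers, tests for zero, indirect addressing), starting from a fixed finite memory content that results from preprocessing; it does not know the window sizes in advance. It has * latency $T(n)$ if in every computation of maximal window size $n$ each operation is handled within $T(n)$ steps; * word size $b(n)$ and space complexity $S(n)$ if for every $n$ one can assign to the registers bit lengths of at most $b(n)$ with sum at most $S(n)$ such that, in every computation of maximal window size $n$, every register that is referred to has positive length, and at every moment the content of every register fits into its length. **Theorem.** Every visibly pushdown language $L$ has a $\mathsf{2V}$ sliding window algorithm with latency $\mathcal{O}(1)$, space complexity $\mathcal{O}(n \log n)$ and word size $\mathcal{O}(\log n)$, where $\log n$ stands for $\lceil \log_2 n \rceil$ and all three bounds hold for the same algorithm. The constants may depend on $L$. -/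

import Mathlib

open Filter Asymptotics

/-! ## Visibly pushdown automata -/

namespace VisiblyPushdown

/-- The letters of the pushdown alphabet that consists of the pairwise disjoint alphabets `C` of
call letters, `R` of return letters and `I` of internal letters. -/
inductive Letter (C R I : Type*) where
  | call (a : C)
  | ret (a : R)
  | internal (a : I)

/-- A (deterministic) visibly pushdown automaton with states `Q` and stack alphabet `Γ`. The type
`{γ : Γ // γ ≠ bot}` is the set of stack symbols other than the bottom symbol. -/
structure VPA (C R I Q Γ : Type*) where
  bot : Γ
  start : Q
  final : Set Q
  callStep : Q → C → {γ : Γ // γ ≠ bot} × Q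
  retStep : Q → R → Γ → Q
  internalStep : Q → I → Q

namespace VPA

variable {C R I Q Γ : Type*}

/-- A configuration: the state, and the stack content above the bottom symbol, with the topmost
symbol at the head of the list. (The bottom symbol itself always lies below this list.) -/
structure Conf (A : VPA C R I Q Γ) where
  state : Q
  stack : List {γ : Γ // γ ≠ A.bot}

/-- The effect of one letter on a configuration. A return letter that finds only the bottom symbol
reads it and does not pop it. -/
def step (A : VPA C R I Q Γ) : A.Conf → Letter C R I → A.Conf
  | ⟨p, α⟩, .call a => ⟨(A.callStep p a).2, (A.callStep p a).1 :: α⟩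
  | ⟨p, α⟩, .internal a => ⟨A.internalStep p a, α⟩
  | ⟨p, γ :: α⟩, .ret a => ⟨A.retStep p a γ.1, α⟩
  | ⟨p, []⟩, .ret a => ⟨A.retStep p a A.bot, []⟩

/-- The language of the automaton: acceptance depends on the state that is reached from the initial
configuration, with an arbitrary final stack. -/
def accepts (A : VPA C R I Q Γ) : Language (Letter C R I) :=
  {w | (w.foldl A.step ⟨A.start, []⟩).state ∈ A.final}

end VPA

/-- Visibly pushdown languages: the languages of automata with finitely many states and finitely
many stack symbols. -/
def IsVPL {C R I : Type*} (L : Language (Letter C R I)) : Prop :=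
  ∃ (Q Γ : Type) (_ : Finite Q) (_ : Finite Γ) (A : VPA C R I Q Γ), A.accepts = L

end VisiblyPushdown

/-! ## The random access machine -/

namespace RAM

/-- The contents of the registers `R_0, R_1, R_2, …`. -/
abbrev Memory := ℕ → ℕ

/-- The arithmetic operations: addition, subtraction (cut off at `0`), multiplication and integer
division. -/
inductive Arith where
  | add | sub | mul | div

def Arith.eval : Arith → ℕ → ℕ → ℕ
  | .add, x, y => x + y
  | .sub, x, y => x - y
  | .mul, x, y => x * y
  | .div, x, y => x / y

/-- The instructions. -/
inductive Instr where
  /-- `R_r := k` -/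
  | const (r k : ℕ)
  /-- `R_r := R_s` -/
  | copy (r s : ℕ)
  /-- `R_r := R_s ∘ R_t` for an arithmetic operation `∘` -/
  | arith (o : Arith) (r s t : ℕ)
  /-- `R_r := R_{R_s}` -/
  | load (r s : ℕ)
  /-- `R_{R_r} := R_s` -/
  | store (r s : ℕ)
  /-- continue with instruction number `l` -/
  | jump (l : ℕ)
  /-- if `R_r = 0`, continue with instruction number `l` -/
  | jumpIfZero (r l : ℕ)

/-- A program; its instructions are numbered from `0`. -/
abbrev Program := List Instr

/-- A configuration: the number of the next instruction and the register contents. -/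
structure Conf where
  pc : ℕ
  mem : Memory

/-- The execution of one instruction. -/
def Instr.exec : Instr → Conf → Conf
  | .const r k, ⟨pc, m⟩ => ⟨pc + 1, Function.update m r k⟩
  | .copy r s, ⟨pc, m⟩ => ⟨pc + 1, Function.update m r (m s)⟩
  | .arith o r s t, ⟨pc, m⟩ => ⟨pc + 1, Function.update m r (o.eval (m s) (m t))⟩
  | .load r s, ⟨pc, m⟩ => ⟨pc + 1, Function.update m r (m (m s))⟩
  | .store r s, ⟨pc, m⟩ => ⟨pc + 1, Function.update m (m r) (m s)⟩
  | .jump l, ⟨_, m⟩ => ⟨l, m⟩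
  | .jumpIfZero r l, ⟨pc, m⟩ => ⟨if m r = 0 then l else pc + 1, m⟩

/-- The registers that an instruction refers to, when the register contents are `m`. -/
def Instr.refs : Instr → Memory → Finset ℕ
  | .const r _, _ => {r}
  | .copy r s, _ => {r, s}
  | .arith _ r s t, _ => {r, s, t}
  | .load r s, m => {r, s, m s}
  | .store r s, m => {r, s, m r}
  | .jump _, _ => ∅
  | .jumpIfZero r _, _ => {r}

/-- One step of a program. The program has halted when there is no instruction with the current
number; then nothing changes any more. -/
def Program.next (P : Program) (c : Conf) : Conf :=
  match P[c.pc]? with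
  | some i => i.exec c
  | none => c

/-- The registers referred to in the next step of a program (none after it has halted). -/
def Program.refs (P : Program) (c : Conf) : Finset ℕ :=
  match P[c.pc]? with
  | some i => i.refs c.mem
  | none => ∅

/-- The configuration after `k` steps, when the program is started on register contents `m`. -/
def Program.conf (P : Program) (m : Memory) (k : ℕ) : Conf :=
  P.next^[k] ⟨0, m⟩

/-- Started on register contents `m`, the program halts after at most `t` steps. -/
def Program.HaltsWithin (P : Program) (m : Memory) (t : ℕ) : Prop :=
  ∃ k ≤ t, P.length ≤ (P.conf m k).pc

open Classical in
/-- The register contents in which the program halts, when it is started on `m`. (The value for a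
program that does not halt is irrelevant: below, halting is always required too.) -/
noncomputable def Program.result (P : Program) (m : Memory) : Memory :=
  if h : ∃ k, P.length ≤ (P.conf m k).pc then (P.conf m (Nat.find h)).mem else m

end RAM

/-! ## Sliding window algorithms in the two-way variable-size model -/

namespace SlidingWindow

/-- The operations of the two-way variable-size model. -/
inductive Op (α : Type*) where
  | rightpush (a : α)
  | leftpush (a : α)
  | leftpop
  | rightpop
  | query

variable {α : Type*}

/-- The effect of an operation on the window. Popping from the empty window has no effect. -/
def Op.apply (w : List α) : Op α → List α
  | .rightpush a => w ++ [a]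
  | .leftpush a => a :: w
  | .leftpop => w.tail
  | .rightpop => w.dropLast
  | .query => w

/-- The window after a sequence of operations; it is empty initially. -/
def window (ops : List (Op α)) : List α :=
  ops.foldl Op.apply []

/-- The maximal window size that occurs during a sequence of operations. -/
def maxWindowSize (ops : List (Op α)) : ℕ :=
  (Finset.range (ops.length + 1)).sup fun k => (window (ops.take k)).length

/-- A two-way variable-size sliding window algorithm on a random access machine: the register
contents after the preprocessing phase, and for each operation the program that handles it.
The register contents persist from one operation to the next. -/
structure Algorithm (α : Type*) where
  init : ℕ →₀ ℕ
  prog : Op α → RAM.Program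

namespace Algorithm

/-- The register contents after a sequence of operations. -/
noncomputable def memoryAfter (A : Algorithm α) (ops : List (Op α)) : RAM.Memory :=
  ops.foldl (fun m op => (A.prog op).result m) A.init

/-- The algorithm answers every query, after any sequence of operations, according to the
membership of the current window in `L`; the answer is read off from register `R_0`. -/
def Solves (A : Algorithm α) (L : Language α) : Prop :=
  ∀ ops : List (Op α),
    (∃ t, (A.prog .query).HaltsWithin (A.memoryAfter ops) t) ∧
    (window ops ∈ L → (A.prog .query).result (A.memoryAfter ops) 0 = 1) ∧
    (window ops ∉ L → (A.prog .query).result (A.memoryAfter ops) 0 = 0)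

/-- Latency `T`: in every computation of maximal window size `n`, every operation is handled within
`T n` steps. -/
def HasLatency (A : Algorithm α) (T : ℕ → ℕ) : Prop :=
  ∀ (ops pre : List (Op α)) (op : Op α), pre ++ [op] <+: ops →
    (A.prog op).HaltsWithin (A.memoryAfter pre) (T (maxWindowSize ops))

/-- `len n i` is the length in bits of register `R_i` in computations of maximal window size `n`:
at each moment of such a computation, the content of each register fits into its length, and each
register that is referred to has positive length. -/
def HasRegisterLengths (A : Algorithm α) (len : ℕ → ℕ →₀ ℕ) : Prop :=
  ∀ (ops pre : List (Op α)) (op : Op α), pre ++ [op] <+: ops → ∀ k : ℕ,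
    (∀ i, ((A.prog op).conf (A.memoryAfter pre) k).mem i < 2 ^ len (maxWindowSize ops) i) ∧
    (∀ i ∈ (A.prog op).refs ((A.prog op).conf (A.memoryAfter pre) k),
      0 < len (maxWindowSize ops) i)

/-- Word size `b` and space complexity `S`: in computations of maximal window size `n`, all
registers have length at most `b n`, and the register lengths sum up to at most `S n` bits. -/
def HasWordSizeAndSpace (A : Algorithm α) (b S : ℕ → ℕ) : Prop :=
  ∃ len : ℕ → ℕ →₀ ℕ, A.HasRegisterLengths len ∧
    (∀ n i, len n i ≤ b n) ∧ (∀ n, ((len n).sum fun _ l => l) ≤ S n)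

end Algorithm

end SlidingWindow

/-!
Every return letter in the window that has a matching call letter in the window encloses, together
with it, a well-matched word. Hence the window has a unique decomposition into forests that are
separated by unmatched return letters, and then by unmatched call letters, where a forest is a
sequence of trees, and a tree is an internal letter or a forest between two matching letters. On a
well-matched word the automaton transforms its state independently of the stack, so that each tree
has a value in the finite monoid of transformations of the states, and the value of a sequence is the
product of the values of its members. The same is true for the parts that contain the unmatched
letters, since an unmatched return letter always finds the empty stack, and the symbol that is pushed
by an unmatched call letter is never read. The sequences are kept in deques that maintain the products of
their elements; then each operation on the window amounts to a bounded number of operations on these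
deques (`VisiblyPushdown.Inv.addLetter`, `VisiblyPushdown.Inv.removeLetter`), and a query is answered
by a product of three values (`VisiblyPushdown.Inv.total`).

The deques need constant time in the worst case for all operations at both ends. They are the purely
functional deques of Kaplan and Tarjan, without lazy evaluation: level `i` holds a short buffer of
nested pairs of depth `i` at each end, and a regularity condition on the sequence of buffer lengths,
`Deque.Good`, ensures that at most one level has to be repaired after an operation
(`Deque.restore_spec`). Each level stores the product of everything below it. The size of a deque
exceeds the sum of the sizes of its elements only by a constant for each element (`Deque.Rep.size_le`),
so that the nested deques have linear size.

All this is expressed by expressions without recursion over S-expressions (`Code`); a function is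
computed by such an expression if it satisfies `Comp`. The random access machine evaluates them with
a heap of reference-counted cells. When a cell is released, its components are not: this is done
later, when the cell is reused for a new pair. So releasing takes constant time, and as all cells are
reachable whenever the free list is empty, the heap never becomes larger than the maximal size of the
contents (`RAM.Inv.card_le_of_full`). Consequently, a representation of the window by S-expressions
of linear size yields an algorithm with the required bounds
(`SlidingWindow.exists_algorithm_of_code`): the addresses are linear in the maximal window size, hence
registers of logarithmic length suffice.
-/

/-! ### Loop-free programs for the random access machine -/

namespace RAM

/-- The register contents are below `B`, and the registers from `B` on are zero. -/
def Bdd (B : ℕ) (m : Memory) : Prop := ∀ i, m i < B ∧ (B ≤ i → m i = 0)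

theorem Bdd.update {B : ℕ} {m : Memory} (h : Bdd B m) {r v : ℕ} (hr : r < B) (hv : v < B) :
    Bdd B (Function.update m r v) := by
  intro i
  by_cases hi : i = r
  · subst hi
    simp only [Function.update_self]
    exact ⟨hv, fun h' => absurd h' (by omega)⟩
  · simp only [Function.update_of_ne hi]
    exact h i

/-- A configuration that respects the bound `B`: the contents and the registers referred to in the
next step are below `B`. -/
def Fits (P : Program) (B : ℕ) (c : Conf) : Prop := Bdd B c.mem ∧ ∀ i ∈ P.refs c, i < B

/-- `Steps P B t c c'`: the program leads from `c` to `c'` in `t` steps, and all configurations on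
the way except the last one respect the bound `B`. -/
inductive Steps (P : Program) (B : ℕ) : ℕ → Conf → Conf → Prop
  | refl (c : Conf) : Steps P B 0 c c
  | head {t : ℕ} {c c' : Conf} : Fits P B c → Steps P B t (P.next c) c' → Steps P B (t + 1) c c'

theorem Steps.trans {P : Program} {B s t : ℕ} {c d e : Conf} (h : Steps P B s c d)
    (h' : Steps P B t d e) : Steps P B (s + t) c e := by
  induction h with
  | refl c => simpa using h'
  | head hf _ ih => rw [Nat.add_right_comm]; exact .head hf (ih h')

theorem Steps.iterate {P : Program} {B t : ℕ} {c d : Conf} (h : Steps P B t c d) :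
    P.next^[t] c = d := by
  induction h with
  | refl c => rfl
  | head _ _ ih => rw [Function.iterate_succ_apply]; exact ih

theorem Steps.fits {P : Program} {B t : ℕ} {c d : Conf} (h : Steps P B t c d) :
    ∀ k < t, Fits P B (P.next^[k] c) := by
  induction h with
  | refl c => intro k hk; omega
  | head hf _ ih =>
    intro k hk
    cases k with
    | zero => exact hf
    | succ k => rw [Function.iterate_succ_apply]; exact ih k (by omega)

theorem next_of_halted {P : Program} {c : Conf} (h : P.length ≤ c.pc) : P.next c = c := by
  simp [Program.next, List.getElem?_eq_none h]

theorem iterate_of_halted {P : Program} {c : Conf} (h : P.length ≤ c.pc) (k : ℕ) :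
    P.next^[k] c = c := Function.iterate_fixed (next_of_halted h) k

theorem conf_of_le {P : Program} {m : Memory} {j k : ℕ} (h : P.length ≤ (P.conf m j).pc)
    (hjk : j ≤ k) : P.conf m k = P.conf m j := by
  obtain ⟨i, rfl⟩ := Nat.exists_eq_add_of_le' hjk
  unfold Program.conf at *
  rw [Function.iterate_add_apply, iterate_of_halted h]

theorem result_of_halted {P : Program} {m : Memory} {j : ℕ} (h : P.length ≤ (P.conf m j).pc) :
    P.result m = (P.conf m j).mem := by
  classical
  have hex : ∃ k, P.length ≤ (P.conf m k).pc := ⟨j, h⟩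
  rw [Program.result, dif_pos hex]
  rw [conf_of_le (Nat.find_spec hex) (Nat.find_min' hex h)]

/-- Structured loop-free commands. -/
inductive Cmd where
  | skip
  | const (r k : ℕ)
  | copy (r s : ℕ)
  | arith (o : Arith) (r s t : ℕ)
  | load (r s : ℕ)
  | store (r s : ℕ)
  | seq (c d : Cmd)
  | ifz (r : ℕ) (c d : Cmd)

namespace Cmd

/-- The commands of a list, one after the other. -/
def block (l : List Cmd) : Cmd := l.foldr seq skip

/-- The number of instructions. -/
def size : Cmd → ℕ
  | skip => 0
  | const _ _ => 1
  | copy _ _ => 1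
  | arith _ _ _ _ => 1
  | load _ _ => 1
  | store _ _ => 1
  | seq c d => c.size + d.size
  | ifz _ c d => c.size + d.size + 2

/-- The instructions of a command, when the first of them gets the number `o`. -/
def compile : Cmd → ℕ → Program
  | skip, _ => []
  | const r k, _ => [.const r k]
  | copy r s, _ => [.copy r s]
  | arith a r s t, _ => [.arith a r s t]
  | load r s, _ => [.load r s]
  | store r s, _ => [.store r s]
  | seq c d, o => c.compile o ++ d.compile (o + c.size)
  | ifz r c d, o => .jumpIfZero r (o + 1 + d.size + 1) :: (d.compile (o + 1) ++
      .jump (o + 1 + d.size + 1 + c.size) :: c.compile (o + 1 + d.size + 1))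

@[simp] theorem length_compile (c : Cmd) (o : ℕ) : (c.compile o).length = c.size := by
  induction c generalizing o with
  | seq c d ihc ihd => simp [compile, size, ihc, ihd]
  | ifz r c d ihc ihd => simp [compile, size, ihc, ihd]; omega
  | _ => simp [compile, size]

/-- The weakest precondition of a command: run on `m`, it leads to register contents with `Q`, and
all registers referred to and all values written on the way are below `B`. -/
def wp (B : ℕ) : Cmd → (Memory → Prop) → Memory → Prop
  | skip, Q, m => Q m
  | const r k, Q, m => r < B ∧ k < B ∧ Q (Function.update m r k)
  | copy r s, Q, m => r < B ∧ s < B ∧ Q (Function.update m r (m s))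
  | arith o r s t, Q, m => r < B ∧ s < B ∧ t < B ∧ o.eval (m s) (m t) < B ∧
      Q (Function.update m r (o.eval (m s) (m t)))
  | load r s, Q, m => r < B ∧ s < B ∧ m s < B ∧ Q (Function.update m r (m (m s)))
  | store r s, Q, m => r < B ∧ s < B ∧ m r < B ∧ Q (Function.update m (m r) (m s))
  | seq c d, Q, m => c.wp B (d.wp B Q) m
  | ifz r c d, Q, m => r < B ∧ (m r = 0 → c.wp B Q m) ∧ (m r ≠ 0 → d.wp B Q m)

/-- The program `P` contains the instructions `l` from number `o` on. -/
def Contains (P : Program) (o : ℕ) (l : List Instr) : Prop := ∀ j < l.length, P[o + j]? = l[j]?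

theorem Contains.left {P : Program} {o : ℕ} {l l' : List Instr} (h : Contains P o (l ++ l')) :
    Contains P o l := by
  intro j hj
  rw [h j (by simp; omega), List.getElem?_append_left hj]

theorem Contains.right {P : Program} {o : ℕ} {l l' : List Instr} (h : Contains P o (l ++ l')) :
    Contains P (o + l.length) l' := by
  intro j hj
  rw [Nat.add_assoc, h (l.length + j) (by simp; omega), List.getElem?_append_right (by omega)]
  simp

theorem Contains.head {P : Program} {o : ℕ} {i : Instr} {l : List Instr}
    (h : Contains P o (i :: l)) : P[o]? = some i := by
  simpa using h 0 (by simp)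

theorem Contains.tail {P : Program} {o : ℕ} {i : Instr} {l : List Instr}
    (h : Contains P o (i :: l)) : Contains P (o + 1) l :=
  Contains.right (l := [i]) h

theorem steps_one {P : Program} {B o : ℕ} {i : Instr} {m m' : Memory} (hm : Bdd B m)
    (hi : P[o]? = some i) (hr : ∀ j ∈ i.refs m, j < B) (he : i.exec ⟨o, m⟩ = ⟨o + 1, m'⟩) :
    Steps P B 1 ⟨o, m⟩ ⟨o + 1, m'⟩ := by
  refine .head ⟨hm, ?_⟩ ?_
  · simpa [Program.refs, hi] using hr
  · rw [show P.next ⟨o, m⟩ = ⟨o + 1, m'⟩ by simp [Program.next, hi, he]]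
    exact .refl _

/-- The compiled program does what the weakest precondition says. -/
theorem steps_of_wp {P : Program} {B : ℕ} {c : Cmd} {Q : Memory → Prop} {o : ℕ} {m : Memory}
    (hP : Contains P o (c.compile o)) (hm : Bdd B m) (h : c.wp B Q m) :
    ∃ t ≤ c.size, ∃ m', Steps P B t ⟨o, m⟩ ⟨o + c.size, m'⟩ ∧ Bdd B m' ∧ Q m' := by
  induction c generalizing Q o m with
  | skip => exact ⟨0, le_rfl, m, .refl _, hm, h⟩
  | const r k =>
    obtain ⟨h1, h2, h3⟩ := h
    refine ⟨1, le_rfl, _, steps_one hm hP.head ?_ rfl, hm.update h1 h2, h3⟩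
    simp [Instr.refs, h1]
  | copy r s =>
    obtain ⟨h1, h2, h3⟩ := h
    refine ⟨1, le_rfl, _, steps_one hm hP.head ?_ rfl, hm.update h1 (hm s).1, h3⟩
    simp [Instr.refs, h1, h2]
  | arith a r s t =>
    obtain ⟨h1, h2, h3, h4, h5⟩ := h
    refine ⟨1, le_rfl, _, steps_one hm hP.head ?_ rfl, hm.update h1 h4, h5⟩
    simp [Instr.refs, h1, h2, h3]
  | load r s =>
    obtain ⟨h1, h2, h3, h4⟩ := h
    refine ⟨1, le_rfl, _, steps_one hm hP.head ?_ rfl, hm.update h1 (hm _).1, h4⟩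
    simp [Instr.refs, h1, h2, h3]
  | store r s =>
    obtain ⟨h1, h2, h3, h4⟩ := h
    refine ⟨1, le_rfl, _, steps_one hm hP.head ?_ rfl, hm.update h3 (hm _).1, h4⟩
    simp [Instr.refs, h1, h2, h3]
  | seq c d ihc ihd =>
    obtain ⟨t, ht, m', hs, hb, hq⟩ := ihc hP.left hm h
    have hP' := hP.right
    rw [length_compile] at hP'
    obtain ⟨t', ht', m'', hs', hb', hq'⟩ := ihd hP' hb hq
    refine ⟨t + t', by simp only [size]; omega, m'', ?_, hb', hq'⟩
    have := hs.trans hs'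
    simpa only [size, Nat.add_assoc] using this
  | ifz r c d ihc ihd =>
    obtain ⟨h1, h2, h3⟩ := h
    have hf : Fits P B ⟨o, m⟩ :=
      ⟨hm, by simp [Program.refs, show P[o]? = _ from hP.head, Instr.refs, h1]⟩
    have hd := hP.tail
    have hj := hd.right
    rw [length_compile] at hj
    by_cases h0 : m r = 0
    · obtain ⟨t, ht, m', hs, hb, hq⟩ := ihc hj.tail hm (h2 h0)
      refine ⟨t + 1, by simp only [size]; omega, m', .head hf ?_, hb, hq⟩
      have : P.next ⟨o, m⟩ = ⟨o + 1 + d.size + 1, m⟩ := by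
        simp [Program.next, show P[o]? = _ from hP.head, Instr.exec, h0]
      rw [this]
      rwa [show o + (ifz r c d).size = o + 1 + d.size + 1 + c.size by simp only [size]; omega]
    · obtain ⟨t, ht, m', hs, hb, hq⟩ := ihd hd.left hm (h3 h0)
      refine ⟨t + 1 + 1, by simp only [size]; omega, m', .head hf ?_, hb, hq⟩
      have : P.next ⟨o, m⟩ = ⟨o + 1, m⟩ := by
        simp [Program.next, show P[o]? = _ from hP.head, Instr.exec, h0]
      rw [this]
      refine hs.trans (.head ⟨hb, ?_⟩ ?_)
      · simp [Program.refs, show P[o + 1 + d.size]? = _ from hj.head, Instr.refs]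
      · have : P.next ⟨o + 1 + d.size, m'⟩ = ⟨o + (ifz r c d).size, m'⟩ := by
          simp only [Program.next, show P[o + 1 + d.size]? = _ from hj.head, Instr.exec, size]
          congr 1; omega
        rw [this]; exact .refl _

/-- What the weakest precondition of a command says about running it as a program. -/
theorem run_of_wp {B : ℕ} {c : Cmd} {Q : Memory → Prop} {m : Memory} (hm : Bdd B m)
    (h : c.wp B Q m) :
    (c.compile 0).HaltsWithin m c.size ∧ Bdd B ((c.compile 0).result m) ∧
      Q ((c.compile 0).result m) ∧
      ∀ k, Fits (c.compile 0) B ((c.compile 0).conf m k) := by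
  obtain ⟨t, ht, m', hs, hb, hq⟩ :=
    steps_of_wp (P := c.compile 0) (o := 0) (fun j _ => by simp) hm h
  have hc : (c.compile 0).conf m t = ⟨0 + c.size, m'⟩ := hs.iterate
  have hh : (c.compile 0).length ≤ ((c.compile 0).conf m t).pc := by simp [hc]
  have hr : (c.compile 0).result m = m' := by rw [result_of_halted hh, hc]
  refine ⟨⟨t, ht, hh⟩, hr ▸ hb, hr ▸ hq, fun k => ?_⟩
  by_cases hk : k < t
  · exact hs.fits k hk
  · rw [conf_of_le hh (by omega), hc]
    refine ⟨hb, ?_⟩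
    simp [Program.refs]

end Cmd

end RAM

/-! ### S-expressions in a heap with reference counts -/

/-- S-expressions: binary trees whose leaves are natural numbers. -/
inductive SExp where
  | atom (n : ℕ)
  | cons (a b : SExp)

namespace SExp

/-- The number of nodes. -/
def size : SExp → ℕ
  | atom _ => 1
  | cons a b => a.size + b.size + 1

theorem size_pos (t : SExp) : 0 < t.size := by cases t <;> simp [size]

end SExp

namespace RAM

open SExp

/-- The addresses of the first `n` cells of the heap that starts at `H`. The cell at `p` consists of
the registers `p` and `p + 1` for its two components, and `p + 2` for its reference count. -/
def IsCell (H n p : ℕ) : Prop := H ≤ p ∧ p < H + 3 * n ∧ (p - H) % 3 = 0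

/-- The registers that may contain counted references: the `K` variables, which start at
register 10, and the components of the `n` cells. -/
def slots (H K n : ℕ) : Finset ℕ :=
  (Finset.range (H + 3 * n)).filter fun s => (10 ≤ s ∧ s < 10 + K) ∨ (H ≤ s ∧ (s - H) % 3 ≠ 2)

/-- The number of references to `p`. -/
def cnt (H K n : ℕ) (m : Memory) (p : ℕ) : ℕ := ((slots H K n).filter fun s => m s = p).card

/-- The list `l` of cells is linked through the reference count registers, starting with `x`. -/
def Linked (m : Memory) : ℕ → List ℕ → Prop
  | x, [] => x = 0
  | x, p :: l => x = p ∧ Linked m (m (p + 2)) l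

/-- The heap invariant. Register 1 contains the first free cell, register 2 the first address above
the heap, and the registers 3 and 4 contain the constants `H` and `1`. Register 0 is reserved for
answers, and the registers from 5 to 9 are scratch registers. The heap has `n` cells, of which those
in the list `fl` are free; `val` maps register contents to the S-expressions that they stand for,
where the numbers below `H` are atoms.
The multiset `E` contains the references that the running program holds outside of `slots`.
A free cell keeps its components, which are counted as references until the cell is reused. -/
structure Inv (H K : ℕ) (m : Memory) (n : ℕ) (fl : List ℕ) (val : ℕ → SExp) (E : Multiset ℕ) :
    Prop where
  heap_le : 10 + K ≤ H
  const3 : m 3 = H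
  const4 : m 4 = 1
  fresh : m 2 = H + 3 * n
  linked : Linked m (m 1) fl
  nodup : fl.Nodup
  free_cell : ∀ p ∈ fl, IsCell H n p
  valid : ∀ s ∈ slots H K n, m s < H ∨ IsCell H n (m s)
  val_atom : ∀ a < H, val a = atom a
  val_cell : ∀ p, IsCell H n p → val p = cons (val (m p)) (val (m (p + 1)))
  count : ∀ p, IsCell H n p → p ∉ fl → m (p + 2) = cnt H K n m p + E.count p ∧ 0 < m (p + 2)
  count_free : ∀ p ∈ fl, cnt H K n m p + E.count p = 0

variable {H K n : ℕ} {m : Memory} {fl : List ℕ} {val : ℕ → SExp} {E : Multiset ℕ}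

theorem mem_slots {s : ℕ} : s ∈ slots H K n ↔
    s < H + 3 * n ∧ ((10 ≤ s ∧ s < 10 + K) ∨ (H ≤ s ∧ (s - H) % 3 ≠ 2)) := by
  simp [slots]

theorem cnt_update_not_mem {s x p : ℕ} (hs : s ∉ slots H K n) :
    cnt H K n (Function.update m s x) p = cnt H K n m p := by
  unfold cnt
  congr 1
  refine Finset.filter_congr fun a ha => ?_
  rw [Function.update_of_ne (by rintro rfl; exact hs ha)]

/-- Overwriting a slot with `x` removes one reference to its old content and adds one to `x`. The
equation is stated without subtraction. -/
theorem cnt_update_mem {s x p : ℕ} (hs : s ∈ slots H K n) :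
    cnt H K n (Function.update m s x) p + (if m s = p then 1 else 0) =
      cnt H K n m p + (if x = p then 1 else 0) := by
  unfold cnt
  simp only [Finset.card_filter]
  rw [← Finset.add_sum_erase _ _ hs,
    ← Finset.add_sum_erase (slots H K n) (fun i => if m i = p then 1 else 0) hs]
  have : ∑ i ∈ (slots H K n).erase s, (if Function.update m s x i = p then 1 else 0) =
      ∑ i ∈ (slots H K n).erase s, (if m i = p then 1 else 0) := by
    refine Finset.sum_congr rfl fun i hi => ?_
    rw [Function.update_of_ne (Finset.ne_of_mem_erase hi)]
  rw [this]
  simp only [Function.update_self]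
  omega

theorem Linked.congr {m m' : Memory} {x : ℕ} {l : List ℕ} (h : Linked m x l)
    (hm : ∀ p ∈ l, m' (p + 2) = m (p + 2)) : Linked m' x l := by
  induction l generalizing x with
  | nil => exact h
  | cons p l ih =>
    refine ⟨h.1, ?_⟩
    rw [hm p (by simp)]
    exact ih h.2 fun q hq => hm q (by simp [hq])

theorem cnt_pos {s : ℕ} (hs : s ∈ slots H K n) : 0 < cnt H K n m (m s) :=
  Finset.card_pos.2 ⟨s, by simp [hs]⟩

/-- A crude bound that ensures that reference counts respect the word size. -/
theorem cnt_le (p : ℕ) : cnt H K n m p ≤ K + 2 * n := by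
  refine (Finset.card_le_card (t := (Finset.range K).image (10 + ·) ∪
    ((Finset.range n).image (H + 3 * ·) ∪ (Finset.range n).image (H + 3 * · + 1))) ?_).trans ?_
  · intro s hs
    simp only [Finset.mem_filter, mem_slots] at hs
    simp only [Finset.mem_union, Finset.mem_image, Finset.mem_range]
    rcases hs.1.2 with h | h
    · exact .inl ⟨s - 10, by omega, by omega⟩
    · rcases Nat.lt_or_ge ((s - H) % 3) 1 with h' | h'
      · exact .inr (.inl ⟨(s - H) / 3, by omega, by omega⟩)
      · exact .inr (.inr ⟨(s - H) / 3, by omega, by omega⟩)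
  · refine (Finset.card_union_le _ _).trans ?_
    refine (Nat.add_le_add Finset.card_image_le ((Finset.card_union_le _ _).trans
      (Nat.add_le_add Finset.card_image_le Finset.card_image_le))).trans ?_
    simp; omega

namespace Inv

/-- The invariant does not depend on the scratch registers 0, 5, 6, 7, 8 and 9. -/
theorem congr {m' : Memory} (h : Inv H K m n fl val E)
    (hm : ∀ s, s ≠ 0 → (s < 5 ∨ 10 ≤ s) → m' s = m s) : Inv H K m' n fl val E := by
  have hH := h.heap_le
  have hne : ∀ s ∈ slots H K n, m' s = m s := fun s hs => by
    rw [mem_slots] at hs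
    exact hm s (by omega) (by omega)
  have hc : ∀ p, IsCell H n p → ∀ j, m' (p + j) = m (p + j) := fun p hp j => by
    unfold IsCell at hp
    exact hm _ (by omega) (by omega)
  have hcnt : ∀ p, cnt H K n m' p = cnt H K n m p := fun p => by
    unfold cnt
    congr 1
    exact Finset.filter_congr fun a ha => by rw [hne a ha]
  refine ⟨hH, ?_, ?_, ?_, ?_, h.nodup, h.free_cell, ?_, h.val_atom, ?_, ?_, ?_⟩
  · rw [hm _ (by omega) (by omega), h.const3]
  · rw [hm _ (by omega) (by omega), h.const4]
  · rw [hm _ (by omega) (by omega), h.fresh]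
  · rw [hm _ (by omega) (by omega)]
    exact h.linked.congr fun p hp => hc p (h.free_cell p hp) 2
  · intro s hs; rw [hne s hs]; exact h.valid s hs
  · intro p hp
    have h0 := hc p hp 0
    rw [Nat.add_zero] at h0
    rw [h0, hc p hp 1]; exact h.val_cell p hp
  · intro p hp hf; rw [hc p hp 2, hcnt]; exact h.count p hp hf
  · intro p hp; rw [hcnt]; exact h.count_free p hp

theorem not_mem_free (h : Inv H K m n fl val E) {s : ℕ} (hs : s ∈ slots H K n) : m s ∉ fl :=
  fun hf => by have := h.count_free _ hf; have := cnt_pos (m := m) hs; omega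

/-- Writing a variable: the new reference is taken from `E`, the old one goes to `E`. -/
theorem setVar {x : ℕ} (h : Inv H K m n fl val (x ::ₘ E)) {i : ℕ} (hi : i < K)
    (hx : x < H ∨ IsCell H n x) :
    Inv H K (Function.update m (10 + i) x) n fl val (m (10 + i) ::ₘ E) := by
  have hH := h.heap_le
  have hs : 10 + i ∈ slots H K n := by rw [mem_slots]; omega
  have hc : ∀ p, IsCell H n p → ∀ j, Function.update m (10 + i) x (p + j) = m (p + j) :=
    fun p hp j => by
      unfold IsCell at hp
      exact Function.update_of_ne (by omega) _ _
  have hcnt : ∀ p, cnt H K n (Function.update m (10 + i) x) p + (m (10 + i) ::ₘ E).count p =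
      cnt H K n m p + (x ::ₘ E).count p := fun p => by
    have := cnt_update_mem (m := m) (x := x) (p := p) hs
    simp only [Multiset.count_cons]
    simp only [eq_comm (a := p)]
    omega
  refine ⟨hH, ?_, ?_, ?_, ?_, h.nodup, h.free_cell, ?_, h.val_atom, ?_, ?_, ?_⟩
  · rw [Function.update_of_ne (by omega), h.const3]
  · rw [Function.update_of_ne (by omega), h.const4]
  · rw [Function.update_of_ne (by omega), h.fresh]
  · rw [Function.update_of_ne (by omega)]
    exact h.linked.congr fun p hp => hc p (h.free_cell p hp) 2
  · intro s hs
    by_cases h' : s = 10 + i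
    · subst h'; rwa [Function.update_self]
    · rw [Function.update_of_ne h']; exact h.valid s hs
  · intro p hp
    have h0 := hc p hp 0
    rw [Nat.add_zero] at h0
    rw [h0, hc p hp 1]; exact h.val_cell p hp
  · intro p hp hf; rw [hc p hp 2, hcnt]; exact h.count p hp hf
  · intro p hp; rw [hcnt]; exact h.count_free p hp

/-- Outstanding references to atoms are irrelevant. -/
theorem cons_atom {x : ℕ} (hx : x < H) : Inv H K m n fl val (x ::ₘ E) ↔ Inv H K m n fl val E := by
  have hc : ∀ p, IsCell H n p → (x ::ₘ E).count p = E.count p := fun p hp =>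
    Multiset.count_cons_of_ne (by unfold IsCell at hp; omega) _
  constructor
  · intro h
    refine ⟨h.1, h.2, h.3, h.4, h.5, h.6, h.7, h.8, h.9, h.10, ?_, ?_⟩
    · intro p hp hf; rw [← hc p hp]; exact h.count p hp hf
    · intro p hp; rw [← hc p (h.free_cell p hp)]; exact h.count_free p hp
  · intro h
    refine ⟨h.1, h.2, h.3, h.4, h.5, h.6, h.7, h.8, h.9, h.10, ?_, ?_⟩
    · intro p hp hf; rw [hc p hp]; exact h.count p hp hf
    · intro p hp; rw [hc p (h.free_cell p hp)]; exact h.count_free p hp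

/-- Changing the reference count of a cell in use. -/
theorem setCount {x c : ℕ} {E' : Multiset ℕ} (h : Inv H K m n fl val E) (hx : IsCell H n x)
    (hf : x ∉ fl) (hc : c = cnt H K n m x + E'.count x) (hpos : 0 < c)
    (hE : ∀ p, p ≠ x → E'.count p = E.count p) :
    Inv H K (Function.update m (x + 2) c) n fl val E' := by
  have hH := h.heap_le
  have hx' := hx
  unfold IsCell at hx'
  have hs : x + 2 ∉ slots H K n := by rw [mem_slots]; omega
  have hne : ∀ s ∈ slots H K n, Function.update m (x + 2) c s = m s := fun s hs' =>
    Function.update_of_ne (by rintro rfl; exact hs hs') _ _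
  have hne2 : ∀ p, p ≠ x → Function.update m (x + 2) c (p + 2) = m (p + 2) := fun p hp =>
    Function.update_of_ne (by omega) _ _
  refine ⟨hH, ?_, ?_, ?_, ?_, h.nodup, h.free_cell, ?_, h.val_atom, ?_, ?_, ?_⟩
  · rw [Function.update_of_ne (by omega), h.const3]
  · rw [Function.update_of_ne (by omega), h.const4]
  · rw [Function.update_of_ne (by omega), h.fresh]
  · rw [Function.update_of_ne (by omega)]
    exact h.linked.congr fun p hp => hne2 p (fun h => hf (h ▸ hp))
  · intro s hs; rw [hne s hs]; exact h.valid s hs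
  · intro p hp
    have hp' := hp
    unfold IsCell at hp'
    rw [Function.update_of_ne (by omega), Function.update_of_ne (by omega)]
    exact h.val_cell p hp
  · intro p hp hpf
    rw [cnt_update_not_mem hs]
    by_cases hpx : p = x
    · subst hpx; rw [Function.update_self]; exact ⟨hc, hpos⟩
    · rw [hne2 p hpx, hE p hpx]; exact h.count p hp hpf
  · intro p hp
    rw [cnt_update_not_mem hs, hE p (fun h => hf (h ▸ hp))]; exact h.count_free p hp

/-- A cell without references becomes free. -/
theorem free {x c : ℕ} (h : Inv H K m n fl val (x ::ₘ E)) (hx : IsCell H n x)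
    (hf : x ∉ fl) (hc : c = m 1) (hcnt : cnt H K n m x + E.count x = 0) :
    Inv H K (Function.update (Function.update m (x + 2) c) 1 x) n (x :: fl) val E := by
  have hH := h.heap_le
  have hx' := hx
  unfold IsCell at hx'
  have hs : x + 2 ∉ slots H K n := by rw [mem_slots]; omega
  have hs1 : 1 ∉ slots H K n := by rw [mem_slots]; omega
  set m' := Function.update (Function.update m (x + 2) c) 1 x with hm'
  have hne : ∀ s, s ≠ 1 → s ≠ x + 2 → m' s = m s := fun s h1 h2 => by
    rw [hm', Function.update_of_ne h1, Function.update_of_ne h2]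
  have hcnt' : ∀ p, cnt H K n m' p = cnt H K n m p := fun p => by
    rw [hm', cnt_update_not_mem hs1, cnt_update_not_mem hs]
  refine ⟨hH, ?_, ?_, ?_, ?_, ?_, ?_, ?_, h.val_atom, ?_, ?_, ?_⟩
  · rw [hne _ (by omega) (by omega), h.const3]
  · rw [hne _ (by omega) (by omega), h.const4]
  · rw [hne _ (by omega) (by omega), h.fresh]
  · refine ⟨by simp [hm'], ?_⟩
    have : m' (x + 2) = m 1 := by
      rw [hm', Function.update_of_ne (by omega), Function.update_self, hc]
    rw [this]
    refine h.linked.congr fun p hp => hne _ (by omega) ?_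
    intro h'
    exact hf ((by omega : p = x) ▸ hp)
  · exact List.nodup_cons.2 ⟨hf, h.nodup⟩
  · intro p hp
    rcases List.mem_cons.1 hp with rfl | hp
    · exact hx
    · exact h.free_cell p hp
  · intro s hs'
    rw [hne s (fun h => hs1 (h ▸ hs')) (fun h => hs (h ▸ hs'))]; exact h.valid s hs'
  · intro p hp
    have hp' := hp
    unfold IsCell at hp'
    rw [hne p (by omega) (by omega), hne (p + 1) (by omega) (by omega)]
    exact h.val_cell p hp
  · intro p hp hpf
    rw [List.mem_cons, not_or] at hpf
    rw [hcnt', hne (p + 2) (by unfold IsCell at hp; omega) (by omega)]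
    have := h.count p hp hpf.2
    rwa [Multiset.count_cons_of_ne hpf.1] at this
  · intro p hp
    rw [hcnt']
    rcases List.mem_cons.1 hp with h' | h'
    · rw [h']; exact hcnt
    · have := h.count_free p h'
      rwa [Multiset.count_cons_of_ne (by rintro rfl; exact hf h')] at this

/-- Reusing a free cell `t` for a new pair. The components that it had before are handed over
to `E`. -/
theorem reuse {t x y : ℕ} {m' : Memory} (h : Inv H K m n (t :: fl) val (x ::ₘ y ::ₘ E))
    (hx : x < H ∨ IsCell H n x) (hy : y < H ∨ IsCell H n y)
    (hm' : m' = Function.update (Function.update (Function.update (Function.update m 1 (m (t + 2)))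
      t x) (t + 1) y) (t + 2) 1) :
    Inv H K m' n fl (Function.update val t (cons (val x) (val y)))
      (t ::ₘ m t ::ₘ m (t + 1) ::ₘ E) := by
  have hH := h.heap_le
  have ht : IsCell H n t := h.free_cell t (by simp)
  have ht' := ht
  unfold IsCell at ht'
  have htf : t ∉ fl := (List.nodup_cons.1 h.nodup).1
  have h0 := h.count_free t (by simp)
  have hs0 : t ∈ slots H K n := by rw [mem_slots]; omega
  have hs1 : t + 1 ∈ slots H K n := by rw [mem_slots]; omega
  have hs2 : t + 2 ∉ slots H K n := by rw [mem_slots]; omega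
  have hs3 : 1 ∉ slots H K n := by rw [mem_slots]; omega
  have hne : ∀ s, s ≠ 1 → s ≠ t → s ≠ t + 1 → s ≠ t + 2 → m' s = m s := fun s h1 h2 h3 h4 => by
    rw [hm', Function.update_of_ne h4, Function.update_of_ne h3, Function.update_of_ne h2,
      Function.update_of_ne h1]
  have hmt : m' t = x := by
    rw [hm', Function.update_of_ne (by omega), Function.update_of_ne (by omega),
      Function.update_self]
  have hmt1 : m' (t + 1) = y := by
    rw [hm', Function.update_of_ne (by omega), Function.update_self]
  have hxt : x ≠ t := fun hh => by simp [hh] at h0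
  have hyt : y ≠ t := fun hh => by simp [hh, Multiset.count_cons] at h0
  have hst : ∀ s ∈ slots H K n, m s ≠ t := fun s hs hh => by
    have := cnt_pos (m := m) hs; rw [hh] at this; omega
  have hcnt : ∀ p, cnt H K n m' p + (m t ::ₘ m (t + 1) ::ₘ E).count p =
      cnt H K n m p + (x ::ₘ y ::ₘ E).count p := fun p => by
    rw [hm', cnt_update_not_mem hs2]
    have h1 := cnt_update_mem (m := Function.update (Function.update m 1 (m (t + 2))) t x)
      (x := y) (p := p) hs1
    have h2 := cnt_update_mem (m := Function.update m 1 (m (t + 2))) (x := x) (p := p) hs0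
    rw [Function.update_of_ne (by omega), Function.update_of_ne (by omega)] at h1
    rw [Function.update_of_ne (by omega), cnt_update_not_mem hs3] at h2
    simp only [Multiset.count_cons]
    simp only [eq_comm (a := p)]
    omega
  have hv : ∀ s ∈ slots H K n, s ≠ t → s ≠ t + 1 → m' s = m s := fun s hs h1 h2 =>
    hne s (fun h => hs3 (h ▸ hs)) h1 h2 (fun h => hs2 (h ▸ hs))
  refine ⟨hH, ?_, ?_, ?_, ?_, (List.nodup_cons.1 h.nodup).2, ?_, ?_, ?_, ?_, ?_, ?_⟩
  · rw [hne _ (by omega) (by omega) (by omega) (by omega), h.const3]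
  · rw [hne _ (by omega) (by omega) (by omega) (by omega), h.const4]
  · rw [hne _ (by omega) (by omega) (by omega) (by omega), h.fresh]
  · have : m' 1 = m (t + 2) := by
      rw [hm', Function.update_of_ne (by omega), Function.update_of_ne (by omega),
        Function.update_of_ne (by omega), Function.update_self]
    rw [this]
    refine h.linked.2.congr fun p hp => ?_
    have hp' := h.free_cell p (by simp [hp])
    have hpt : p ≠ t := fun h => htf (h ▸ hp)
    unfold IsCell at hp'
    exact hne _ (by omega) (by omega) (by omega) (by omega)
  · exact fun p hp => h.free_cell p (by simp [hp])
  · intro s hs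
    by_cases h1 : s = t
    · rw [h1, hmt]; exact hx
    by_cases h2 : s = t + 1
    · rw [h2, hmt1]; exact hy
    rw [hv s hs h1 h2]; exact h.valid s hs
  · intro a ha
    rw [Function.update_of_ne (by omega)]; exact h.val_atom a ha
  · intro p hp
    by_cases h1 : p = t
    · subst h1
      rw [Function.update_self, hmt, hmt1, Function.update_of_ne hxt, Function.update_of_ne hyt]
    · have hp' := hp
      unfold IsCell at hp'
      have e0 : p ∈ slots H K n := by rw [mem_slots]; omega
      have e1 : p + 1 ∈ slots H K n := by rw [mem_slots]; omega
      rw [Function.update_of_ne h1, hv p e0 (by omega) (by omega),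
        hv (p + 1) e1 (by omega) (by omega),
        Function.update_of_ne (hst p e0), Function.update_of_ne (hst _ e1)]
      exact h.val_cell p hp
  · intro p hp hpf
    have := hcnt p
    by_cases h1 : p = t
    · subst h1
      rw [show m' (p + 2) = 1 by rw [hm', Function.update_self], Multiset.count_cons_self]
      omega
    · rw [Multiset.count_cons_of_ne h1, this]
      have hp' := hp
      unfold IsCell at hp'
      rw [hne _ (by omega) (by omega) (by omega) (by omega)]
      exact h.count p hp (by simp [h1, hpf])
  · intro p hp
    have := hcnt p
    rw [Multiset.count_cons_of_ne (by rintro rfl; exact htf hp), this]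
    exact h.count_free p (by simp [hp])

theorem isCell_succ {p : ℕ} : IsCell H (n + 1) p ↔ IsCell H n p ∨ p = H + 3 * n := by
  unfold IsCell; omega

theorem slots_succ (hH : 10 + K ≤ H) :
    slots H K (n + 1) = insert (H + 3 * n) (insert (H + 3 * n + 1) (slots H K n)) := by
  ext s
  simp only [Finset.mem_insert, mem_slots]
  omega

/-- Extending the heap by a new cell for a pair. -/
theorem extend {t x y : ℕ} {m' : Memory} (h : Inv H K m n fl val (x ::ₘ y ::ₘ E))
    (ht : t = H + 3 * n) (hx : x < H ∨ IsCell H n x) (hy : y < H ∨ IsCell H n y)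
    (hE : t ∉ E)
    (hm' : m' = Function.update (Function.update (Function.update (Function.update m 2 (t + 3))
      t x) (t + 1) y) (t + 2) 1) :
    Inv H K m' (n + 1) fl (Function.update val t (cons (val x) (val y))) (t ::ₘ E) := by
  have hH := h.heap_le
  have hs0 : t ∉ slots H K n := by rw [mem_slots]; omega
  have hs1 : t + 1 ∉ slots H K n := by rw [mem_slots]; omega
  have hs2 : t + 2 ∉ slots H K n := by rw [mem_slots]; omega
  have hs3 : 2 ∉ slots H K n := by rw [mem_slots]; omega
  have hne : ∀ s, s ≠ 2 → s ≠ t → s ≠ t + 1 → s ≠ t + 2 → m' s = m s := fun s h1 h2 h3 h4 => by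
    rw [hm', Function.update_of_ne h4, Function.update_of_ne h3, Function.update_of_ne h2,
      Function.update_of_ne h1]
  have hmt : m' t = x := by
    rw [hm', Function.update_of_ne (by omega), Function.update_of_ne (by omega),
      Function.update_self]
  have hmt1 : m' (t + 1) = y := by
    rw [hm', Function.update_of_ne (by omega), Function.update_self]
  have hxt : x ≠ t := by unfold IsCell at hx; omega
  have hyt : y ≠ t := by unfold IsCell at hy; omega
  have hst : ∀ s ∈ slots H K n, m s ≠ t := fun s hs hh => by
    have := h.valid s hs
    unfold IsCell at this
    omega
  have hcnt : ∀ p, cnt H K (n + 1) m' p =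
      cnt H K n m p + (if x = p then 1 else 0) + (if y = p then 1 else 0) := fun p => by
    have e : cnt H K n m' p = cnt H K n m p := by
      rw [hm', cnt_update_not_mem hs2, cnt_update_not_mem hs1, cnt_update_not_mem hs0,
        cnt_update_not_mem hs3]
    rw [← e]
    unfold cnt
    simp only [Finset.card_filter]
    rw [slots_succ hH, ← ht, Finset.sum_insert (by simp [hs0]), Finset.sum_insert hs1, hmt, hmt1]
    omega
  have hv : ∀ s ∈ slots H K n, m' s = m s := fun s hs =>
    hne s (fun h => hs3 (h ▸ hs)) (fun h => hs0 (h ▸ hs)) (fun h => hs1 (h ▸ hs))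
      (fun h => hs2 (h ▸ hs))
  have hmono : ∀ z, (z < H ∨ IsCell H n z) → (z < H ∨ IsCell H (n + 1) z) := fun z hz => by
    rw [isCell_succ]; tauto
  refine ⟨hH, ?_, ?_, ?_, ?_, h.nodup, ?_, ?_, ?_, ?_, ?_, ?_⟩
  · rw [hne _ (by omega) (by omega) (by omega) (by omega), h.const3]
  · rw [hne _ (by omega) (by omega) (by omega) (by omega), h.const4]
  · rw [hm', Function.update_of_ne (by omega), Function.update_of_ne (by omega),
      Function.update_of_ne (by omega), Function.update_self]
    omega
  · rw [hne _ (by omega) (by omega) (by omega) (by omega)]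
    refine h.linked.congr fun p hp => ?_
    have hp' := h.free_cell p hp
    unfold IsCell at hp'
    exact hne _ (by omega) (by omega) (by omega) (by omega)
  · exact fun p hp => isCell_succ.2 (.inl (h.free_cell p hp))
  · intro s hs
    rw [slots_succ hH, ← ht, Finset.mem_insert, Finset.mem_insert] at hs
    rcases hs with rfl | rfl | hs
    · rw [hmt]; exact hmono x hx
    · rw [hmt1]; exact hmono y hy
    · rw [hv s hs]; exact hmono _ (h.valid s hs)
  · intro a ha
    rw [Function.update_of_ne (by omega)]; exact h.val_atom a ha
  · intro p hp
    rw [isCell_succ, ← ht] at hp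
    by_cases h1 : p = t
    · subst h1
      rw [Function.update_self, hmt, hmt1, Function.update_of_ne hxt, Function.update_of_ne hyt]
    · replace hp := hp.resolve_right h1
      have hp' := hp
      unfold IsCell at hp'
      have e0 : p ∈ slots H K n := by rw [mem_slots]; omega
      have e1 : p + 1 ∈ slots H K n := by rw [mem_slots]; omega
      rw [Function.update_of_ne h1, hv p e0, hv (p + 1) e1,
        Function.update_of_ne (hst p e0), Function.update_of_ne (hst _ e1)]
      exact h.val_cell p hp
  · intro p hp hpf
    rw [isCell_succ, ← ht] at hp
    rw [hcnt]
    by_cases h1 : p = t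
    · subst h1
      have : cnt H K n m p = 0 := by
        unfold cnt
        rw [Finset.card_eq_zero, Finset.filter_eq_empty_iff]
        exact hst
      rw [show m' (p + 2) = 1 by rw [hm', Function.update_self], Multiset.count_cons_self,
        Multiset.count_eq_zero_of_notMem hE, this, if_neg hxt, if_neg hyt]
      omega
    · replace hp := hp.resolve_right h1
      have := h.count p hp hpf
      have hp' := hp
      unfold IsCell at hp'
      rw [hne _ (by omega) (by omega) (by omega) (by omega)]
      simp only [Multiset.count_cons, if_neg h1] at this ⊢
      simp only [eq_comm (a := p)] at this
      omega
  · intro p hp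
    have h1 : p ≠ t := by have := h.free_cell p hp; unfold IsCell at this; omega
    have := h.count_free p hp
    rw [hcnt]
    simp only [Multiset.count_cons, if_neg h1] at this ⊢
    simp only [eq_comm (a := p)] at this
    omega

/-- The S-expressions of the components are smaller; hence there are no cycles in the heap. -/
theorem size_lt {p : ℕ} (h : Inv H K m n fl val E) (hp : IsCell H n p) :
    (val (m p)).size < (val p).size ∧ (val (m (p + 1))).size < (val p).size := by
  rw [h.val_cell p hp]
  simp only [size]
  omega

end Inv

/-- The cells that can be reached from a register content. -/
inductive Reach (H n : ℕ) (m : Memory) : ℕ → ℕ → Prop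
  | refl {p : ℕ} : IsCell H n p → Reach H n m p p
  | car {x p : ℕ} : IsCell H n p → Reach H n m x p → IsCell H n (m p) → Reach H n m x (m p)
  | cdr {x p : ℕ} : IsCell H n p → Reach H n m x p → IsCell H n (m (p + 1)) →
      Reach H n m x (m (p + 1))

/-- The number of cells that can be reached is bounded by the size of the S-expression. -/
theorem Inv.exists_reach (h : Inv H K m n fl val E) (x : ℕ) :
    ∃ s : Finset ℕ, s.card ≤ (val x).size ∧ ∀ p, Reach H n m x p → p ∈ s := by
  induction hk : (val x).size using Nat.strong_induction_on generalizing x with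
  | _ k ih =>
  by_cases hx : IsCell H n x
  · obtain ⟨s, hs, hs'⟩ := ih _ (hk ▸ (h.size_lt hx).1) (m x) rfl
    obtain ⟨t, ht, ht'⟩ := ih _ (hk ▸ (h.size_lt hx).2) (m (x + 1)) rfl
    refine ⟨insert x (s ∪ t), ?_, ?_⟩
    · rw [← hk, h.val_cell x hx]
      refine (Finset.card_insert_le _ _).trans ?_
      have := Finset.card_union_le s t
      simp only [size]
      omega
    · intro p hp
      have : p = x ∨ Reach H n m (m x) p ∨ Reach H n m (m (x + 1)) p := by
        induction hp with
        | refl _ => exact .inl rfl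
        | @car p hc _ hc' ih' =>
          rcases ih' with rfl | h' | h'
          · exact .inr (.inl (.refl hc'))
          · exact .inr (.inl (.car hc h' hc'))
          · exact .inr (.inr (.car hc h' hc'))
        | @cdr p hc _ hc' ih' =>
          rcases ih' with rfl | h' | h'
          · exact .inr (.inr (.refl hc'))
          · exact .inr (.inl (.cdr hc h' hc'))
          · exact .inr (.inr (.cdr hc h' hc'))
      simp only [Finset.mem_insert, Finset.mem_union]
      exact this.imp id (Or.imp (hs' p) (ht' p))
  · refine ⟨∅, by simp, fun p hp => absurd ?_ hx⟩
    clear ih hk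
    induction hp <;> tauto

/-- If there are no free cells and no outstanding references, then all cells can be reached from
the variables: a cell is referenced by a variable or by a cell of larger size. -/
theorem Inv.reach_of_full (h : Inv H K m n [] val 0) {p : ℕ} (hp : IsCell H n p) :
    ∃ i < K, Reach H n m (m (10 + i)) p := by
  obtain ⟨M, hM⟩ : ∃ M, ∀ p, IsCell H n p → (val p).size ≤ M := by
    refine ⟨(Finset.range (H + 3 * n)).sup fun p => (val p).size, fun p hp => ?_⟩
    exact Finset.le_sup (f := fun p => (val p).size) (Finset.mem_range.2 hp.2.1)
  -- The sizes of the referencing cells increase strictly, and they are bounded by `M`.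
  induction hk : M - (val p).size using Nat.strong_induction_on generalizing p with
  | _ k ih =>
  have h1 := h.count p hp (by simp)
  have h2 : 0 < cnt H K n m p := by
    have := Multiset.count_zero p
    omega
  obtain ⟨s, hs⟩ := Finset.card_pos.1 h2
  rw [Finset.mem_filter, mem_slots] at hs
  obtain ⟨⟨h3, h4⟩, rfl⟩ := hs
  by_cases h5 : 10 ≤ s ∧ s < 10 + K
  · exact ⟨s - 10, by omega, by rw [show 10 + (s - 10) = s by omega]; exact .refl hp⟩
  · replace h4 := h4.resolve_left h5
    rcases Nat.lt_or_ge ((s - H) % 3) 1 with h6 | h6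
    · have hc : IsCell H n s := by unfold IsCell; omega
      have := (h.size_lt hc).1
      have := hM s hc
      obtain ⟨i, hi, hr⟩ := ih (M - (val s).size) (by omega) hc rfl
      exact ⟨i, hi, .car hc hr hp⟩
    · obtain ⟨q, rfl⟩ : ∃ q, s = q + 1 := ⟨s - 1, by omega⟩
      have hc : IsCell H n q := by unfold IsCell; omega
      have := (h.size_lt hc).2
      have := hM q hc
      obtain ⟨i, hi, hr⟩ := ih (M - (val q).size) (by omega) hc rfl
      exact ⟨i, hi, .cdr hc hr hp⟩

/-- When the free list is empty, the size of the heap is bounded by the size of its contents. So it is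
only extended as far as the contents require. -/
theorem Inv.card_le_of_full (h : Inv H K m n [] val 0) :
    n ≤ ∑ i ∈ Finset.range K, (val (m (10 + i))).size := by
  choose s hs hs' using h.exists_reach
  have : (Finset.range n).image (H + 3 * ·) ⊆ (Finset.range K).biUnion fun i => s (m (10 + i)) := by
    intro p hp
    obtain ⟨j, hj, rfl⟩ := Finset.mem_image.1 hp
    have hc : IsCell H n (H + 3 * j) := by
      rw [Finset.mem_range] at hj
      unfold IsCell; omega
    obtain ⟨i, hi, hr⟩ := h.reach_of_full hc
    exact Finset.mem_biUnion.2 ⟨i, Finset.mem_range.2 hi, hs' _ _ hr⟩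
  calc n = ((Finset.range n).image (H + 3 * ·)).card := by
        rw [Finset.card_image_of_injective _ (fun a b hab => by simpa using hab),
          Finset.card_range]
    _ ≤ _ := Finset.card_le_card this
    _ ≤ ∑ i ∈ Finset.range K, (s (m (10 + i))).card := Finset.card_biUnion_le
    _ ≤ _ := Finset.sum_le_sum fun i _ => hs _

end RAM

/-! ### Reference counting and allocation -/

namespace RAM

open SExp Cmd

variable {H K n : ℕ} {m : Memory} {fl : List ℕ} {val : ℕ → SExp} {E : Multiset ℕ}

namespace Cmd

variable {B r s t v : ℕ} {d : Cmd} {Q : Memory → Prop}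

theorem seq_const (hr : r < B) (hv : v < B) (h : d.wp B Q (Function.update m r v)) :
    (seq (const r v) d).wp B Q m := ⟨hr, hv, h⟩

theorem seq_copy (v : ℕ) (hr : r < B) (hs : s < B) (hv : m s = v)
    (h : d.wp B Q (Function.update m r v)) : (seq (copy r s) d).wp B Q m := by
  subst hv; exact ⟨hr, hs, h⟩

theorem seq_add (v : ℕ) (hr : r < B) (hs : s < B) (ht : t < B) (hv : m s + m t = v) (hB : v < B)
    (h : d.wp B Q (Function.update m r v)) : (seq (arith .add r s t) d).wp B Q m := by
  subst hv; exact ⟨hr, hs, ht, hB, h⟩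

theorem seq_sub (v : ℕ) (hr : r < B) (hs : s < B) (ht : t < B) (hv : m s - m t = v) (hB : v < B)
    (h : d.wp B Q (Function.update m r v)) : (seq (arith .sub r s t) d).wp B Q m := by
  subst hv; exact ⟨hr, hs, ht, hB, h⟩

theorem seq_load (a v : ℕ) (hr : r < B) (hs : s < B) (ha : m s = a) (hB : a < B) (hv : m a = v)
    (h : d.wp B Q (Function.update m r v)) : (seq (load r s) d).wp B Q m := by
  subst ha hv; exact ⟨hr, hs, hB, h⟩

theorem seq_store (a v : ℕ) (hr : r < B) (hs : s < B) (ha : m r = a) (hB : a < B) (hv : m s = v)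
    (h : d.wp B Q (Function.update m a v)) : (seq (store r s) d).wp B Q m := by
  subst ha hv; exact ⟨hr, hs, hB, h⟩

end Cmd

/-- Counting one more reference to the content of register `a`. This content is an atom, which needs
no count, if and only if it is below `H`, that is, if adding `1` and subtracting `H` with truncation
yields `0`. -/
def incref (a : ℕ) : Cmd :=
  block [.arith .add 9 a 4, .arith .sub 9 9 3, .ifz 9 .skip
    (block [.arith .add 9 a 4, .arith .add 9 9 4, .load 8 9, .arith .add 8 8 4, .store 9 8])]

/-- Counting one reference less to the content of register `a`; a cell that has no references any
more is prepended to the free list. Its components keep their counts until the cell is reused, so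
that no cascade of releases can occur. -/
def decref (a : ℕ) : Cmd :=
  block [.arith .add 9 a 4, .arith .sub 9 9 3, .ifz 9 .skip
    (block [.arith .add 9 a 4, .arith .add 9 9 4, .load 8 9, .arith .sub 8 8 4, .ifz 8
      (block [.copy 8 1, .store 9 8, .copy 1 a]) (.store 9 8)])]

/-- The register `a` is one of the scratch registers 5, 6, 7, which are preserved. -/
theorem wp_incref {B a : ℕ} {Q : Memory → Prop} (h : Inv H K m n fl val E)
    (hB : H + 3 * n < B) (hE : E.card ≤ 5) (ha : 5 ≤ a ∧ a < 8) (hx : m a < H ∨ IsCell H n (m a))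
    (hf : m a ∉ fl)
    (hQ : ∀ m', Inv H K m' n fl val (m a ::ₘ E) →
      (∀ s, (5 ≤ s ∧ s < 8) ∨ (10 ≤ s ∧ s < H) → m' s = m s) → Q m') :
    (incref a).wp B Q m := by
  have hH := h.heap_le
  have h3 := h.const3
  have h4 := h.const4
  have hxB : m a + 1 < B := by unfold IsCell at hx; omega
  simp (disch := omega) only [incref, block, List.foldr, wp, Arith.eval, Function.update_self,
    Function.update_of_ne, h3, h4, Function.update_idem]
  repeat refine ⟨by omega, ?_⟩
  refine ⟨fun h0 => ?_, fun h0 => ?_⟩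
  · refine hQ _ ((Inv.cons_atom (by omega)).2 (h.congr fun s _ _ => ?_)) fun s hs => ?_
    · rw [Function.update_of_ne (by omega)]
    · rw [Function.update_of_ne (by omega)]
  · have hc : IsCell H n (m a) := hx.resolve_left (by omega)
    have hcount := h.count _ hc hf
    have hcnt := cnt_le (H := H) (K := K) (n := n) (m := m) (m a)
    have hEc := Multiset.count_le_card (m a) E
    have hc' := hc
    unfold IsCell at hc'
    have e1 : m a + 1 + 1 = m a + 2 := rfl
    simp (disch := omega) only [e1, Function.update_of_ne]
    repeat refine ⟨by omega, ?_⟩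
    refine hQ _ ((h.setCount (E' := m a ::ₘ E) hc hf (c := m (m a + 2) + 1) ?_ (by omega)
      fun p hp => Multiset.count_cons_of_ne hp _).congr fun s _ _ => ?_) fun s hs => ?_
    · rw [Multiset.count_cons_self]; omega
    · by_cases hs : s = m a + 2
      · subst hs; simp
      · simp (disch := omega) only [Function.update_of_ne]
    · simp (disch := omega) only [Function.update_of_ne]

/-- The register `a` is one of the scratch registers 5, 6, 7, which are preserved. -/
theorem wp_decref {B a : ℕ} {Q : Memory → Prop} (h : Inv H K m n fl val (m a ::ₘ E))
    (hB : H + 3 * n < B) (hE : E.card ≤ 5) (ha : 5 ≤ a ∧ a < 8) (hx : m a < H ∨ IsCell H n (m a))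
    (hQ : ∀ m' fl', Inv H K m' n fl' val E →
      (∀ s, (5 ≤ s ∧ s < 8) ∨ (10 ≤ s ∧ s < H) → m' s = m s) → Q m') :
    (decref a).wp B Q m := by
  have hH := h.heap_le
  have h3 := h.const3
  have h4 := h.const4
  have hxB : m a + 1 < B := by unfold IsCell at hx; omega
  simp only [decref, block, List.foldr]
  refine seq_add (m a + 1) (by omega) (by omega) (by omega) (by rw [h4]) (by omega) ?_
  refine seq_sub (m a + 1 - H) (by omega) (by omega) (by omega)
    (by simp (disch := omega) only [Function.update_self, Function.update_of_ne, h3]) (by omega) ?_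
  rw [Function.update_idem]
  refine ⟨by omega, fun h0 => ?_, fun h0 => ?_⟩
  all_goals rw [Function.update_self] at h0
  · refine hQ _ _ (((Inv.cons_atom (by omega)).1 h).congr fun s _ _ => ?_) fun s hs => ?_
    · rw [Function.update_of_ne (by omega)]
    · rw [Function.update_of_ne (by omega)]
  · have hc : IsCell H n (m a) := hx.resolve_left (by omega)
    have hf : m a ∉ fl := fun hf => by
      have := h.count_free _ hf
      rw [Multiset.count_cons_self] at this
      omega
    have hcount := h.count _ hc hf
    rw [Multiset.count_cons_self] at hcount
    have hcnt := cnt_le (H := H) (K := K) (n := n) (m := m) (m a)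
    have hEc := Multiset.count_le_card (m a) E
    have hc' := hc
    unfold IsCell at hc'
    have e1 : m a + 1 + 1 = m a + 2 := rfl
    refine seq_add (m a + 1) (by omega) (by omega) (by omega)
      (by simp (disch := omega) only [Function.update_of_ne, h4]) (by omega) ?_
    rw [Function.update_idem]
    refine seq_add (m a + 2) (by omega) (by omega) (by omega)
      (by simp (disch := omega) only [Function.update_self, Function.update_of_ne, h4])
      (by omega) ?_
    rw [Function.update_idem]
    refine seq_load (m a + 2) (m (m a + 2)) (by omega) (by omega)
      (by rw [Function.update_self]) (by omega) (by rw [Function.update_of_ne (by omega)]) ?_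
    refine seq_sub (m (m a + 2) - 1) (by omega) (by omega) (by omega)
      (by simp (disch := omega) only [Function.update_self, Function.update_of_ne, h4])
      (by omega) ?_
    rw [Function.update_idem]
    refine ⟨by omega, fun h1 => ?_, fun h1 => ?_⟩
    all_goals rw [Function.update_self] at h1
    · refine seq_copy (m 1) (by omega) (by omega)
        (by simp (disch := omega) only [Function.update_of_ne]) ?_
      rw [Function.update_idem]
      refine seq_store (m a + 2) (m 1) (by omega) (by omega)
        (by simp (disch := omega) only [Function.update_self, Function.update_of_ne]) (by omega)
        (by rw [Function.update_self]) ?_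
      refine seq_copy (m a) (by omega) (by omega)
        (by simp (disch := omega) only [Function.update_of_ne]) ?_
      refine hQ _ _ ((h.free hc hf rfl (by omega)).congr fun s _ _ => ?_) fun s hs => ?_
      · by_cases hs1 : s = 1
        · subst hs1; simp (disch := omega) only [Function.update_self]
        by_cases hs : s = m a + 2
        · subst hs; simp (disch := omega) only [Function.update_of_ne, Function.update_self]
        · simp (disch := omega) only [Function.update_of_ne]
      · simp (disch := omega) only [Function.update_of_ne]
    · refine seq_store (d := .skip) (m a + 2) (m (m a + 2) - 1) (by omega) (by omega)
        (by simp (disch := omega) only [Function.update_self, Function.update_of_ne]) (by omega)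
        (by rw [Function.update_self]) ?_
      refine hQ _ _ ((h.setCount (E' := E) hc hf (c := m (m a + 2) - 1) (by omega) (by omega)
        fun p hp => (Multiset.count_cons_of_ne hp _).symm).congr fun s _ _ => ?_) fun s hs => ?_
      · by_cases hs : s = m a + 2
        · subst hs; simp (disch := omega) only [Function.update_self]
        · simp (disch := omega) only [Function.update_of_ne]
      · simp (disch := omega) only [Function.update_of_ne]

/-- Storing the pair of the contents of the registers 5 and 6 in a new or reused cell; its address
is put into register 7. The references of a reused cell are moved to the registers 5 and 6. -/
def alloc : Cmd :=
  .ifz 1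
    (block [.copy 7 2, .store 7 5, .arith .add 9 7 4, .store 9 6, .arith .add 9 9 4, .store 9 4,
      .arith .add 2 9 4, .const 5 0, .const 6 0])
    (block [.copy 7 1, .load 8 7, .store 7 5, .copy 5 8, .arith .add 9 7 4, .load 8 9, .store 9 6,
      .copy 6 8, .arith .add 9 9 4, .load 1 9, .store 9 4])

/-- After the allocation, the registers 5 and 6 contain outstanding references, which are to be
released; they are `0` if the cell is new. -/
theorem wp_alloc {B : ℕ} {Q : Memory → Prop} (h : Inv H K m n fl val {m 5, m 6})
    (hB : H + 3 * n < B) (hfull : fl = [] → H + 3 * (n + 1) < B)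
    (h5 : m 5 < H ∨ IsCell H n (m 5)) (h6 : m 6 < H ∨ IsCell H n (m 6))
    (hQ : ∀ m' n' fl' val', (n' = n ∨ fl = [] ∧ n' = n + 1) →
      Inv H K m' n' fl' val' {m' 7, m' 5, m' 6} →
      val' (m' 7) = cons (val (m 5)) (val (m 6)) → (∀ i < K, val' (m (10 + i)) = val (m (10 + i))) →
      (m' 5 < H ∨ IsCell H n' (m' 5)) → (m' 6 < H ∨ IsCell H n' (m' 6)) →
      (m' 7 < H ∨ IsCell H n' (m' 7)) →
      (∀ s, 10 ≤ s ∧ s < H → m' s = m s) → Q m') :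
    alloc.wp B Q m := by
  have hH := h.heap_le
  have h3 := h.const3
  have h4 := h.const4
  have h2 := h.fresh
  have hmem : ∀ i < K, 10 + i ∈ slots H K n := fun i hi => by rw [mem_slots]; omega
  have hE : ({m 5, m 6} : Multiset ℕ) = m 5 ::ₘ m 6 ::ₘ 0 := rfl
  rw [hE] at h
  refine ⟨by omega, fun h0 => ?_, fun h0 => ?_⟩
  -- There is no free cell: the heap is extended by a cell at `t`.
  · have hfl : fl = [] := by
      cases fl with
      | nil => rfl
      | cons p l =>
        have := h.linked.1
        have := h.free_cell p (by simp)
        unfold IsCell at this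
        omega
    have hB' := hfull hfl
    obtain ⟨t, ht⟩ : ∃ t, t = H + 3 * n := ⟨_, rfl⟩
    simp only [block, List.foldr]
    refine seq_copy t (by omega) (by omega) (h2.trans ht.symm) ?_
    refine seq_store t (m 5) (by omega) (by omega)
      (by simp (disch := omega) only [Function.update_self]) (by omega)
      (by simp (disch := omega) only [Function.update_of_ne]) ?_
    refine seq_add (t + 1) (by omega) (by omega) (by omega)
      (by simp (disch := omega) only [Function.update_self, Function.update_of_ne, h4])
      (by omega) ?_
    refine seq_store (t + 1) (m 6) (by omega) (by omega)
      (by simp (disch := omega) only [Function.update_self]) (by omega)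
      (by simp (disch := omega) only [Function.update_of_ne]) ?_
    refine seq_add (t + 2) (by omega) (by omega) (by omega)
      (by simp (disch := omega) only [Function.update_self, Function.update_of_ne, h4])
      (by omega) ?_
    refine seq_store (t + 2) 1 (by omega) (by omega)
      (by simp (disch := omega) only [Function.update_self]) (by omega)
      (by simp (disch := omega) only [Function.update_of_ne, h4]) ?_
    refine seq_add (t + 3) (by omega) (by omega) (by omega)
      (by simp (disch := omega) only [Function.update_self, Function.update_of_ne, h4])
      (by omega) ?_
    refine seq_const (by omega) (by omega) (seq_const (by omega) (by omega) ?_)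
    have key := h.extend (t := t) (m' := Function.update (Function.update (Function.update
      (Function.update m 2 (t + 3)) t (m 5)) (t + 1) (m 6)) (t + 2) 1) ht h5 h6 (by simp) rfl
    refine hQ _ (n + 1) fl (Function.update val t (cons (val (m 5)) (val (m 6)))) (.inr ⟨hfl, rfl⟩)
      ?_ ?_ ?_ ?_ ?_ ?_ ?_
    · simp (disch := omega) only [Function.update_self, Function.update_of_ne]
      change Inv H K _ _ _ _ (t ::ₘ 0 ::ₘ 0 ::ₘ 0)
      rw [Multiset.cons_swap, Inv.cons_atom (by omega), Multiset.cons_swap,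
        Inv.cons_atom (by omega)]
      refine key.congr fun s hs hs' => ?_
      by_cases e2 : s = 2
      · subst e2; simp (disch := omega) only [Function.update_self, Function.update_of_ne]
      by_cases e0 : s = t
      · subst e0; simp (disch := omega) only [Function.update_self, Function.update_of_ne]
      by_cases e1 : s = t + 1
      · subst e1; simp (disch := omega) only [Function.update_self, Function.update_of_ne]
      by_cases e3 : s = t + 2
      · subst e3; simp (disch := omega) only [Function.update_self, Function.update_of_ne]
      simp (disch := omega) only [Function.update_of_ne]
    · simp (disch := omega) only [Function.update_self, Function.update_of_ne]
    · intro i hi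
      rw [Function.update_of_ne]
      have := h.valid _ (hmem i hi)
      unfold IsCell at this
      omega
    · left; simp; omega
    · left; simp; omega
    · right
      simp (disch := omega) only [Function.update_self, Function.update_of_ne]
      unfold IsCell; omega
    · intro s hs
      simp (disch := omega) only [Function.update_of_ne]
  -- The first free cell `t` is reused.
  · obtain ⟨t, l, rfl⟩ : ∃ t l, fl = t :: l := by
      cases fl with
      | nil => exact absurd h.linked h0
      | cons p l => exact ⟨p, l, rfl⟩
    have ht : m 1 = t := h.linked.1
    have htc := h.free_cell t (by simp)
    have htc' := htc
    unfold IsCell at htc'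
    simp only [block, List.foldr]
    refine seq_copy t (by omega) (by omega) ht ?_
    refine seq_load t (m t) (by omega) (by omega) (by rw [Function.update_self]) (by omega)
      (by rw [Function.update_of_ne (by omega)]) ?_
    refine seq_store t (m 5) (by omega) (by omega)
      (by simp (disch := omega) only [Function.update_self, Function.update_of_ne]) (by omega)
      (by simp (disch := omega) only [Function.update_of_ne]) ?_
    refine seq_copy (m t) (by omega) (by omega)
      (by simp (disch := omega) only [Function.update_self, Function.update_of_ne]) ?_
    refine seq_add (t + 1) (by omega) (by omega) (by omega)
      (by simp (disch := omega) only [Function.update_self, Function.update_of_ne, h4])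
      (by omega) ?_
    refine seq_load (t + 1) (m (t + 1)) (by omega) (by omega) (by rw [Function.update_self])
      (by omega) (by simp (disch := omega) only [Function.update_of_ne]) ?_
    refine seq_store (t + 1) (m 6) (by omega) (by omega)
      (by simp (disch := omega) only [Function.update_self, Function.update_of_ne]) (by omega)
      (by simp (disch := omega) only [Function.update_of_ne]) ?_
    refine seq_copy (m (t + 1)) (by omega) (by omega)
      (by simp (disch := omega) only [Function.update_self, Function.update_of_ne]) ?_
    refine seq_add (t + 2) (by omega) (by omega) (by omega)
      (by simp (disch := omega) only [Function.update_self, Function.update_of_ne, h4])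
      (by omega) ?_
    refine seq_load (t + 2) (m (t + 2)) (by omega) (by omega) (by rw [Function.update_self])
      (by omega) (by simp (disch := omega) only [Function.update_of_ne]) ?_
    refine seq_store (t + 2) 1 (by omega) (by omega)
      (by simp (disch := omega) only [Function.update_self, Function.update_of_ne]) (by omega)
      (by simp (disch := omega) only [Function.update_of_ne, h4]) ?_
    have key := h.reuse h5 h6 rfl
    have hs0 : t ∈ slots H K n := by rw [mem_slots]; omega
    have hs1 : t + 1 ∈ slots H K n := by rw [mem_slots]; omega
    refine hQ _ n l (Function.update val t (cons (val (m 5)) (val (m 6)))) (.inl rfl)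
      ?_ ?_ ?_ ?_ ?_ ?_ ?_
    · simp (disch := omega) only [Function.update_self, Function.update_of_ne]
      refine key.congr fun s hs hs' => ?_
      by_cases e2 : s = 1
      · subst e2; simp (disch := omega) only [Function.update_self, Function.update_of_ne]
      by_cases e0 : s = t
      · subst e0; simp (disch := omega) only [Function.update_self, Function.update_of_ne]
      by_cases e1 : s = t + 1
      · subst e1; simp (disch := omega) only [Function.update_self, Function.update_of_ne]
      by_cases e3 : s = t + 2
      · subst e3; simp (disch := omega) only [Function.update_self]
      simp (disch := omega) only [Function.update_of_ne]
    · simp (disch := omega) only [Function.update_self, Function.update_of_ne]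
    · intro i hi
      rw [Function.update_of_ne]
      intro hh
      have := h.not_mem_free (hmem i hi)
      simp [hh] at this
    · simp (disch := omega) only [Function.update_self, Function.update_of_ne]
      exact h.valid t hs0
    · simp (disch := omega) only [Function.update_self, Function.update_of_ne]
      exact h.valid (t + 1) hs1
    · right
      simp (disch := omega) only [Function.update_self, Function.update_of_ne]
      exact htc
    · intro s hs
      simp (disch := omega) only [Function.update_of_ne]

end RAM

/-! ### Expressions on S-expressions, and their evaluation by the machine -/

/-- Expressions that compute S-expressions without recursion. Variables are de Bruijn indices. -/
inductive Code where
  | var (i : ℕ)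
  | atom (a : ℕ)
  | cons (e f : Code)
  | car (e : Code)
  | cdr (e : Code)
  /-- if the value of `e` is the atom `a`, then `f`, else `g` -/
  | ite (e : Code) (a : ℕ) (f g : Code)
  /-- the value of `f`, where the value of `e` becomes variable 0 -/
  | bind (e f : Code)

namespace SExp

/-- The first component; that of an atom is `0` by convention. -/
def car : SExp → SExp
  | atom _ => atom 0
  | cons a _ => a

/-- The second component; that of an atom is `0` by convention. -/
def cdr : SExp → SExp
  | atom _ => atom 0
  | cons _ b => b

/-- Whether an S-expression is the atom `a`. -/
def isAtom (a : ℕ) : SExp → Bool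
  | atom b => b == a
  | cons _ _ => false

theorem size_car_le (t : SExp) : t.car.size ≤ t.size := by
  cases t <;> simp [car, size]; omega

theorem size_cdr_le (t : SExp) : t.cdr.size ≤ t.size := by
  cases t <;> simp [cdr, size]; omega

end SExp

namespace Code

open SExp

/-- The value of an expression in an environment. -/
def eval : Code → List SExp → SExp
  | var i, env => env.getD i (.atom 0)
  | atom a, _ => .atom a
  | cons e f, env => .cons (e.eval env) (f.eval env)
  | car e, env => (e.eval env).car
  | cdr e, env => (e.eval env).cdr
  | ite e a f g, env => bif (e.eval env).isAtom a then f.eval env else g.eval env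
  | bind e f, env => f.eval (e.eval env :: env)

/-- The number of machine variables needed for the evaluation. -/
def height : Code → ℕ
  | var _ => 1
  | atom _ => 1
  | cons e f => max e.height (f.height + 1)
  | car e => e.height
  | cdr e => e.height
  | ite e _ f g => max e.height (max f.height g.height)
  | bind e f => max e.height (f.height + 1)

/-- A strict upper bound for the constants. -/
def bound : Code → ℕ
  | var _ => 0
  | atom a => a + 1
  | cons e f => max e.bound f.bound
  | car e => e.bound
  | cdr e => e.bound
  | ite e a f g => max (a + 1) (max e.bound (max f.bound g.bound))
  | bind e f => max e.bound f.bound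

/-- A factor that bounds the growth of sizes in the evaluation. -/
def factor : Code → ℕ
  | var _ => 1
  | atom _ => 1
  | cons e f => e.factor + f.factor + 1
  | car e => e.factor
  | cdr e => e.factor
  | ite e _ f g => e.factor + f.factor + g.factor
  | bind e f => f.factor * (e.factor + 1)

theorem height_pos (e : Code) : 0 < e.height := by
  induction e <;> simp [height] <;> omega

theorem factor_pos (e : Code) : 0 < e.factor := by
  induction e <;> simp [factor] <;> omega

theorem size_eval_le (e : Code) {env : List SExp} {z : ℕ} (hz : 0 < z)
    (h : ∀ t ∈ env, t.size ≤ z) : (e.eval env).size ≤ e.factor * z := by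
  induction e generalizing env z with
  | var i =>
    simp only [eval, factor, one_mul]
    by_cases hi : i < env.length
    · rw [List.getD_eq_getElem _ _ hi]; exact h _ (List.getElem_mem hi)
    · rw [List.getD_eq_default _ _ (by omega)]; exact hz
  | atom a => simp only [eval, factor, size]; omega
  | cons e f he hf =>
    have := he hz h
    have := hf hz h
    simp only [eval, factor, size, add_mul]; omega
  | car e he => exact (size_car_le _).trans (he hz h)
  | cdr e he => exact (size_cdr_le _).trans (he hz h)
  | ite e a f g he hf hg =>
    have := hf hz h
    have := hg hz h
    simp only [eval, factor, add_mul]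
    cases (e.eval env).isAtom a <;> simp only [cond_true, cond_false] <;> omega
  | bind e f he hf =>
    have := he hz h
    simp only [eval, factor]
    rw [mul_assoc]
    refine hf (Nat.mul_pos (by omega) hz) fun t ht => ?_
    rw [add_mul]
    rcases List.mem_cons.1 ht with rfl | ht
    · omega
    · have := h t ht; omega

end Code

namespace RAM

open SExp Cmd

/-- The machine represents the S-expressions `ρ 0, …, ρ (K - 1)` in its `K` variables, with at most
`N` cells in the heap. -/
def Heap (H K N : ℕ) (m : Memory) (ρ : ℕ → SExp) : Prop :=
  ∃ n ≤ N, ∃ fl val, Inv H K m n fl val 0 ∧ ∀ i < K, val (m (10 + i)) = ρ i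

variable {H K N B n : ℕ} {m : Memory} {fl : List ℕ} {val : ℕ → SExp} {E : Multiset ℕ}
  {ρ : ℕ → SExp} {Q : Memory → Prop}

theorem Inv.mem_slots_var (h : Inv H K m n fl val E) {i : ℕ} (hi : i < K) :
    10 + i ∈ slots H K n := by
  have := h.heap_le
  rw [mem_slots]; omega

theorem Inv.eq_of_val_eq_atom (h : Inv H K m n fl val E) {x a : ℕ} (hx : x < H ∨ IsCell H n x)
    (hv : val x = atom a) : x = a := by
  rcases hx with hx | hx
  · rw [h.val_atom x hx] at hv; exact SExp.atom.inj hv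
  · rw [h.val_cell x hx] at hv; cases hv

/-- Copying variable `j` to the empty variable `s`. -/
def copyVar (j s : ℕ) : Cmd := block [.copy 5 (10 + j), incref 5, .copy (10 + s) 5]

theorem wp_copyVar {j s : ℕ} (h : Heap H K N m ρ) (hB : H + 3 * N < B) (hj : j < K) (hs : s < K)
    (h0 : ρ s = atom 0) (hQ : ∀ m', Heap H K N m' (Function.update ρ s (ρ j)) → Q m') :
    (copyVar j s).wp B Q m := by
  obtain ⟨n, hn, fl, val, h, hρ⟩ := h
  have hH := h.heap_le
  have hv := h.valid _ (h.mem_slots_var hj)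
  have hs0 : m (10 + s) = 0 :=
    h.eq_of_val_eq_atom (h.valid _ (h.mem_slots_var hs)) (by rw [hρ s hs, h0])
  simp only [copyVar, block, List.foldr]
  refine seq_copy (m (10 + j)) (by omega) (by omega) rfl ?_
  have h1 : Inv H K (Function.update m 5 (m (10 + j))) n fl val 0 :=
    h.congr fun s _ _ => Function.update_of_ne (by omega) _ _
  refine wp_incref h1 (by omega) (by simp) (by omega) (by simpa using hv)
    (by simpa using h.not_mem_free (h.mem_slots_var hj)) fun m2 h2 hf => ?_
  have e5 : m2 5 = m (10 + j) := by rw [hf 5 (by omega), Function.update_self]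
  have ev : ∀ i < K, m2 (10 + i) = m (10 + i) := fun i hi => by
    rw [hf _ (by omega), Function.update_of_ne (by omega)]
  rw [Function.update_self] at h2
  refine seq_copy (m (10 + j)) (by omega) (by omega) e5 (hQ _ ?_)
  have h3 := h2.setVar hs hv
  rw [ev s hs, hs0, Inv.cons_atom (by omega)] at h3
  refine ⟨n, hn, fl, val, h3, fun i hi => ?_⟩
  by_cases his : i = s
  · subst his; rw [Function.update_self, Function.update_self, hρ j hj]
  · rw [Function.update_of_ne (by omega), Function.update_of_ne his, ev i hi, hρ i hi]

theorem wp_constVar {a s : ℕ} (h : Heap H K N m ρ) (hB : H + 3 * N < B) (ha : a < H) (hs : s < K)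
    (h0 : ρ s = atom 0) (hQ : ∀ m', Heap H K N m' (Function.update ρ s (atom a)) → Q m') :
    (Cmd.const (10 + s) a).wp B Q m := by
  obtain ⟨n, hn, fl, val, h, hρ⟩ := h
  have hH := h.heap_le
  have hs0 : m (10 + s) = 0 :=
    h.eq_of_val_eq_atom (h.valid _ (h.mem_slots_var hs)) (by rw [hρ s hs, h0])
  refine ⟨by omega, by omega, hQ _ ?_⟩
  have h3 := ((Inv.cons_atom ha).2 h).setVar hs (.inl ha)
  rw [hs0, Inv.cons_atom (by omega)] at h3
  refine ⟨n, hn, fl, val, h3, fun i hi => ?_⟩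
  by_cases his : i = s
  · subst his; rw [Function.update_self, Function.update_self, h.val_atom a ha]
  · rw [Function.update_of_ne (by omega), Function.update_of_ne his, hρ i hi]

/-- Replacing the variables `s` and `s + 1` by their pair in `s`. -/
def consVar (s : ℕ) : Cmd :=
  block [.copy 5 (10 + s), .copy 6 (10 + (s + 1)), .const (10 + s) 0, .const (10 + (s + 1)) 0,
    alloc, .copy (10 + s) 7, decref 5, decref 6]

/-- Since the sizes of all variables sum up to less than `N`, the heap is not extended beyond `N`
cells. -/
theorem wp_consVar {s : ℕ} (h : Heap H K N m ρ) (hB : H + 3 * N < B) (hs : s + 1 < K)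
    (hN : ∑ i ∈ Finset.range K, (ρ i).size < N)
    (hQ : ∀ m', Heap H K N m' (Function.update (Function.update ρ (s + 1) (atom 0)) s
      (cons (ρ s) (ρ (s + 1)))) → Q m') :
    (consVar s).wp B Q m := by
  obtain ⟨n, hn, fl, val, h, hρ⟩ := h
  have hH := h.heap_le
  have hv := h.valid _ (h.mem_slots_var (i := s) (by omega))
  have hv' := h.valid _ (h.mem_slots_var hs)
  have hfull : fl = [] → n < N := by
    rintro rfl
    refine lt_of_le_of_lt h.card_le_of_full ?_
    rwa [Finset.sum_congr rfl fun i hi => by rw [hρ i (Finset.mem_range.1 hi)]]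
  simp only [consVar, block, List.foldr]
  refine seq_copy (m (10 + s)) (by omega) (by omega) rfl ?_
  refine seq_copy (m (10 + (s + 1))) (by omega) (by omega)
    (by rw [Function.update_of_ne (by omega)]) ?_
  refine seq_const (by omega) (by omega) (seq_const (by omega) (by omega) ?_)
  set m1 := Function.update (Function.update (Function.update (Function.update m 5 (m (10 + s))) 6
    (m (10 + (s + 1)))) (10 + s) 0) (10 + (s + 1)) 0 with hm1
  have e5 : m1 5 = m (10 + s) := by
    simp (disch := omega) only [hm1, Function.update_self, Function.update_of_ne]
  have e6 : m1 6 = m (10 + (s + 1)) := by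
    simp (disch := omega) only [hm1, Function.update_self, Function.update_of_ne]
  have ev : ∀ i < K, m1 (10 + i) = if i = s ∨ i = s + 1 then 0 else m (10 + i) := fun i hi => by
    by_cases h1 : i = s
    · subst h1; simp (disch := omega) [hm1, Function.update_self, Function.update_of_ne]
    by_cases h2 : i = s + 1
    · subst h2; simp [hm1]
    rw [if_neg (by tauto), hm1]
    simp (disch := omega) only [Function.update_of_ne]
  have h1 : Inv H K m1 n fl val {m1 5, m1 6} := by
    have a1 := (((Inv.cons_atom (by omega)).2 h).setVar (i := s) (x := 0) (by omega)
      (.inl (by omega)))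
    have a2 := (((Inv.cons_atom (by omega)).2 a1).setVar (i := s + 1) (x := 0) (by omega)
      (.inl (by omega)))
    rw [Function.update_of_ne (by omega), Multiset.cons_swap] at a2
    rw [e5, e6]
    refine a2.congr fun r _ _ => ?_
    by_cases hr : r = 10 + (s + 1)
    · subst hr; rw [hm1, Function.update_self, Function.update_self]
    by_cases hr' : r = 10 + s
    · subst hr'; simp (disch := omega) only [hm1, Function.update_self, Function.update_of_ne]
    simp (disch := omega) only [hm1, Function.update_of_ne]
  refine wp_alloc h1 (by omega) (fun hfl => by have := hfull hfl; omega)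
    (by rwa [e5]) (by rwa [e6]) fun m2 n' fl' val' hn' h2 h27 h2v c5 c6 c7 hf2 => ?_
  have hnN : n' ≤ N := by
    rcases hn' with rfl | ⟨hfl, rfl⟩
    · exact hn
    · exact hfull hfl
  rw [e5, e6, hρ s (by omega), hρ (s + 1) hs] at h27
  refine seq_copy (m2 7) (by omega) (by omega) rfl ?_
  have h3 := Inv.setVar (E := {m2 5, m2 6}) h2 (i := s) (by omega) c7
  have e2s : m2 (10 + s) = 0 := by
    rw [hf2 _ (by omega), ev s (by omega), if_pos (.inl rfl)]
  rw [e2s, Inv.cons_atom (by omega)] at h3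
  have n5 : 10 + s ≠ 5 := by omega
  have n6 : 10 + s ≠ 6 := by omega
  refine wp_decref (H := H) (K := K) (n := n') (fl := fl') (E := {m2 6}) (val := val') ?_
    (by omega) (by simp) (by omega)
    (by rwa [Function.update_of_ne n5.symm]) fun m4 fl4 h4 hf4 => ?_
  · rw [Function.update_of_ne n5.symm]; exact h3
  have e46 : m4 6 = m2 6 := by rw [hf4 _ (by omega), Function.update_of_ne n6.symm]
  refine wp_decref (H := H) (K := K) (n := n') (fl := fl4) (E := 0) (val := val') ?_
    (by omega) (by simp) (by omega)
    (by rwa [e46]) fun m5 fl5 h5 hf5 => hQ m5 ?_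
  · rw [e46]; exact h4
  refine ⟨n', hnN, fl5, val', h5, fun i hi => ?_⟩
  rw [hf5 _ (by omega), hf4 _ (by omega)]
  by_cases his : i = s
  · subst his; rw [Function.update_self, Function.update_self, h27]
  · rw [Function.update_of_ne (by omega), Function.update_of_ne his, hf2 _ (by omega), h2v i hi,
      ev i hi]
    by_cases his' : i = s + 1
    · subst his'
      rw [Function.update_self, if_pos (.inr rfl), h.val_atom 0 (by omega)]
    · rw [Function.update_of_ne his', if_neg (by tauto), hρ i hi]

/-- Replacing variable `s` by its first (`k = 0`) or second (`k = 1`) component. -/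
def projVar (k s : ℕ) : Cmd :=
  block [.copy 5 (10 + s), .arith .add 9 5 4, .arith .sub 9 9 3, .ifz 9 (.const (10 + s) 0)
    (block [.const 9 k, .arith .add 9 5 9, .load 6 9, incref 6, .copy (10 + s) 6, decref 5])]

theorem wp_projVar {k s : ℕ} (hk : k < 2) (h : Heap H K N m ρ) (hB : H + 3 * N < B) (hs : s < K)
    (hQ : ∀ m', Heap H K N m' (Function.update ρ s (if k = 0 then (ρ s).car else (ρ s).cdr)) →
      Q m') :
    (projVar k s).wp B Q m := by
  obtain ⟨n, hn, fl, val, h, hρ⟩ := h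
  have hH := h.heap_le
  have hv := h.valid _ (h.mem_slots_var hs)
  have hvB : m (10 + s) + 1 < B := by unfold IsCell at hv; omega
  have h3 := h.const3
  have h4 := h.const4
  simp only [projVar, block, List.foldr]
  refine seq_copy (m (10 + s)) (by omega) (by omega) rfl ?_
  refine seq_add (m (10 + s) + 1) (by omega) (by omega) (by omega)
    (by simp (disch := omega) only [Function.update_self, Function.update_of_ne, h4]) (by omega) ?_
  refine seq_sub (m (10 + s) + 1 - H) (by omega) (by omega) (by omega)
    (by simp (disch := omega) only [Function.update_self, Function.update_of_ne, h3]) (by omega) ?_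
  rw [Function.update_idem]
  refine ⟨by omega, fun h0 => ?_, fun h0 => ?_⟩
  all_goals rw [Function.update_self] at h0
  · refine ⟨by omega, by omega, hQ _ ?_⟩
    have a1 := ((Inv.cons_atom (by omega)).2 h).setVar (i := s) (x := 0) hs (.inl (by omega))
    rw [Inv.cons_atom (by omega)] at a1
    have hat : ρ s = atom (m (10 + s)) := by rw [← hρ s hs, h.val_atom _ (by omega)]
    refine ⟨n, hn, fl, val, a1.congr fun r _ _ => ?_, fun i hi => ?_⟩
    · by_cases hr : r = 10 + s
      · subst hr; rw [Function.update_self, Function.update_self]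
      · simp (disch := omega) only [Function.update_of_ne]
    · by_cases his : i = s
      · subst his
        rw [Function.update_self, Function.update_self, hat, h.val_atom 0 (by omega)]
        simp [car, cdr]
      · simp (disch := omega) only [Function.update_of_ne]
        exact hρ i hi
  · have hc : IsCell H n (m (10 + s)) := hv.resolve_left (by omega)
    have hc' := hc
    unfold IsCell at hc'
    have hks : m (10 + s) + k ∈ slots H K n := by rw [mem_slots]; omega
    have hkv := h.valid _ hks
    refine seq_const (by omega) (by omega) ?_
    refine seq_add (m (10 + s) + k) (by omega) (by omega) (by omega)
      (by simp (disch := omega) only [Function.update_self, Function.update_of_ne]) (by omega) ?_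
    rw [Function.update_idem, Function.update_idem]
    refine seq_load (m (10 + s) + k) (m (m (10 + s) + k)) (by omega) (by omega)
      (by simp (disch := omega) only [Function.update_self]) (by omega)
      (by simp (disch := omega) only [Function.update_of_ne]) ?_
    have h1 : Inv H K (Function.update (Function.update (Function.update m 5 (m (10 + s))) 9
        (m (10 + s) + k)) 6 (m (m (10 + s) + k))) n fl val 0 :=
      h.congr fun s _ _ => by simp (disch := omega) only [Function.update_of_ne]
    refine wp_incref h1 (by omega) (by simp) (by omega) (by simpa using hkv)
      (by simpa using h.not_mem_free hks) fun m2 h2 hf => ?_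
    have e6 : m2 6 = m (m (10 + s) + k) := by rw [hf 6 (by omega), Function.update_self]
    have e5 : m2 5 = m (10 + s) := by
      rw [hf 5 (by omega)]
      simp (disch := omega) only [Function.update_self, Function.update_of_ne]
    have ev : ∀ i < K, m2 (10 + i) = m (10 + i) := fun i hi => by
      rw [hf _ (by omega)]
      simp (disch := omega) only [Function.update_of_ne]
    rw [Function.update_self] at h2
    refine seq_copy (m (m (10 + s) + k)) (by omega) (by omega) e6 ?_
    have h3' := h2.setVar hs hkv
    rw [ev s hs] at h3'
    have n5 : 5 ≠ 10 + s := by omega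
    refine wp_decref (H := H) (K := K) (n := n) (fl := fl) (E := 0) (val := val) ?_
      (by omega) (by simp) (by omega)
      (by rwa [Function.update_of_ne n5, e5]) fun m5 fl5 h5 hf5 => hQ m5 ?_
    · rw [Function.update_of_ne n5, e5]; exact h3'
    refine ⟨n, hn, fl5, val, h5, fun i hi => ?_⟩
    rw [hf5 _ (by omega)]
    by_cases his : i = s
    · subst his
      rw [Function.update_self, Function.update_self, ← hρ i hi, h.val_cell _ hc]
      obtain rfl | rfl : k = 0 ∨ k = 1 := by omega
      · simp [car]
      · simp [cdr]
    · rw [Function.update_of_ne (by omega), Function.update_of_ne his, ev i hi, hρ i hi]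

/-- Clearing variable `s`; then `c` if its value was the atom `a`, and `d` otherwise. The distance
between the register content and `a` is computed in register 7. -/
def branchVar (s a : ℕ) (c d : Cmd) : Cmd :=
  block [.copy 5 (10 + s), .const (10 + s) 0, .const 6 a, .arith .sub 7 5 6, .arith .sub 6 6 5,
    .arith .add 7 6 7, decref 5, .ifz 7 c d]

theorem wp_branchVar {a s : ℕ} {c d : Cmd} (h : Heap H K N m ρ) (hB : H + 3 * N < B) (hs : s < K)
    (ha : a < H)
    (hQ : ∀ m', Heap H K N m' (Function.update ρ s (atom 0)) →
      (bif (ρ s).isAtom a then c else d).wp B Q m') :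
    (branchVar s a c d).wp B Q m := by
  obtain ⟨n, hn, fl, val, h, hρ⟩ := h
  have hH := h.heap_le
  have hv := h.valid _ (h.mem_slots_var hs)
  have hvB : m (10 + s) + 1 < B := by unfold IsCell at hv; omega
  simp only [branchVar, block, List.foldr]
  refine seq_copy (m (10 + s)) (by omega) (by omega) rfl ?_
  refine seq_const (by omega) (by omega) (seq_const (by omega) (by omega) ?_)
  refine seq_sub (m (10 + s) - a) (by omega) (by omega) (by omega)
    (by simp (disch := omega) only [Function.update_self, Function.update_of_ne]) (by omega) ?_
  refine seq_sub (a - m (10 + s)) (by omega) (by omega) (by omega)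
    (by simp (disch := omega) only [Function.update_self, Function.update_of_ne]) (by omega) ?_
  refine seq_add (a - m (10 + s) + (m (10 + s) - a)) (by omega) (by omega) (by omega)
    (by simp (disch := omega) only [Function.update_self, Function.update_of_ne]) (by omega) ?_
  have a1 := ((Inv.cons_atom (by omega)).2 h).setVar (i := s) (x := 0) hs (.inl (by omega))
  refine wp_decref (H := H) (K := K) (n := n) (fl := fl) (E := 0) (val := val) ?_
    (by omega) (by simp) (by omega)
    ?_ fun m5 fl5 h5 hf5 => ?_
  · simp (disch := omega) only [Function.update_self, Function.update_of_ne]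
    refine a1.congr fun r _ _ => ?_
    by_cases hr : r = 10 + s
    · subst hr; simp (disch := omega) only [Function.update_self, Function.update_of_ne]
    · simp (disch := omega) only [Function.update_of_ne]
  · simp (disch := omega) only [Function.update_self, Function.update_of_ne]
    exact hv
  have e7 : m5 7 = a - m (10 + s) + (m (10 + s) - a) := by
    rw [hf5 _ (by omega), Function.update_self]
  have key := hQ m5 ⟨n, hn, fl5, val, h5, fun i hi => by
    rw [hf5 _ (by omega)]
    by_cases his : i = s
    · subst his
      simp (disch := omega) only [Function.update_self, Function.update_of_ne]
      exact h.val_atom 0 (by omega)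
    · simp (disch := omega) only [Function.update_of_ne]
      exact hρ i hi⟩
  have hiff : (ρ s).isAtom a = true ↔ m5 7 = 0 := by
    rw [e7, ← hρ s hs]
    rcases hv with hv | hv
    · rw [h.val_atom _ hv]
      simp [isAtom]; omega
    · have hv' := hv
      unfold IsCell at hv'
      rw [h.val_cell _ hv]
      simp [isAtom]; omega
  refine ⟨by omega, fun h0 => ?_, fun h0 => ?_⟩
  · rwa [hiff.2 h0] at key
  · rwa [show (ρ s).isAtom a = false by simpa using mt hiff.1 h0] at key

/-- Moving variable `t` to variable `s`, whose value is discarded. -/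
def moveVar (t s : ℕ) : Cmd :=
  block [.copy 5 (10 + s), .copy 6 (10 + t), .const (10 + t) 0, .copy (10 + s) 6, decref 5]

theorem wp_moveVar {s t : ℕ} (h : Heap H K N m ρ) (hB : H + 3 * N < B) (hs : s < K) (ht : t < K)
    (hst : s ≠ t)
    (hQ : ∀ m', Heap H K N m' (Function.update (Function.update ρ t (atom 0)) s (ρ t)) → Q m') :
    (moveVar t s).wp B Q m := by
  obtain ⟨n, hn, fl, val, h, hρ⟩ := h
  have hH := h.heap_le
  have hv := h.valid _ (h.mem_slots_var hs)
  have hv' := h.valid _ (h.mem_slots_var ht)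
  simp only [moveVar, block, List.foldr]
  refine seq_copy (m (10 + s)) (by omega) (by omega) rfl ?_
  refine seq_copy (m (10 + t)) (by omega) (by omega)
    (by simp (disch := omega) only [Function.update_of_ne]) (seq_const (by omega) (by omega) ?_)
  refine seq_copy (m (10 + t)) (by omega) (by omega)
    (by simp (disch := omega) only [Function.update_self, Function.update_of_ne]) ?_
  have a1 := ((Inv.cons_atom (by omega)).2 h).setVar (i := t) (x := 0) ht (.inl (by omega))
  have a2 := a1.setVar hs hv'
  rw [Function.update_of_ne (by omega)] at a2
  refine wp_decref (H := H) (K := K) (n := n) (fl := fl) (E := 0) (val := val) ?_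
    (by omega) (by simp) (by omega)
    ?_ fun m5 fl5 h5 hf5 => hQ m5 ?_
  · simp (disch := omega) only [Function.update_self, Function.update_of_ne]
    refine a2.congr fun r _ _ => ?_
    by_cases hr : r = 10 + s
    · subst hr; simp (disch := omega) only [Function.update_self]
    by_cases hr' : r = 10 + t
    · subst hr'; simp (disch := omega) only [Function.update_self, Function.update_of_ne]
    · simp (disch := omega) only [Function.update_of_ne]
  · simp (disch := omega) only [Function.update_self, Function.update_of_ne]
    exact hv
  refine ⟨n, hn, fl5, val, h5, fun i hi => ?_⟩
  rw [hf5 _ (by omega)]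
  by_cases his : i = s
  · subst his; rw [Function.update_self, Function.update_self, hρ t ht]
  by_cases hit : i = t
  · subst hit
    simp (disch := omega) only [Function.update_self, Function.update_of_ne]
    exact h.val_atom 0 (by omega)
  · simp (disch := omega) only [Function.update_of_ne]
    exact hρ i hi

end RAM

namespace Code

open SExp RAM Cmd

/-- Machine code for an expression. The environment is found in the machine variables with the
numbers `σ`; the variables from `s` on are empty, and the value is put into variable `s`. -/
def compile : Code → List ℕ → ℕ → Cmd
  | var i, σ, s => (σ[i]?).elim .skip fun j => copyVar j s
  | atom a, _, s => .const (10 + s) a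
  | cons e f, σ, s => .seq (e.compile σ s) (.seq (f.compile σ (s + 1)) (consVar s))
  | car e, σ, s => .seq (e.compile σ s) (projVar 0 s)
  | cdr e, σ, s => .seq (e.compile σ s) (projVar 1 s)
  | ite e a f g, σ, s => .seq (e.compile σ s) (branchVar s a (f.compile σ s) (g.compile σ s))
  | bind e f, σ, s => .seq (e.compile σ s) (.seq (f.compile (s :: σ) (s + 1)) (moveVar (s + 1) s))

theorem map_update_of_lt {σ : List ℕ} {s : ℕ} (hσ : ∀ j ∈ σ, j < s) (ρ : ℕ → SExp) (t : SExp) :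
    σ.map (Function.update ρ s t) = σ.map ρ :=
  List.map_congr_left fun j hj => Function.update_of_ne (hσ j hj).ne _ _

theorem size_update_le {K Z s : ℕ} {ρ : ℕ → SExp} {t : SExp} (hρ : ∀ i < K, (ρ i).size ≤ Z)
    (ht : t.size ≤ Z) : ∀ i < K, (Function.update ρ s t i).size ≤ Z := fun i hi => by
  by_cases his : i = s
  · subst his; rwa [Function.update_self]
  · rw [Function.update_of_ne his]; exact hρ i hi

/-- The compiled expression puts the value into variable `s`. The values in the environment have size
at most `z`, and all values in the course of the evaluation have size at most `Z`; therefore all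
variables together need less than `N` cells. -/
theorem wp_compile {H K N B Z : ℕ} (hB : H + 3 * N < B) (hZ : K * Z < N) (e : Code) {σ : List ℕ}
    {s z : ℕ} {ρ : ℕ → SExp} {m : Memory} {Q : Memory → Prop} (hs : s + e.height ≤ K)
    (hσ : ∀ j ∈ σ, j < s) (hz : 0 < z) (hσz : ∀ j ∈ σ, (ρ j).size ≤ z) (hez : e.factor * z ≤ Z)
    (hρ : ∀ i < K, (ρ i).size ≤ Z) (he : e.bound ≤ H) (h0 : ∀ i < K, s ≤ i → ρ i = SExp.atom 0)
    (h : Heap H K N m ρ)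
    (hQ : ∀ m', Heap H K N m' (Function.update ρ s (e.eval (σ.map ρ))) → Q m') :
    (e.compile σ s).wp B Q m := by
  have hsize (e : Code) (h : e.factor * z ≤ Z) : (e.eval (σ.map ρ)).size ≤ Z :=
    (e.size_eval_le hz (by simpa using hσz)).trans h
  have hz0 : 0 < Z := (Nat.mul_pos e.factor_pos hz).trans_le hez
  have h0' (t : SExp) : ∀ i < K, s + 1 ≤ i → Function.update ρ s t i = SExp.atom 0 :=
    fun i hi hi' => by rw [Function.update_of_ne (by omega)]; exact h0 i hi (by omega)
  have hσz' (t : SExp) : ∀ j ∈ σ, (Function.update ρ s t j).size ≤ z := fun j hj => by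
    rw [Function.update_of_ne (hσ j hj).ne]; exact hσz j hj
  have hσ' : ∀ j ∈ σ, j < s + 1 := fun j hj => (hσ j hj).trans (Nat.lt_succ_self s)
  induction e generalizing σ s z ρ m Q with
  | var i =>
    simp only [height] at hs
    simp only [compile]
    by_cases hi : i < σ.length
    · rw [List.getElem?_eq_getElem hi]
      have hj := hσ _ (List.getElem_mem hi)
      refine wp_copyVar h hB (by omega) (by omega) (h0 _ (by omega) le_rfl) fun m' h' => hQ _ ?_
      simpa [eval, hi] using h'
    · rw [List.getElem?_eq_none (by omega)]
      refine hQ _ ?_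
      have : Function.update ρ s ((var i).eval (σ.map ρ)) = ρ := by
        rw [Function.update_eq_self_iff]
        simp [eval, h0 s (by omega) le_rfl, List.getElem?_eq_none (Nat.le_of_not_lt hi)]
      rwa [this]
  | atom a =>
    simp only [height] at hs
    simp only [bound] at he
    exact wp_constVar h hB (by omega) (by omega) (h0 _ (by omega) le_rfl) hQ
  | cons e f ihe ihf =>
    have := f.height_pos
    simp only [height] at hs
    simp only [bound] at he
    simp only [factor, add_mul] at hez
    refine ihe (by omega) hσ hz hσz (by omega) hρ (by omega) h0 h (fun m1 h1 => ?_) hsize h0' hσz'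
      hσ'
    set ρ1 := Function.update ρ s (e.eval (σ.map ρ)) with hρ1
    have hm : σ.map ρ1 = σ.map ρ := map_update_of_lt hσ _ _
    have b1 : ∀ i < K, (ρ1 i).size ≤ Z := size_update_le hρ (hsize e (by omega))
    refine ihf (ρ := ρ1) (by omega) hσ' hz (hσz' _) (by omega) b1
      (by omega) (h0' _) h1 (fun m2 h2 => ?_) (by rwa [hm]) ?_ ?_ ?_
    · rw [hm] at h2
      have b2 := size_update_le (s := s + 1) b1 (hsize f (by omega))
      refine wp_consVar h2 hB (by omega) ?_ fun m3 h3 => hQ _ ?_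
      · refine (Finset.sum_le_card_nsmul _ _ Z fun i hi => b2 i (Finset.mem_range.1 hi)).trans_lt ?_
        simpa using hZ
      · convert h3 using 1
        funext i
        by_cases his : i = s
        · subst his; simp [hρ1, eval]
        by_cases his' : i = s + 1
        · subst his'; simp [h0 (s + 1) (by omega) (by omega)]
        · simp [Function.update_of_ne, his, his', hρ1]
    · intro t i hi hi'
      rw [Function.update_of_ne (by omega)]; exact h0' _ i hi (by omega)
    · intro t j hj
      have := hσ j hj
      rw [Function.update_of_ne (by omega)]; exact hσz' _ j hj
    · intro j hj; have := hσ j hj; omega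
  | car e ihe =>
    have := e.height_pos
    simp only [height] at hs
    refine ihe hs hσ hz hσz hez hρ he h0 h (fun m1 h1 => ?_) hsize h0' hσz' hσ'
    refine wp_projVar (by omega) h1 hB (by omega) fun m2 h2 => hQ _ ?_
    simpa [eval] using h2
  | cdr e ihe =>
    have := e.height_pos
    simp only [height] at hs
    refine ihe hs hσ hz hσz hez hρ he h0 h (fun m1 h1 => ?_) hsize h0' hσz' hσ'
    refine wp_projVar (by omega) h1 hB (by omega) fun m2 h2 => hQ _ ?_
    simpa [eval] using h2
  | ite e a f g ihe ihf ihg =>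
    have := e.height_pos
    simp only [height] at hs
    simp only [bound] at he
    simp only [factor, add_mul] at hez
    refine ihe (by omega) hσ hz hσz (by omega) hρ (by omega) h0 h (fun m1 h1 => ?_) hsize h0' hσz'
      hσ'
    refine wp_branchVar h1 hB (by omega) (by omega) fun m2 h2 => ?_
    rw [Function.update_idem, ← h0 s (by omega) le_rfl, Function.update_eq_self] at h2
    rw [Function.update_self]
    simp only [eval] at hQ
    cases hc : (e.eval (σ.map ρ)).isAtom a
    · rw [hc] at hQ
      exact ihg (by omega) hσ hz hσz (by omega) hρ (by omega) h0 h2 hQ hsize h0' hσz' hσ'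
    · rw [hc] at hQ
      exact ihf (by omega) hσ hz hσz (by omega) hρ (by omega) h0 h2 hQ hsize h0' hσz' hσ'
  | bind e f ihe ihf =>
    have := f.height_pos
    have hfac := f.factor_pos
    simp only [height] at hs
    simp only [bound] at he
    simp only [factor] at hez
    rw [mul_assoc] at hez
    have hez' : (e.factor + 1) * z ≤ Z := le_trans (Nat.le_mul_of_pos_left _ hfac) hez
    have hez2 : (e.factor + 1) * z = e.factor * z + z := by ring
    refine ihe (by omega) hσ hz hσz (by omega) hρ (by omega) h0 h (fun m1 h1 => ?_) hsize h0' hσz'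
      hσ'
    set ρ1 := Function.update ρ s (e.eval (σ.map ρ)) with hρ1
    have hm : (s :: σ).map ρ1 = e.eval (σ.map ρ) :: σ.map ρ := by
      rw [List.map_cons, map_update_of_lt hσ, hρ1, Function.update_self]
    have b1 : ∀ i < K, (ρ1 i).size ≤ Z := size_update_le hρ (hsize e (by omega))
    have hσ1 : ∀ j ∈ s :: σ, j < s + 1 := by simpa using fun j hj => hσ' j hj
    have hσz1 : ∀ j ∈ s :: σ, (ρ1 j).size ≤ (e.factor + 1) * z := by
      intro j hj
      rcases List.mem_cons.1 hj with rfl | hj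
      · have := e.size_eval_le hz (env := σ.map ρ) (by simpa using hσz)
        rw [hρ1, Function.update_self]; omega
      · refine (hσz' (e.eval (σ.map ρ)) j hj).trans ?_
        omega
    refine ihf (ρ := ρ1) (z := (e.factor + 1) * z) (by omega) hσ1 (by omega) hσz1 hez b1
      (by omega) (h0' _) h1 (fun m2 h2 => ?_) ?_ ?_ ?_ ?_
    · rw [hm] at h2
      refine wp_moveVar h2 hB (by omega) (by omega) (by omega) fun m3 h3 => hQ _ ?_
      convert h3 using 1
      funext i
      by_cases his : i = s
      · subst his; simp [eval]
      by_cases his' : i = s + 1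
      · subst his'; simp [h0 (s + 1) (by omega) (by omega)]
      · simp [Function.update_of_ne, his, his', hρ1]
    · exact fun f hf => (f.size_eval_le (by omega) (by simpa using hσz1)).trans hf
    · intro t i hi hi'
      rw [Function.update_of_ne (by omega)]; exact h0' _ i hi (by omega)
    · intro t j hj
      have := hσ1 j hj
      rw [Function.update_of_ne (by omega)]; exact hσz1 j hj
    · intro j hj; have := hσ1 j hj; omega

end Code

/-! ### Sliding window algorithms from expressions -/

namespace RAM

open SExp Cmd

/-- Handling an operation that replaces the S-expression in variable 0 by the value of `e`. -/
def updateCmd (e : Code) : Cmd := .seq (e.compile [0] 1) (moveVar 1 0)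

/-- Handling a query whose answer is the value of `e`. -/
def queryCmd (e : Code) : Cmd := .seq (e.compile [0] 1) (block [.copy 0 11, .const 11 0])

/-- The content of the variables between two operations. -/
def single (t : SExp) : ℕ → SExp := Function.update (fun _ => atom 0) 0 t

variable {H K N B Z z : ℕ} {m : Memory} {t : SExp} {e : Code}

theorem wp_compile_single {Q : Memory → Prop} (hB : H + 3 * N < B) (hZ : K * Z < N)
    (hs : 1 + e.height ≤ K) (hz : t.size ≤ z) (hez : e.factor * z ≤ Z) (he : e.bound ≤ H)
    (h : Heap H K N m (single t))
    (hQ : ∀ m', Heap H K N m' (Function.update (single t) 1 (e.eval [t])) → Q m') :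
    (e.compile [0] 1).wp B Q m := by
  have hzZ : z ≤ Z := le_trans (Nat.le_mul_of_pos_left _ e.factor_pos) hez
  have h1 : 1 ≤ z := t.size_pos.trans_le hz
  refine Code.wp_compile hB hZ e (z := z) hs (by simp) h1 (by simpa [single] using hz) hez ?_ he
    (fun i _ hi => ?_) h (by simpa [single] using hQ)
  · intro i _
    by_cases hi : i = 0
    · subst hi; simp only [single, Function.update_self]; omega
    · simp only [single, Function.update_of_ne hi, SExp.size]; omega
  · simp only [single]; rw [Function.update_of_ne (by omega)]

theorem wp_updateCmd (hB : H + 3 * N < B) (hZ : K * Z < N)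
    (hs : 1 + e.height ≤ K) (hz : t.size ≤ z) (hez : e.factor * z ≤ Z) (he : e.bound ≤ H)
    (h : Heap H K N m (single t)) :
    (updateCmd e).wp B (fun m' => Heap H K N m' (single (e.eval [t]))) m := by
  have := e.height_pos
  refine wp_compile_single hB hZ hs hz hez he h fun m1 h1 => ?_
  refine wp_moveVar h1 hB (by omega) (by omega) (by omega) fun m2 h2 => ?_
  convert h2 using 1
  funext i
  by_cases h0 : i = 0
  · subst h0; simp [single]
  by_cases h0' : i = 1
  · subst h0'; simp [single]
  · simp [single, h0, h0']

theorem wp_queryCmd {a : ℕ} (hB : H + 3 * N < B) (hZ : K * Z < N)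
    (hs : 1 + e.height ≤ K) (hz : t.size ≤ z) (hez : e.factor * z ≤ Z) (he : e.bound ≤ H)
    (h : Heap H K N m (single t)) (ha : e.eval [t] = atom a) :
    (queryCmd e).wp B (fun m' => Heap H K N m' (single t) ∧ m' 0 = a) m := by
  have := e.height_pos
  refine wp_compile_single hB hZ hs hz hez he h fun m1 ⟨n, hn, fl, val, h1, hρ⟩ => ?_
  have hH := h1.heap_le
  have hv := h1.valid _ (h1.mem_slots_var (i := 1) (by omega))
  have hm : m1 11 = a := by
    refine h1.eq_of_val_eq_atom hv ?_
    rw [hρ 1 (by omega), Function.update_self, ha]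
  have h11 : m1 11 < H := by
    rcases hv with hv | hv
    · exact hv
    · have := h1.val_cell _ hv
      rw [hρ 1 (by omega), Function.update_self, ha] at this
      cases this
  simp only [block, List.foldr]
  refine seq_copy a (by omega) (by omega) hm (seq_const (by omega) (by omega) ⟨?_, ?_⟩)
  · have h2 := ((Inv.cons_atom (by omega)).2 h1).setVar (i := 1) (x := 0) (by omega)
      (.inl (by omega))
    rw [Inv.cons_atom h11] at h2
    refine ⟨n, hn, fl, val, h2.congr fun r hr _ => ?_, fun i hi => ?_⟩
    · by_cases h : r = 11
      · subst h; simp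
      · simp (disch := omega) only [Function.update_of_ne]
    · by_cases h : i = 1
      · subst h; simp [single, h1.val_atom 0 (by omega)]
      · simp (disch := omega) only [Function.update_of_ne]
        rw [hρ i hi, Function.update_of_ne h]
  · simp

end RAM

namespace SlidingWindow

open RAM SExp

variable {α : Type*}

theorem maxWindowSize_ge {ops pre : List (Op α)} (h : pre <+: ops) :
    (window pre).length ≤ maxWindowSize ops := by
  obtain ⟨k, hk, rfl⟩ : ∃ k, k ≤ ops.length ∧ pre = ops.take k :=
    ⟨pre.length, h.length_le, (List.prefix_iff_eq_take.1 h)⟩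
  exact Finset.le_sup (f := fun k => (window (ops.take k)).length)
    (Finset.mem_range.2 (by omega))

/-- The S-expression after an operation, if the operations other than queries act through
expressions. -/
def Op.evalCode (code : Op α → Code) (t : SExp) : Op α → SExp
  | .query => t
  | op => (code op).eval [t]

/-- The S-expression after a sequence of operations. -/
def stateAfter (code : Op α → Code) (ops : List (Op α)) : SExp :=
  ops.foldl (Op.evalCode code) (atom 0)

/-- The algorithm that keeps an S-expression and handles the operations through expressions. -/
noncomputable def Algorithm.ofCode (H : ℕ) (code : Op α → Code) : Algorithm α where
  init := Finsupp.single 2 H + Finsupp.single 3 H + Finsupp.single 4 1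
  prog
    | .query => (queryCmd (code .query)).compile 0
    | op => (updateCmd (code op)).compile 0

/-- The initial register contents describe an empty heap, with the atom `0` in all variables. -/
theorem heap_init {H K N : ℕ} (h : 10 + K ≤ H) (code : Op α → Code) :
    Heap H K N (Algorithm.ofCode H code).init (single (atom 0)) := by
  have e : ∀ s, (Algorithm.ofCode H code).init s =
      if s = 2 then H else if s = 3 then H else if s = 4 then 1 else 0 := by
    intro s
    simp only [Algorithm.ofCode, Finsupp.add_apply, Finsupp.single_apply, eq_comm (a := s)]
    split_ifs <;> omega
  have hc : ∀ p, ¬IsCell H 0 p := fun p hp => by unfold IsCell at hp; omega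
  refine ⟨0, Nat.zero_le _, [], atom, ⟨h, by simp [e], by simp [e], by simp [e], ?_, by simp,
    by simp, ?_, fun _ _ => rfl, ?_, ?_, by simp⟩, ?_⟩
  · simp [Linked, e]
  · intro s hs
    rw [mem_slots] at hs
    rw [e]
    left
    split_ifs <;> omega
  · exact fun p hp => absurd hp (hc p)
  · exact fun p hp => absurd hp (hc p)
  · intro i hi
    rw [e]
    simp (disch := omega) only [if_neg]
    by_cases hi : i = 0
    · subst hi; simp [single]
    · simp [single, hi]

theorem isBigO_clog (a d : ℕ) :
    (fun n => (Nat.clog 2 (a + d * n) : ℝ)) =O[atTop] (fun n => (Nat.clog 2 n : ℝ)) := by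
  refine IsBigO.of_bound (Nat.clog 2 (a + d) + 1 : ℕ) ?_
  filter_upwards [eventually_ge_atTop 2] with n hn
  rw [Real.norm_natCast, Real.norm_natCast, ← Nat.cast_mul, Nat.cast_le]
  have h1 : 1 ≤ Nat.clog 2 n := Nat.clog_pos (by omega) hn
  have h2 : a + d * n ≤ 2 ^ (Nat.clog 2 (a + d) + Nat.clog 2 n) := by
    rw [pow_add]
    calc a + d * n ≤ (a + d) * n := by nlinarith
      _ ≤ _ := Nat.mul_le_mul (Nat.le_pow_clog (by omega) _) (Nat.le_pow_clog (by omega) _)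
  refine (Nat.clog_le_of_le_pow h2).trans ?_
  nlinarith

theorem isBigO_linear (a d : ℕ) :
    (fun n : ℕ => ((a + d * n : ℕ) : ℝ)) =O[atTop] (fun n => (n : ℝ)) := by
  refine IsBigO.of_bound (a + d : ℕ) ?_
  filter_upwards [eventually_ge_atTop 1] with n hn
  rw [Real.norm_natCast, Real.norm_natCast, ← Nat.cast_mul, Nat.cast_le]
  nlinarith

/-- If the window can be represented by an S-expression of linear size such that the operations act
through expressions, then there is a sliding window algorithm with the required resource bounds. -/
theorem exists_algorithm_of_code [Finite α] (L : Language α) (code : Op α → Code)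
    (hquery : ∀ ops, (window ops ∈ L → (code .query).eval [stateAfter code ops] = atom 1) ∧
      (window ops ∉ L → (code .query).eval [stateAfter code ops] = atom 0))
    (c : ℕ) (hsize : ∀ ops, (stateAfter code ops).size ≤ c * ((window ops).length + 1)) :
    ∃ A : Algorithm α, A.Solves L ∧
      ∃ T S b : ℕ → ℕ, A.HasLatency T ∧ A.HasWordSizeAndSpace b S ∧
        (fun n => (T n : ℝ)) =O[atTop] (fun _ => (1 : ℝ)) ∧
        (fun n => (S n : ℝ)) =O[atTop] (fun n => (n : ℝ) * (Nat.clog 2 n : ℝ)) ∧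
        (fun n => (b n : ℝ)) =O[atTop] (fun n => (Nat.clog 2 n : ℝ)) := by
  have hfin : Finite (Op α) := by
    refine Finite.of_injective (β := Option (Option (Option (α ⊕ α)))) (fun
      | .rightpush a => some (some (some (.inl a)))
      | .leftpush a => some (some (some (.inr a)))
      | .leftpop => some (some none)
      | .rightpop => some none
      | .query => none) ?_
    intro x y h
    cases x <;> cases y <;> simp_all
  obtain ⟨hb, hhb⟩ : ∃ M, ∀ op, (code op).height ≤ M :=
    (Set.finite_range fun op => (code op).height).bddAbove.imp fun M hM op => hM ⟨op, rfl⟩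
  obtain ⟨bb, hbb⟩ : ∃ M, ∀ op, (code op).bound ≤ M :=
    (Set.finite_range fun op => (code op).bound).bddAbove.imp fun M hM op => hM ⟨op, rfl⟩
  obtain ⟨F, hF⟩ : ∃ M, ∀ op, (code op).factor ≤ M :=
    (Set.finite_range fun op => (code op).factor).bddAbove.imp fun M hM op => hM ⟨op, rfl⟩
  obtain ⟨T, hT⟩ : ∃ M, ∀ op, max (queryCmd (code op)).size (updateCmd (code op)).size ≤ M :=
    (Set.finite_range fun op =>
      max (queryCmd (code op)).size (updateCmd (code op)).size).bddAbove.imp fun M hM op => hM ⟨op, rfl⟩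
  -- `K` variables, heap base `H`, maximal size `Z n` of the values, maximal number `N n` of cells, and
  -- bound `B n` for addresses and contents, in computations of maximal window size `n`.
  obtain ⟨K, hK⟩ : ∃ K, K = 1 + hb := ⟨_, rfl⟩
  obtain ⟨H, hH⟩ : ∃ H, H = 10 + K + bb := ⟨_, rfl⟩
  obtain ⟨Z, hZ⟩ : ∃ Z : ℕ → ℕ, ∀ n, Z n = F * (c * (n + 1)) := ⟨_, fun _ => rfl⟩
  obtain ⟨N, hN⟩ : ∃ N : ℕ → ℕ, ∀ n, N n = K * Z n + 1 := ⟨_, fun _ => rfl⟩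
  obtain ⟨B, hB⟩ : ∃ B : ℕ → ℕ, ∀ n, B n = H + 3 * N n + 1 := ⟨_, fun _ => rfl⟩
  set A := Algorithm.ofCode H code with hA
  have step : ∀ n m t op, t.size ≤ c * (n + 1) → (∃ a, (code .query).eval [t] = atom a) →
      Heap H K (N n) m (single t) → Bdd (B n) m →
      (A.prog op).HaltsWithin m T ∧ (∀ k, Fits (A.prog op) (B n) ((A.prog op).conf m k)) ∧
        Bdd (B n) ((A.prog op).result m) ∧
        Heap H K (N n) ((A.prog op).result m) (single (op.evalCode code t)) ∧
        ∀ a, op = .query → (code .query).eval [t] = atom a → (A.prog op).result m 0 = a := by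
    intro n m t op ht ⟨a, ha⟩ hm hb
    have hBn := hB n
    have hNn := hN n
    have hop := hhb op
    have hop' := hbb op
    have hZn : (code op).factor * (c * (n + 1)) ≤ Z n := by
      rw [hZ]; exact Nat.mul_le_mul_right _ (hF op)
    have hTop := hT op
    by_cases hq : op = .query
    · subst hq
      obtain ⟨h1, h2, ⟨h3, h3'⟩, h4⟩ := Cmd.run_of_wp hb (wp_queryCmd (by omega) (by omega)
        (by omega) ht hZn (by omega) hm ha)
      refine ⟨?_, h4, h2, h3, fun a' _ ha' => ?_⟩
      · obtain ⟨k, hk, hk'⟩ := h1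
        exact ⟨k, hk.trans ((le_max_left _ _).trans hTop), hk'⟩
      · rw [ha] at ha'
        rw [← SExp.atom.inj ha']
        exact h3'
    · have hprog : A.prog op = (updateCmd (code op)).compile 0 := by
        cases op <;> first | rfl | exact absurd rfl hq
      have hev : op.evalCode code t = (code op).eval [t] := by
        cases op <;> first | rfl | exact absurd rfl hq
      obtain ⟨h1, h2, h3, h4⟩ := Cmd.run_of_wp hb (wp_updateCmd (by omega) (by omega)
        (by omega) ht hZn (by omega) hm)
      rw [hprog, hev]
      refine ⟨?_, h4, h2, h3, fun a' h _ => absurd h hq⟩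
      obtain ⟨k, hk, hk'⟩ := h1
      exact ⟨k, hk.trans ((le_max_right _ _).trans hTop), hk'⟩
  have hans : ∀ ops, ∃ a, (code .query).eval [stateAfter code ops] = atom a := fun ops => by
    by_cases h : window ops ∈ L
    · exact ⟨1, (hquery ops).1 h⟩
    · exact ⟨0, (hquery ops).2 h⟩
  have hsz : ∀ n ops, (window ops).length ≤ n → (stateAfter code ops).size ≤ c * (n + 1) :=
    fun n ops h => (hsize ops).trans (Nat.mul_le_mul_left _ (by omega))
  have key : ∀ n ops, (∀ pre, pre <+: ops → (window pre).length ≤ n) →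
      Heap H K (N n) (A.memoryAfter ops) (single (stateAfter code ops)) ∧
        Bdd (B n) (A.memoryAfter ops) := by
    intro n ops
    induction ops using List.reverseRecOn with
    | nil =>
      intro _
      refine ⟨heap_init (by omega) code, fun i => ?_⟩
      have hBn := hB n
      have : A.memoryAfter [] i =
          if i = 2 then H else if i = 3 then H else if i = 4 then 1 else 0 := by
        simp only [Algorithm.memoryAfter, List.foldl_nil, hA, Algorithm.ofCode, Finsupp.add_apply,
          Finsupp.single_apply, eq_comm (a := i)]
        split_ifs <;> omega
      rw [this]
      split_ifs <;> omega
    | append_singleton ops op ih =>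
      intro h
      obtain ⟨h1, h2⟩ := ih fun pre hpre => h pre (hpre.trans (List.prefix_append _ _))
      obtain ⟨-, -, h3, h4, -⟩ := step n _ _ op (hsz n ops (h ops (List.prefix_append _ _)))
        (hans ops) h1 h2
      simp only [Algorithm.memoryAfter, stateAfter, List.foldl_append, List.foldl_cons,
        List.foldl_nil]
      exact ⟨h4, h3⟩
  have key' : ∀ ops pre op, pre ++ [op] <+: ops → _ := fun ops pre op (h : pre ++ [op] <+: ops) =>
    have hpre : pre <+: ops := (List.prefix_append _ _).trans h
    have hk := key (maxWindowSize ops) pre fun p hp => maxWindowSize_ge (hp.trans hpre)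
    step (maxWindowSize ops) _ _ op (hsz _ _ (maxWindowSize_ge hpre)) (hans pre) hk.1 hk.2
  refine ⟨A, fun ops => ?_, fun _ => T, fun n => B n * Nat.clog 2 (B n), fun n => Nat.clog 2 (B n),
    fun ops pre op h => (key' ops pre op h).1, ?_, ?_, ?_, ?_⟩
  · have hk := key' (ops ++ [.query]) ops .query (List.prefix_refl _)
    obtain ⟨t, -, ht⟩ := hk.1
    exact ⟨⟨t, t, le_rfl, ht⟩, fun h => hk.2.2.2.2 1 rfl ((hquery ops).1 h),
      fun h => hk.2.2.2.2 0 rfl ((hquery ops).2 h)⟩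
  · classical
    refine ⟨fun n => Finsupp.indicator (Finset.range (B n)) fun _ _ => Nat.clog 2 (B n),
      fun ops pre op h k => ?_, fun n i => ?_, fun n => ?_⟩
    · have hf := (key' ops pre op h).2.1 k
      have hBn := hB (maxWindowSize ops)
      refine ⟨fun i => ?_, fun i hi => ?_⟩
      · have := hf.1 i
        simp only [Finsupp.indicator_apply, Finset.mem_range]
        split_ifs with hi
        · exact this.1.trans_le (Nat.le_pow_clog (by omega) _)
        · rw [this.2 (by omega)]; simp
      · have := hf.2 i hi
        simp only [Finsupp.indicator_apply, Finset.mem_range, this, dif_pos]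
        exact Nat.clog_pos (by omega) (by omega)
    · simp only [Finsupp.indicator_apply]
      split_ifs <;> simp
    · rw [Finsupp.sum]
      refine (Finset.sum_le_sum_of_subset (Finsupp.support_indicator_subset _ _)).trans ?_
      refine (Finset.sum_le_card_nsmul _ _ (Nat.clog 2 (B n)) fun i _ => ?_).trans (by simp)
      simp only [Finsupp.indicator_apply]
      split_ifs
      simp
  · exact isBigO_const_const _ one_ne_zero _
  all_goals
    obtain ⟨a, d, had⟩ : ∃ a d, ∀ n, B n = a + d * n :=
      ⟨H + 3 * (K * (F * c) + 1) + 1, 3 * (K * (F * c)), fun n => by rw [hB, hN, hZ]; ring⟩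
    simp only [had]
  · simp only [Nat.cast_mul]
    exact (isBigO_linear a d).mul (isBigO_clog a d)
  · exact isBigO_clog a d

end SlidingWindow

/-! ### Functions that are computed by expressions -/

/-- A chosen representation of the elements of a type by S-expressions. -/
class Enc (X : Type*) where
  enc : X → SExp

section Enc

open SExp Enc

/-- The elements of a finite type are represented by atoms. -/
noncomputable instance Enc.ofFinite {F : Type*} [Finite F] : Enc F :=
  ⟨fun a => atom (Finite.equivFin F a)⟩

instance : Enc SExp := ⟨id⟩

instance {X Y : Type*} [Enc X] [Enc Y] : Enc (X × Y) := ⟨fun p => cons (enc p.1) (enc p.2)⟩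

/-- Lists are represented as in Lisp, where the atom `0` stands for the empty list. -/
def encList {X : Type*} [Enc X] : List X → SExp
  | [] => atom 0
  | a :: l => cons (enc a) (encList l)

instance {X : Type*} [Enc X] : Enc (List X) := ⟨encList⟩

variable {X Y Z A F : Type*} [Enc X] [Enc Y] [Enc Z] [Enc A] [Finite F]

@[simp] theorem enc_sexp (t : SExp) : enc t = t := rfl
@[simp] theorem enc_prod (x : X) (y : Y) : enc (x, y) = cons (enc x) (enc y) := rfl
@[simp] theorem enc_nil : enc ([] : List A) = atom 0 := rfl
@[simp] theorem enc_cons (a : A) (l : List A) : enc (a :: l) = cons (enc a) (enc l) := rfl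
theorem enc_finite (a : F) : enc a = atom (Finite.equivFin F a) := rfl

theorem SExp.isAtom_eq_true {a : ℕ} {t : SExp} : t.isAtom a = true ↔ t = atom a := by
  cases t <;> simp [isAtom]

theorem enc_finite_injective : Function.Injective (enc : F → SExp) := fun a b h => by
  simpa [enc_finite, Fin.val_inj] using h

/-- The function is computed by an expression, hence in constant time. -/
@[fun_prop]
def Comp (f : X → Y) : Prop := ∃ e : Code, ∀ x env, e.eval (enc x :: env) = enc (f x)

/-- An expression without variables for a given S-expression. -/
def SExp.toCode : SExp → Code
  | .atom a => .atom a
  | .cons a b => .cons a.toCode b.toCode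

theorem SExp.eval_toCode (t : SExp) (env : List SExp) : t.toCode.eval env = t := by
  induction t with
  | atom a => rfl
  | cons a b iha ihb => simp [toCode, Code.eval, iha, ihb]

namespace Comp

@[fun_prop]
theorem id : Comp (fun x : X => x) := ⟨.var 0, fun _ _ => rfl⟩

@[fun_prop]
theorem const (y : Y) : Comp (fun _ : X => y) := ⟨(enc y).toCode, fun _ _ => eval_toCode _ _⟩

@[fun_prop]
theorem comp {g : Y → Z} {f : X → Y} (hg : Comp g) (hf : Comp f) : Comp (fun x => g (f x)) := by
  obtain ⟨e, he⟩ := hf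
  obtain ⟨e', he'⟩ := hg
  exact ⟨.bind e e', fun x env => by rw [Code.eval, he, he']⟩

@[fun_prop]
theorem prodMk {f : X → Y} {g : X → Z} (hf : Comp f) (hg : Comp g) :
    Comp (fun x => (f x, g x)) := by
  obtain ⟨e, he⟩ := hf
  obtain ⟨e', he'⟩ := hg
  exact ⟨.cons e e', fun x env => by rw [Code.eval, he, he', enc_prod]⟩

@[fun_prop]
theorem fst {f : X → Y × Z} (hf : Comp f) : Comp (fun x => (f x).1) := by
  obtain ⟨e, he⟩ := hf
  exact ⟨.car e, fun x env => by rw [Code.eval, he]; rfl⟩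

@[fun_prop]
theorem snd {f : X → Y × Z} (hf : Comp f) : Comp (fun x => (f x).2) := by
  obtain ⟨e, he⟩ := hf
  exact ⟨.cdr e, fun x env => by rw [Code.eval, he]; rfl⟩

@[fun_prop]
theorem sexp_cons {f g : X → SExp} (hf : Comp f) (hg : Comp g) :
    Comp (fun x => SExp.cons (f x) (g x)) := by
  obtain ⟨e, he⟩ := hf
  obtain ⟨e', he'⟩ := hg
  exact ⟨.cons e e', fun x env => by rw [Code.eval, he, he']; rfl⟩

@[fun_prop]
theorem sexp_car {f : X → SExp} (hf : Comp f) : Comp (fun x => (f x).car) := by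
  obtain ⟨e, he⟩ := hf
  exact ⟨.car e, fun x env => by rw [Code.eval, he]; rfl⟩

@[fun_prop]
theorem sexp_cdr {f : X → SExp} (hf : Comp f) : Comp (fun x => (f x).cdr) := by
  obtain ⟨e, he⟩ := hf
  exact ⟨.cdr e, fun x env => by rw [Code.eval, he]; rfl⟩

@[fun_prop]
theorem enc {f : X → Y} (hf : Comp f) : Comp (fun x => Enc.enc (f x)) := hf

@[fun_prop]
theorem list_cons {f : X → A} {g : X → List A} (hf : Comp f) (hg : Comp g) :
    Comp (fun x => f x :: g x) := by
  obtain ⟨e, he⟩ := hf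
  obtain ⟨e', he'⟩ := hg
  exact ⟨.cons e e', fun x env => by rw [Code.eval, he, he']; rfl⟩

/-- Case distinction on a value from a finite type. -/
theorem finite_cases {f : F → X → Y} {g : X → F} (hg : Comp g) (hf : ∀ a, Comp (f a)) :
    Comp (fun x => f (g x) x) := by
  obtain ⟨e, he⟩ := hg
  choose e' he' using hf
  -- a chain of conditionals that compares the value with the elements of a list
  have : ∀ l : List F, ∃ c : Code, ∀ x env, g x ∈ l →
      c.eval (Enc.enc x :: env) = Enc.enc (f (g x) x) := by
    intro l
    induction l with
    | nil => exact ⟨.atom 0, by simp⟩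
    | cons a l ih =>
      obtain ⟨c, hc⟩ := ih
      refine ⟨.ite e (Finite.equivFin F a) (e' a) c, fun x env hx => ?_⟩
      rw [Code.eval, he]
      by_cases h : g x = a
      · rw [← h, show (Enc.enc (g x)).isAtom (Finite.equivFin F (g x)) = true from
          isAtom_eq_true.2 rfl, cond_true, he']
      · rw [show (Enc.enc (g x)).isAtom (Finite.equivFin F a) = false by
          rw [Bool.eq_false_iff]
          exact fun h' => h (enc_finite_injective (isAtom_eq_true.1 h')), cond_false]
        exact hc x env ((List.mem_cons.1 hx).resolve_left h)
  have hF := Fintype.ofFinite F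
  obtain ⟨c, hc⟩ := this Finset.univ.toList
  exact ⟨c, fun x env => hc x env (by simp)⟩

@[fun_prop]
theorem ite {p : X → Prop} [DecidablePred p] {f g : X → Y} (hp : Comp fun x => decide (p x))
    (hf : Comp f) (hg : Comp g) : Comp (fun x => if p x then f x else g x) := by
  have := finite_cases (f := fun b x => bif b then f x else g x) hp (by simp [hf, hg])
  simpa [Bool.cond_decide] using this

@[fun_prop]
theorem and {p q : X → Prop} [DecidablePred p] [DecidablePred q] (hp : Comp fun x => decide (p x))
    (hq : Comp fun x => decide (q x)) : Comp fun x => decide (p x ∧ q x) := by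
  have := finite_cases (f := fun b x => b && decide (q x)) hp (by simp [hq, const])
  simpa using this

@[fun_prop]
theorem not {p : X → Prop} [DecidablePred p] (hp : Comp fun x => decide (p x)) :
    Comp fun x => decide (¬p x) := by
  have := finite_cases (f := fun b (_ : X) => !b) hp (fun _ => const _)
  simpa using this

/-- Functions of finite data. -/
theorem of_finite {f : F → Y} : Comp f := finite_cases (f := fun a _ => f a) id fun _ => const _

theorem of_finite₂ {F' : Type*} [Finite F'] {f : F → F' → Y} {g : X → F} {g' : X → F'}
    (hg : Comp g) (hg' : Comp g') : Comp (fun x => f (g x) (g' x)) :=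
  finite_cases (f := fun a x => f a (g' x)) hg fun _ => of_finite.comp hg'

/-- Case distinction on a list. -/
theorem list_cases {f : X → List A → Y} {g : X → List A} (hg : Comp g) (h0 : Comp fun x => f x [])
    (h1 : Comp fun p : X × A × List A => f p.1 (p.2.1 :: p.2.2)) : Comp (fun x => f x (g x)) := by
  obtain ⟨e, he⟩ := hg
  obtain ⟨e0, he0⟩ := h0
  obtain ⟨e1, he1⟩ := h1
  refine ⟨.ite e 0 e0 (.bind (.cons (.var 0) e) e1), fun x env => ?_⟩
  rw [Code.eval, he]
  rcases h : g x with _ | ⟨a, l⟩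
  · rw [enc_nil, isAtom_eq_true.2 rfl, cond_true, he0]
    exact congrArg (fun l => Enc.enc (f x l)) h.symm
  · rw [enc_cons, show (SExp.cons (Enc.enc a) (Enc.enc l)).isAtom 0 = false from rfl, cond_false,
      Code.eval, Code.eval, he, h]
    exact (he1 (x, a, l) _).trans (congrArg (fun l => Enc.enc (f x l)) h.symm)

@[fun_prop]
theorem tail {g : X → List A} (hg : Comp g) : Comp (fun x => (g x).tail) :=
  list_cases (f := fun _ l => l.tail) hg (const _) (by simp only [List.tail_cons]; fun_prop)

@[fun_prop]
theorem headD {g : X → List A} {a : A} (hg : Comp g) : Comp (fun x => (g x).headD a) :=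
  list_cases (f := fun _ l => l.headD a) hg (const _) (by simp only [List.headD_cons]; fun_prop)

@[fun_prop]
theorem take {g : X → List A} (k : ℕ) (hg : Comp g) : Comp (fun x => (g x).take k) := by
  suffices Comp (fun l : List A => l.take k) from this.comp hg
  clear hg
  induction k with
  | zero => simpa using const _
  | succ k ih =>
    refine list_cases (f := fun _ l => l.take (k + 1)) id (const _) ?_
    simp only [List.take_succ_cons]
    fun_prop

@[fun_prop]
theorem drop {g : X → List A} (k : ℕ) (hg : Comp g) : Comp (fun x => (g x).drop k) := by
  suffices Comp (fun l : List A => l.drop k) from this.comp hg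
  clear hg
  induction k with
  | zero => simpa using id
  | succ k ih =>
    refine list_cases (f := fun _ l => l.drop (k + 1)) id (const _) ?_
    simp only [List.drop_succ_cons]
    fun_prop

@[fun_prop]
theorem length_le {g : X → List A} (k : ℕ) (hg : Comp g) :
    Comp (fun x => decide ((g x).length ≤ k)) := by
  suffices Comp (fun l : List A => decide (l.length ≤ k)) from this.comp hg
  clear hg
  induction k with
  | zero =>
    exact list_cases (f := fun _ l => decide (l.length ≤ 0)) id (const _) (by simpa using const _)
  | succ k ih =>
    refine list_cases (f := fun _ l => decide (l.length ≤ k + 1)) id (const _) ?_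
    simp only [List.length_cons, Nat.add_le_add_iff_right]
    exact ih.comp (f := fun p : List A × A × List A => p.2.2) (by fun_prop)

@[fun_prop]
theorem take_append {g h : X → List A} (k : ℕ) (hg : Comp g) (hh : Comp h) :
    Comp (fun x => (g x).take k ++ h x) := by
  suffices Comp (fun p : List A × List A => p.1.take k ++ p.2) from this.comp (hg.prodMk hh)
  clear hg hh
  induction k with
  | zero => simpa using snd id
  | succ k ih =>
    refine list_cases (f := fun (p : List A × List A) l => l.take (k + 1) ++ p.2) (fst id)
      (by simpa using snd id) ?_
    simp only [List.take_succ_cons, List.cons_append]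
    exact list_cons (by fun_prop) (ih.comp (f := fun p : (List A × List A) × A × List A =>
      (p.2.2, p.1.2)) (by fun_prop))

@[fun_prop]
theorem take_reverse {g : X → List A} (k : ℕ) (hg : Comp g) :
    Comp (fun x => ((g x).take k).reverse) := by
  suffices Comp (fun p : List A × List A => (p.1.take k).reverse ++ p.2) by
    simpa using this.comp (hg.prodMk (const []))
  clear hg
  induction k with
  | zero => simpa using snd id
  | succ k ih =>
    refine list_cases (f := fun (p : List A × List A) l => (l.take (k + 1)).reverse ++ p.2) (fst id)
      (by simpa using snd id) ?_
    simp only [List.take_succ_cons, List.reverse_cons, List.append_assoc, List.singleton_append]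
    exact ih.comp (f := fun p : (List A × List A) × A × List A => (p.2.2, p.2.1 :: p.1.2))
      (by fun_prop)

@[fun_prop]
theorem take_prod {M : Type*} [Monoid M] [Finite M] {v : A → M} (hv : Comp v) {g : X → List A}
    (k : ℕ) (hg : Comp g) : Comp (fun x => (((g x).take k).map v).prod) := by
  suffices Comp (fun l : List A => ((l.take k).map v).prod) from this.comp hg
  clear hg
  induction k with
  | zero => simpa using const _
  | succ k ih =>
    refine list_cases (f := fun _ l => ((l.take (k + 1)).map v).prod) id (const _) ?_
    simp only [List.take_succ_cons, List.map_cons, List.prod_cons]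
    exact of_finite₂ (f := (· * ·)) (by fun_prop)
      (ih.comp (f := fun p : List A × A × List A => p.2.2) (by fun_prop))

end Comp

open Classical in
/-- The element of a finite type that an S-expression stands for. (Its value for S-expressions that
do not represent an element is irrelevant.) -/
noncomputable def SExp.dec (F : Type*) [Finite F] [Nonempty F] (t : SExp) : F :=
  if h : ∃ a : F, enc a = t then h.choose else Classical.arbitrary F

@[simp] theorem SExp.dec_enc [Nonempty F] (a : F) : (enc a).dec F = a := by
  have h : ∃ b : F, enc b = enc a := ⟨a, rfl⟩
  rw [dec, dif_pos h]
  exact enc_finite_injective h.choose_spec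

@[fun_prop]
theorem Comp.dec [Nonempty F] {f : X → SExp} (hf : Comp f) : Comp (fun x => (f x).dec F) := by
  suffices Comp (fun t : SExp => t.dec F) from this.comp hf
  have : ∀ l : List F, ∃ c : Code, ∀ t env, t.dec F ∈ l ∨ (¬∃ a : F, Enc.enc a = t) →
      c.eval (t :: env) = Enc.enc (t.dec F) := by
    intro l
    induction l with
    | nil =>
      refine ⟨(Enc.enc (Classical.arbitrary F)).toCode, fun t env h => ?_⟩
      rw [eval_toCode, SExp.dec, dif_neg (h.resolve_left (by simp))]
    | cons a l ih =>
      obtain ⟨c, hc⟩ := ih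
      refine ⟨.ite (.var 0) (Finite.equivFin F a) (Enc.enc a).toCode c, fun t env ht => ?_⟩
      rw [Code.eval, eval_toCode]
      cases h : (Code.eval (.var 0) (t :: env)).isAtom (Finite.equivFin F a) with
      | true =>
        have : t = Enc.enc a := isAtom_eq_true.1 h
        rw [this, SExp.dec_enc, cond_true]
      | false =>
        rw [cond_false]
        refine hc t env ?_
        by_cases hex : ∃ b : F, Enc.enc b = t
        · refine .inl ((List.mem_cons.1 (ht.resolve_right (by simpa using hex))).resolve_left ?_)
          obtain ⟨b, rfl⟩ := hex
          rw [SExp.dec_enc]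
          rintro rfl
          have : (Code.eval (.var 0) (Enc.enc b :: env)).isAtom (Finite.equivFin F b) = true :=
            isAtom_eq_true.2 rfl
          rw [this] at h
          cases h
        · exact .inr hex
  have hF := Fintype.ofFinite F
  obtain ⟨c, hc⟩ := this Finset.univ.toList
  exact ⟨c, fun x env => hc x env (.inl (by simp))⟩

end Enc

/-! ### Deques with products -/

@[fun_prop]
theorem Comp.mul {X M : Type*} [Enc X] [Monoid M] [Finite M] {f g : X → M} (hf : Comp f)
    (hg : Comp g) : Comp (fun x => f x * g x) :=
  Comp.of_finite₂ (f := (· * ·)) hf hg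

namespace Deque

open SExp Enc

variable (M : Type*) [Monoid M] [Finite M]

/-- The value of an element of a deque. -/
noncomputable def val (t : SExp) : M := t.car.dec M

/-- Two consecutive elements as a single element. -/
noncomputable def pair (x y : SExp) : SExp := cons (enc (val M x * val M y)) (cons x y)

/-- The pair of the elements `x` and `y`; if `o` is true, then `y` comes first. -/
noncomputable def opair (o : Bool) (x y : SExp) : SExp := bif o then pair M y x else pair M x y

/-- The first, or for true `o` the second, component of a pair. -/
def outer (o : Bool) (t : SExp) : SExp := bif o then t.cdr.cdr else t.cdr.car

/-- The second, or for true `o` the first, component of a pair. -/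
def inner (o : Bool) (t : SExp) : SExp := bif o then t.cdr.car else t.cdr.cdr

/-- A short list of elements. -/
abbrev Buf := List SExp

/-- A level of a deque consists of the product of the elements on all levels below, the list of the
leftmost elements, and the list of the rightmost elements in reversed order. -/
abbrev Lvl := M × Buf × Buf

/-- A deque has a sequence of levels and, below them, a bottom buffer. The elements on level `i` are
pairs of pairs … of elements, nested `i` times. The sequence of levels is divided into packets that
start with a level which is not yellow and continue with yellow levels; only the first packet may
start with a yellow level as well. -/
abbrev Dq := List (Lvl M × List (Lvl M)) × Buf

/-- For true `o` the reversed buffer (which has at most 8 elements). -/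
def orient (o : Bool) (b : Buf) : Buf := bif o then (b.take 8).reverse else b

/-- The product of a buffer, read backwards if `o` is true. -/
noncomputable def total (o : Bool) (b : Buf) : M := (((orient o b).take 8).map (val M)).prod

/-- If the first buffer is long, two elements at its end are moved as a pair to the second one. -/
noncomputable def shed (o : Bool) (x : Buf × Buf) : Buf × Buf :=
  if x.1.length ≤ 3 then x
  else if x.1.length ≤ 4 then
    (x.1.take 2, opair M o ((x.1.drop 2).headD (atom 0)) ((x.1.drop 3).headD (atom 0)) :: x.2)
  else (x.1.take 3, opair M o ((x.1.drop 3).headD (atom 0)) ((x.1.drop 4).headD (atom 0)) :: x.2)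

/-- If the first buffer is short, a pair is moved from the second one to the end of the first. -/
def fill (o : Bool) (x : Buf × Buf) : Buf × Buf :=
  if x.1.length ≤ 1 ∧ ¬x.2.length ≤ 0 then
    (x.1.take 1 ++ [outer o (x.2.headD (atom 0)), inner o (x.2.headD (atom 0))], x.2.tail)
  else x

variable {M}

/-- A level is safe, that is, not red, if an element can be added or removed on each side such that
the buffer lengths remain between 0 and 5. -/
def Safe (l : Lvl M) : Prop :=
  (¬l.2.1.length ≤ 0 ∧ l.2.1.length ≤ 4) ∧ (¬l.2.2.length ≤ 0 ∧ l.2.2.length ≤ 4)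

instance (l : Lvl M) : Decidable (Safe l) := by unfold Safe; infer_instance

/-- A level is green if it remains safe when an element is added or removed on each side. The safe
levels that are not green are the yellow ones. -/
def Green (l : Lvl M) : Prop :=
  (¬l.2.1.length ≤ 1 ∧ l.2.1.length ≤ 3) ∧ (¬l.2.2.length ≤ 1 ∧ l.2.2.length ≤ 3)

instance (l : Lvl M) : Decidable (Green l) := by unfold Green; infer_instance

/-- Making the level `x.1` green by means of the next level `x.2`. -/
noncomputable def xfer (x : Lvl M × Lvl M) : Lvl M × Lvl M :=
  let a := fill false (shed M false (x.1.2.1, x.2.2.1))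
  let c := fill true (shed M true (x.1.2.2, x.2.2.2))
  ((total M false a.2 * x.2.1 * total M true c.2, a.1, c.1), (x.2.1, a.2, c.2))

/-- The deque with the levels `x.1.1` and `x.1.2`, the yellow levels `x.2.1`, the packets `x.2.2.1`
and the bottom buffer `x.2.2.2`. -/
def assemble (x : (Lvl M × Lvl M) × List (Lvl M) × List (Lvl M × List (Lvl M)) × Buf) : Dq M :=
  if Safe x.1.2 ∧ ¬Green x.1.2 then ((x.1.1, x.1.2 :: x.2.1) :: x.2.2.1, x.2.2.2)
  else ((x.1.1, []) :: (x.1.2, x.2.1) :: x.2.2.1, x.2.2.2)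

/-- The deque with the single level `x.1` and the bottom buffer `x.2`, which is turned into a second
level if it is long. -/
noncomputable def withBottom (x : (Buf × Buf) × Buf) : Dq M :=
  if x.2.length ≤ 6 then ([((total M false x.2, x.1), [])], x.2)
  else ([((total M false x.2, x.1), [(1, x.2.take 4, orient true (x.2.drop 4))])], [])

/-- The buffers `x.1` of the last level and the bottom buffer `x.2`, after moving pairs between them
if necessary. -/
noncomputable def balance (M : Type*) [Monoid M] [Finite M] (x : (Buf × Buf) × Buf) :
    (Buf × Buf) × Buf :=
  let a := shed M false (x.1.1, x.2)
  let c := shed M true (x.1.2, orient true a.2)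
  let a' := fill false (a.1, orient true c.2)
  let c' := fill true (c.1, orient true a'.2)
  ((a'.1, c'.1), orient true c'.2)

/-- Making the last level green by means of the bottom buffer. If this fails, the level itself
becomes the bottom buffer. -/
noncomputable def bottomFix (x : (Buf × Buf) × Buf) : Dq M :=
  let y := balance M x
  if ¬y.1.1.length ≤ 1 ∧ ¬y.1.2.length ≤ 1 then withBottom y
  else ([], y.1.1.take 8 ++ orient true y.1.2)

/-- Making the level `l` green, where `l` and `ys` form the first packet. -/
noncomputable def fixHead (l : Lvl M) : List (Lvl M) → List (Lvl M × List (Lvl M)) → Buf → Dq M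
  | y :: ys, rest, b => assemble (xfer (l, y), ys, rest, b)
  | [], p :: rest, b => assemble (xfer (l, p.1), p.2, rest, b)
  | [], [], b => bottomFix (l.2, b)

/-- Restoring the invariants when the first packet starts with `l`: the first level that is not
yellow has to be made green if it is red. -/
noncomputable def restore (l : Lvl M) (ys : List (Lvl M)) (b : Buf) :
    List (Lvl M × List (Lvl M)) → Dq M
  | [] => if Safe l then ([(l, ys)], b) else fixHead l ys [] b
  | p :: rest =>
    if Safe l then
      if Safe p.1 then ((l, ys) :: p :: rest, b)
      else
        let d := fixHead p.1 p.2 rest b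
        ((l, ys) :: d.1, d.2)
    else fixHead l ys (p :: rest) b

/-- The level `l` with `f` applied to its left or, for true `o`, its right buffer. -/
def modify (o : Bool) (f : Buf → Buf) (l : Lvl M) : Lvl M :=
  bif o then (l.1, l.2.1, f l.2.2) else (l.1, f l.2.1, l.2.2)

/-- The deque whose only elements are in a buffer of length at most 7. -/
noncomputable def ofBuf (b : Buf) : Dq M :=
  if b.length ≤ 6 then ([], b) else ([((1, b.take 4, orient true (b.drop 4)), [])], [])

/-- Adding an element at the left or, for true `o`, at the right end. -/
noncomputable def push (o : Bool) (x : SExp) (b : Buf) : List (Lvl M × List (Lvl M)) → Dq M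
  | [] => ofBuf (orient o (x :: orient o b))
  | p :: rest => restore (modify o (x :: ·) p.1) p.2 b rest

/-- Removing the element at the left or, for true `o`, at the right end. -/
noncomputable def pop (o : Bool) (b : Buf) : List (Lvl M × List (Lvl M)) → Dq M
  | [] => ([], orient o (orient o b).tail)
  | p :: rest => restore (modify o List.tail p.1) p.2 b rest

/-- The element at the left or, for true `o`, at the right end. -/
def peek (o : Bool) (b : Buf) : List (Lvl M × List (Lvl M)) → SExp
  | [] => (orient o b).headD (atom 0)
  | p :: _ => bif o then p.1.2.2.headD (atom 0) else p.1.2.1.headD (atom 0)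

/-- The product of all elements. -/
noncomputable def product (b : Buf) : List (Lvl M × List (Lvl M)) → M
  | [] => total M false b
  | p :: _ => total M false p.1.2.1 * p.1.1 * total M true p.1.2.2

/-- Whether there are no elements. -/
def empty (d : Dq M) : Bool := decide (d.1.length ≤ 0 ∧ d.2.length ≤ 0)

section Comp

variable {X : Type*} [Enc X]

@[fun_prop]
theorem comp_val {f : X → SExp} (hf : Comp f) : Comp (fun x => val M (f x)) := by
  unfold val; fun_prop

@[fun_prop]
theorem comp_opair (o : Bool) {f g : X → SExp} (hf : Comp f) (hg : Comp g) :
    Comp (fun x => opair M o (f x) (g x)) := by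
  cases o <;> simp only [opair, pair, cond_true, cond_false] <;> fun_prop

@[fun_prop]
theorem comp_outer (o : Bool) {f : X → SExp} (hf : Comp f) : Comp (fun x => outer o (f x)) := by
  cases o <;> simp only [outer, cond_true, cond_false] <;> fun_prop

@[fun_prop]
theorem comp_inner (o : Bool) {f : X → SExp} (hf : Comp f) : Comp (fun x => inner o (f x)) := by
  cases o <;> simp only [inner, cond_true, cond_false] <;> fun_prop

@[fun_prop]
theorem comp_orient (o : Bool) {f : X → Buf} (hf : Comp f) : Comp (fun x => orient o (f x)) := by
  cases o <;> simp only [orient, cond_true, cond_false] <;> fun_prop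

@[fun_prop]
theorem comp_total (o : Bool) {f : X → Buf} (hf : Comp f) : Comp (fun x => total M o (f x)) := by
  unfold total
  exact Comp.take_prod (comp_val Comp.id) 8 (by fun_prop)

@[fun_prop]
theorem comp_shed (o : Bool) {f : X → Buf × Buf} (hf : Comp f) :
    Comp (fun x => shed M o (f x)) := by
  unfold shed
  fun_prop

@[fun_prop]
theorem comp_fill (o : Bool) {f : X → Buf × Buf} (hf : Comp f) : Comp (fun x => fill o (f x)) := by
  unfold fill
  fun_prop

omit [Monoid M] in
@[fun_prop]
theorem comp_green {f : X → Lvl M} (hf : Comp f) : Comp (fun x => decide (Green (f x))) := by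
  unfold Green
  fun_prop

@[fun_prop]
theorem comp_xfer {f : X → Lvl M × Lvl M} (hf : Comp f) : Comp (fun x => xfer (f x)) := by
  unfold xfer
  fun_prop

omit [Monoid M] in
@[fun_prop]
theorem comp_assemble {f : X → (Lvl M × Lvl M) × List (Lvl M) × List (Lvl M × List (Lvl M)) × Buf}
    (hf : Comp f) : Comp (fun x => assemble (f x)) := by
  unfold assemble
  fun_prop

@[fun_prop]
theorem comp_withBottom {f : X → (Buf × Buf) × Buf} (hf : Comp f) :
    Comp (fun x => (withBottom (f x) : Dq M)) := by
  unfold withBottom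
  fun_prop

@[fun_prop]
theorem comp_balance {f : X → (Buf × Buf) × Buf} (hf : Comp f) :
    Comp (fun x => balance M (f x)) := by
  unfold balance
  fun_prop

@[fun_prop]
theorem comp_bottomFix {f : X → (Buf × Buf) × Buf} (hf : Comp f) :
    Comp (fun x => (bottomFix (f x) : Dq M)) := by
  unfold bottomFix
  fun_prop

theorem comp_fixHead {f : X → Lvl M} {g : X → List (Lvl M)} {h : X → List (Lvl M × List (Lvl M))}
    {k : X → Buf} (hf : Comp f) (hg : Comp g) (hh : Comp h) (hk : Comp k) :
    Comp (fun x => fixHead (f x) (g x) (h x) (k x)) := by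
  refine Comp.list_cases (f := fun x l => fixHead (f x) l (h x) (k x)) hg ?_ ?_
  · refine Comp.list_cases (f := fun x l => fixHead (f x) [] l (k x)) hh ?_ ?_
    · simp only [fixHead]; fun_prop
    · simp only [fixHead]; fun_prop
  · simp only [fixHead]; fun_prop

theorem comp_restore {f : X → Lvl M} {g : X → List (Lvl M)} {h : X → List (Lvl M × List (Lvl M))}
    {k : X → Buf} (hf : Comp f) (hg : Comp g) (hk : Comp k) (hh : Comp h) :
    Comp (fun x => restore (f x) (g x) (k x) (h x)) := by
  refine Comp.list_cases (f := fun x l => restore (f x) (g x) (k x) l) hh ?_ ?_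
  · simp only [restore]
    refine Comp.ite (by fun_prop) (by fun_prop) (comp_fixHead hf hg (by fun_prop) hk)
  · simp only [restore]
    have h1 := comp_fixHead (X := X × (Lvl M × List (Lvl M)) × List (Lvl M × List (Lvl M)))
      (f := fun p => p.2.1.1) (g := fun p => p.2.1.2) (h := fun p => p.2.2) (k := fun p => k p.1)
      (by fun_prop) (by fun_prop) (by fun_prop) (by fun_prop)
    refine Comp.ite (by fun_prop) (Comp.ite (by fun_prop) (by fun_prop) ?_)
      (comp_fixHead (by fun_prop) (by fun_prop) (by fun_prop) (by fun_prop))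
    exact (Comp.list_cons (by fun_prop) (Comp.fst h1)).prodMk (Comp.snd h1)

theorem comp_push (o : Bool) {f : X → SExp} {d : X → Dq M} (hf : Comp f) (hd : Comp d) :
    Comp (fun x => push o (f x) (d x).2 (d x).1) := by
  refine Comp.list_cases (f := fun x l => push o (f x) (d x).2 l) (Comp.fst hd) ?_ ?_
  · simp only [push, ofBuf]; fun_prop
  · simp only [push]
    refine comp_restore ?_ (by fun_prop) (by fun_prop) (by fun_prop)
    cases o <;> simp only [modify, cond_true, cond_false] <;> fun_prop

theorem comp_pop (o : Bool) {d : X → Dq M} (hd : Comp d) :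
    Comp (fun x => pop o (d x).2 (d x).1) := by
  refine Comp.list_cases (f := fun x l => pop o (d x).2 l) (Comp.fst hd) ?_ ?_
  · simp only [pop]; fun_prop
  · simp only [pop]
    refine comp_restore ?_ (by fun_prop) (by fun_prop) (by fun_prop)
    cases o <;> simp only [modify, cond_true, cond_false] <;> fun_prop

omit [Monoid M] in
theorem comp_peek (o : Bool) {d : X → Dq M} (hd : Comp d) :
    Comp (fun x => peek o (d x).2 (d x).1) := by
  refine Comp.list_cases (f := fun x l => peek o (d x).2 l) (Comp.fst hd) ?_ ?_
  · simp only [peek]; fun_prop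
  · simp only [peek]
    cases o <;> simp only [cond_true, cond_false] <;> fun_prop

theorem comp_product {d : X → Dq M} (hd : Comp d) :
    Comp (fun x => product (d x).2 (d x).1) := by
  refine Comp.list_cases (f := fun x l => product (d x).2 l) (Comp.fst hd) ?_ ?_
  · simp only [product]; fun_prop
  · simp only [product]; fun_prop

omit [Monoid M] in
theorem comp_empty {d : X → Dq M} (hd : Comp d) : Comp (fun x => empty (d x)) := by
  unfold empty; fun_prop

end Comp

end Deque

namespace Deque

open SExp Enc

section Flat

/-- The elements that a nested pair on level `i` consists of. -/
def flat : ℕ → SExp → List SExp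
  | 0, e => [e]
  | i + 1, e => flat i (outer false e) ++ flat i (inner false e)

variable (M : Type*) [Monoid M] [Finite M]

/-- Nested pairs on level `i`. -/
def Ok : ℕ → SExp → Prop
  | 0, _ => True
  | i + 1, e => ∃ x y, e = pair M x y ∧ Ok i x ∧ Ok i y

/-- All elements of a buffer are nested pairs on level `i`. -/
def OkAll (i : ℕ) (b : Buf) : Prop := ∀ e ∈ b, Ok M i e

/-- The elements in the buffers `x.1` on level `i` and `x.2` on level `i + 1`, which follow each
other from the outside to the inside, where the outside is at the left or, for true `o`, at the
right. -/
def seq (o : Bool) (i : ℕ) (x : Buf × Buf) : List SExp :=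
  bif o then x.2.reverse.flatMap (flat (i + 1)) ++ x.1.reverse.flatMap (flat i)
  else x.1.flatMap (flat i) ++ x.2.flatMap (flat (i + 1))

variable {M}

@[simp] theorem outer_pair (x y : SExp) : outer false (pair M x y) = x := rfl
@[simp] theorem inner_pair (x y : SExp) : inner false (pair M x y) = y := rfl

@[simp] theorem val_pair (x y : SExp) : val M (pair M x y) = val M x * val M y := by
  simp [val, pair, SExp.car]

theorem val_eq_prod {i : ℕ} {e : SExp} (h : Ok M i e) :
    val M e = ((flat i e).map (val M)).prod := by
  induction i generalizing e with
  | zero => simp [flat]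
  | succ i ih =>
    obtain ⟨x, y, rfl, hx, hy⟩ := h
    simp [flat, ih hx, ih hy]

theorem orient_true {b : Buf} (h : b.length ≤ 8) : orient true b = b.reverse := by
  simp [orient, List.take_of_length_le h]

theorem total_false {i : ℕ} {b : Buf} (h : OkAll M i b) (hl : b.length ≤ 8) :
    total M false b = ((b.flatMap (flat i)).map (val M)).prod := by
  rw [total, orient, cond_false, List.take_of_length_le hl]
  clear hl
  induction b with
  | nil => rfl
  | cons e b ih =>
    simp [val_eq_prod (h e (by simp)), ih fun e he => h e (by simp [he])]

theorem total_true {i : ℕ} {b : Buf} (h : OkAll M i b) (hl : b.length ≤ 8) :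
    total M true b = ((b.reverse.flatMap (flat i)).map (val M)).prod := by
  rw [← total_false (b := b.reverse) (fun e he => h e (by simpa using he)) (by simpa using hl),
    total, orient_true hl]
  rfl

theorem seq_shed (o : Bool) (i : ℕ) {p q : Buf} (hp : p.length ≤ 5) :
    seq o i (shed M o (p, q)) = seq o i (p, q) := by
  match p, hp with
  | [], _ | [_], _ | [_, _], _ | [_, _, _], _ => simp [shed]
  | [a, b, c, d], _ => cases o <;> simp [shed, seq, opair, flat]
  | [a, b, c, d, e], _ => cases o <;> simp [shed, seq, opair, flat]
  | _ :: _ :: _ :: _ :: _ :: _ :: _, h => simp at h; omega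

theorem seq_fill (o : Bool) (i : ℕ) (p q : Buf) : seq o i (fill o (p, q)) = seq o i (p, q) := by
  match p, q with
  | _, [] => simp [fill]
  | [], e :: q => cases o <;> simp [fill, seq, flat, outer, inner]
  | [a], e :: q => cases o <;> simp [fill, seq, flat, outer, inner]
  | _ :: _ :: _, e :: q => simp [fill]

theorem Ok.opair (o : Bool) {i : ℕ} {x y : SExp} (hx : Ok M i x) (hy : Ok M i y) :
    Ok M (i + 1) (opair M o x y) := by
  cases o
  · exact ⟨x, y, rfl, hx, hy⟩
  · exact ⟨y, x, rfl, hy, hx⟩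

theorem Ok.comps (o : Bool) {i : ℕ} {e : SExp} (he : Ok M (i + 1) e) :
    Ok M i (outer o e) ∧ Ok M i (inner o e) := by
  obtain ⟨x, y, rfl, hx, hy⟩ := he
  cases o
  · exact ⟨hx, hy⟩
  · exact ⟨hy, hx⟩

theorem okAll_shed (o : Bool) {i : ℕ} {p q : Buf} (hl : p.length ≤ 5) (hp : OkAll M i p)
    (hq : OkAll M (i + 1) q) :
    OkAll M i (shed M o (p, q)).1 ∧ OkAll M (i + 1) (shed M o (p, q)).2 := by
  match p, hl with
  | [], _ | [_], _ | [_, _], _ | [_, _, _], _ => simpa [shed] using ⟨hp, hq⟩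
  | [a, b, c, d], _ =>
    simp only [OkAll, List.mem_cons, List.not_mem_nil, or_false, forall_eq_or_imp, forall_eq] at hp
    simp only [shed]
    simp only [OkAll, List.length_cons, List.length_nil, Nat.reduceAdd, Nat.reduceLeDiff, if_true,
      if_false, List.take, List.drop, List.headD_cons, List.mem_cons, List.not_mem_nil, or_false,
      forall_eq_or_imp, forall_eq]
    exact ⟨⟨hp.1, hp.2.1⟩, hp.2.2.1.opair o hp.2.2.2, hq⟩
  | [a, b, c, d, e], _ =>
    simp only [OkAll, List.mem_cons, List.not_mem_nil, or_false, forall_eq_or_imp, forall_eq] at hp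
    simp only [shed]
    simp only [OkAll, List.length_cons, List.length_nil, Nat.reduceAdd, Nat.reduceLeDiff,
      if_false, List.take, List.drop, List.headD_cons, List.mem_cons, List.not_mem_nil, or_false,
      forall_eq_or_imp, forall_eq]
    exact ⟨⟨hp.1, hp.2.1, hp.2.2.1⟩, hp.2.2.2.1.opair o hp.2.2.2.2, hq⟩
  | _ :: _ :: _ :: _ :: _ :: _ :: _, h => simp at h; omega

theorem okAll_fill (o : Bool) {i : ℕ} {p q : Buf} (hp : OkAll M i p)
    (hq : OkAll M (i + 1) q) :
    OkAll M i (fill o (p, q)).1 ∧ OkAll M (i + 1) (fill o (p, q)).2 := by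
  unfold fill
  split_ifs with h
  · obtain ⟨e, q, rfl⟩ := List.exists_cons_of_length_pos (Nat.pos_of_ne_zero (by simpa using h.2))
    refine ⟨fun a ha => ?_, fun a ha => hq a (by simp at ha; simp [ha])⟩
    have he := (hq e (by simp)).comps o
    simp only [List.headD_cons, List.mem_append, List.mem_cons, List.not_mem_nil, or_false] at ha
    rcases ha with ha | rfl | rfl
    · exact hp a (List.mem_of_mem_take ha)
    · exact he.1
    · exact he.2
  · exact ⟨hp, hq⟩

theorem length_shed (o : Bool) {p q : Buf} (hp : p.length ≤ 5) :
    (shed M o (p, q)).1.length = (if p.length ≤ 3 then p.length else p.length - 2) ∧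
    (shed M o (p, q)).2.length = (if p.length ≤ 3 then q.length else q.length + 1) := by
  unfold shed
  split_ifs <;> simp_all <;> omega

theorem length_fill (o : Bool) (p q : Buf) :
    (fill o (p, q)).1.length =
      (if p.length ≤ 1 ∧ ¬q.length ≤ 0 then p.length + 2 else p.length) ∧
    (fill o (p, q)).2.length =
      (if p.length ≤ 1 ∧ ¬q.length ≤ 0 then q.length - 1 else q.length) := by
  unfold fill
  split_ifs <;> simp_all

end Flat

variable {M : Type*} [Monoid M] [Finite M]

/-- All elements on the levels `ls`, of which the first has number `i`, and the bottom buffer. -/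
def toL : ℕ → List (Lvl M) → Buf → List SExp
  | i, [], b => b.flatMap (flat i)
  | i, l :: ls, b => l.2.1.flatMap (flat i) ++ toL (i + 1) ls b ++ l.2.2.reverse.flatMap (flat i)

/-- The elements on the levels `ls`, of which the first has number `i`, and in the bottom buffer are
suitably nested, and the stored products are correct. -/
def WF : ℕ → List (Lvl M) → Buf → Prop
  | i, [], b => OkAll M i b
  | i, l :: ls, b => OkAll M i l.2.1 ∧ OkAll M i l.2.2 ∧
      l.1 = ((toL (i + 1) ls b).map (val M)).prod ∧ WF (i + 1) ls b

/-- The buffers of a level have length at most 5. -/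
def Small (l : Lvl M) : Prop := l.2.1.length ≤ 5 ∧ l.2.2.length ≤ 5

/-- If the next level `n` is safe, it can absorb one pair and supply one pair on each side. -/
theorem xfer_spec {i : ℕ} {l n : Lvl M} {ls : List (Lvl M)} {b : Buf} (h : WF i (l :: n :: ls) b)
    (hl : Small l) (hn : Safe n) :
    WF i ((xfer (l, n)).1 :: (xfer (l, n)).2 :: ls) b ∧
      toL i ((xfer (l, n)).1 :: (xfer (l, n)).2 :: ls) b = toL i (l :: n :: ls) b ∧
      Green (xfer (l, n)).1 ∧ Small (xfer (l, n)).2 ∧ (Green n → Safe (xfer (l, n)).2) := by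
  obtain ⟨m, p, s⟩ := l
  obtain ⟨k, q, t⟩ := n
  obtain ⟨hp, hs, hm, hq, ht, hk, h⟩ := h
  obtain ⟨hlp, hls⟩ := hl
  simp only [Safe] at hn
  simp only at hp hs hq ht hlp hls hk
  have o1 := okAll_shed false hlp hp hq
  have o2 := okAll_shed true hls hs ht
  have f1 := okAll_fill false o1.1 o1.2
  have f2 := okAll_fill true o2.1 o2.2
  have l1 := length_shed (M := M) false (q := q) hlp
  have l2 := length_shed (M := M) true (q := t) hls
  have g1 := length_fill false (shed M false (p, q)).1 (shed M false (p, q)).2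
  have g2 := length_fill true (shed M true (s, t)).1 (shed M true (s, t)).2
  have e1 := (seq_fill false i (shed M false (p, q)).1 (shed M false (p, q)).2).trans
    (seq_shed (M := M) false i hlp)
  have e2 := (seq_fill true i (shed M true (s, t)).1 (shed M true (s, t)).2).trans
    (seq_shed (M := M) true i hls)
  simp only [xfer, Small, Green, Safe, WF]
  simp only [Prod.mk.eta] at f1 f2 g1 g2 e1 e2
  generalize fill false (shed M false (p, q)) = a at *
  generalize fill true (shed M true (s, t)) = c at *
  generalize shed M false (p, q) = a0 at *
  generalize shed M true (s, t) = c0 at *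
  refine ⟨⟨f1.1, f2.1, ?_, f1.2, f2.2, hk, h⟩, ?_, ?_, ?_, ?_⟩
  · have : a.2.length ≤ 8 := by split_ifs at * <;> omega
    have : c.2.length ≤ 8 := by split_ifs at * <;> omega
    rw [total_false f1.2 (by assumption), total_true f2.2 (by assumption), hk]
    simp only [toL, List.map_append, List.prod_append]
  · simp only [seq, cond_true, cond_false] at e1 e2
    simp only [toL, List.append_assoc]
    rw [e2, ← List.append_assoc, e1]
    simp only [List.append_assoc]
  all_goals split_ifs at * <;> omega


/-- Replacing the levels `ls` and the bottom buffer `b` by `ls'` and `b'` is a legal restructuring,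
where the first of these levels has number `i`. -/
def Same (i : ℕ) (ls : List (Lvl M)) (b : Buf) (ls' : List (Lvl M)) (b' : Buf) : Prop :=
  WF i ls b → WF i ls' b' ∧ toL i ls' b' = toL i ls b

theorem Same.cons {i : ℕ} {ls ls' : List (Lvl M)} {b b' : Buf} (h : Same (i + 1) ls b ls' b')
    (l : Lvl M) : Same i (l :: ls) b (l :: ls') b' := by
  rintro ⟨h1, h2, h3, h4⟩
  obtain ⟨h5, h6⟩ := h h4
  exact ⟨⟨h1, h2, by rw [h6, h3], h5⟩, by simp only [toL, h6]⟩

theorem Same.append {ls ls' : List (Lvl M)} {b b' : Buf} (h : ∀ i, Same i ls b ls' b') (i : ℕ)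
    (a : List (Lvl M)) : Same i (a ++ ls) b (a ++ ls') b' := by
  induction a generalizing i with
  | nil => exact h i
  | cons l a ih => exact (ih (i + 1)).cons l

theorem WF.tail {i : ℕ} {a ls : List (Lvl M)} {b : Buf} (h : WF i (a ++ ls) b) :
    ∃ j, WF j ls b := by
  induction a generalizing i with
  | nil => exact ⟨i, h⟩
  | cons l a ih => exact ih h.2.2.2

/-- The levels of a sequence of packets. -/
def lv (ch : List (Lvl M × List (Lvl M))) : List (Lvl M) := ch.flatMap fun p => p.1 :: p.2

/-- A level is yellow if it is safe but not green. -/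
def Yellow (l : Lvl M) : Prop := Safe l ∧ ¬Green l

omit [Monoid M] [Finite M] in
theorem Green.safe {l : Lvl M} (h : Green l) : Safe l := by
  simp only [Green, Safe] at *; omega

/-- The packets are in a regular state, where `g` says whether the level that is not yellow and
precedes the packets is green: each packet consists of a green or red level followed by yellow ones,
and a red level is only allowed if the last level before it that is not yellow is green. -/
def Good : Prop → List (Lvl M × List (Lvl M)) → Prop
  | _, [] => True
  | g, p :: rest => (Green p.1 ∨ g ∧ ¬Safe p.1 ∧ Small p.1) ∧ (∀ y ∈ p.2, Yellow y) ∧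
      Good (Green p.1) rest

omit [Monoid M] [Finite M] in
theorem Good.mono {g g' : Prop} (h : g → g') {ch : List (Lvl M × List (Lvl M))} (hc : Good g ch) :
    Good g' ch := by
  cases ch with
  | nil => trivial
  | cons p rest => exact ⟨hc.1.imp_right fun h1 => ⟨h h1.1, h1.2⟩, hc.2⟩

omit [Monoid M] [Finite M] in
theorem lv_assemble (x : Lvl M × Lvl M) (ys : List (Lvl M)) (rest : List (Lvl M × List (Lvl M)))
    (b : Buf) : lv (assemble (x, ys, rest, b)).1 = x.1 :: x.2 :: (ys ++ lv rest) ∧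
      (assemble (x, ys, rest, b)).2 = b := by
  unfold assemble
  split_ifs <;> simp [lv]

omit [Monoid M] [Finite M] in
theorem good_assemble {x : Lvl M × Lvl M} {ys : List (Lvl M)}
    {rest : List (Lvl M × List (Lvl M))} (b : Buf) (h1 : Green x.1) (h2 : Small x.2)
    (hys : ∀ y ∈ ys, Yellow y) (h : Good (Safe x.2) rest) :
    Good False (assemble (x, ys, rest, b)).1 := by
  unfold assemble
  split_ifs with hx
  · refine ⟨.inl h1, fun y hy => ?_, h.mono fun _ => h1⟩
    rcases List.mem_cons.1 hy with rfl | hy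
    exacts [hx, hys y hy]
  · refine ⟨.inl h1, by simp, ?_, hys, h.mono fun hs => not_not.1 fun hg => hx ⟨hs, hg⟩⟩
    by_cases hg : Green x.2
    · exact .inl hg
    · exact .inr ⟨h1, fun hs => hx ⟨hs, hg⟩, h2⟩

/-- After `balance`, both buffers of the last level have length 2 or 3, unless there are no further
elements below it. -/
theorem balance_spec {i : ℕ} {p s b : Buf} (hp : OkAll M i p) (hs : OkAll M i s)
    (hb : OkAll M (i + 1) b) (hlp : p.length ≤ 5) (hls : s.length ≤ 5) (hlb : b.length ≤ 6) :
    ∃ p' s' b', balance M ((p, s), b) = ((p', s'), b') ∧ OkAll M i p' ∧ OkAll M i s' ∧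
      OkAll M (i + 1) b' ∧ p'.length ≤ 3 ∧ s'.length ≤ 3 ∧ b'.length ≤ 8 ∧
      (p'.length ≤ 1 ∨ s'.length ≤ 1 → b' = []) ∧
      p'.flatMap (flat i) ++ b'.flatMap (flat (i + 1)) ++ s'.reverse.flatMap (flat i) =
        p.flatMap (flat i) ++ b.flatMap (flat (i + 1)) ++ s.reverse.flatMap (flat i) := by
  have okr : ∀ {j} {q : Buf}, OkAll M j q → OkAll M j q.reverse := fun h e he =>
    h e (by simpa using he)
  have o1 := okAll_shed false hlp hp hb
  have l1 := length_shed (M := M) false (q := b) hlp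
  have e1 := seq_shed (M := M) false i (q := b) hlp
  rcases ea : shed M false (p, b) with ⟨ap, ab⟩
  rw [ea] at o1 l1 e1
  simp only at o1 l1 e1
  have hab : ab.length ≤ 8 := by split_ifs at * <;> omega
  have o2 := okAll_shed true hls hs (okr o1.2)
  have l2 := length_shed (M := M) true (q := ab.reverse) hls
  have e2 := seq_shed (M := M) true i (q := ab.reverse) hls
  rcases ec : shed M true (s, ab.reverse) with ⟨cs, cb⟩
  rw [ec] at o2 l2 e2
  simp only [List.length_reverse] at o2 l2 e2
  have hcb : cb.length ≤ 8 := by split_ifs at * <;> omega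
  have o3 := okAll_fill false o1.1 (okr o2.2)
  have l3 := length_fill false ap cb.reverse
  have e3 := seq_fill false i ap cb.reverse
  rcases ea' : fill false (ap, cb.reverse) with ⟨ap', ab'⟩
  rw [ea'] at o3 l3 e3
  simp only [List.length_reverse] at o3 l3 e3
  have hab' : ab'.length ≤ 8 := by split_ifs at * <;> omega
  have o4 := okAll_fill true o2.1 (okr o3.2)
  have l4 := length_fill true cs ab'.reverse
  have e4 := seq_fill true i cs ab'.reverse
  rcases ec' : fill true (cs, ab'.reverse) with ⟨cs', cb'⟩
  rw [ec'] at o4 l4 e4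
  simp only [List.length_reverse] at o4 l4 e4
  have hcb' : cb'.length ≤ 8 := by split_ifs at * <;> omega
  refine ⟨ap', cs', cb'.reverse, ?_, o3.1, o4.1, okr o4.2, ?_, ?_, by simpa using hcb', ?_, ?_⟩
  · simp only [balance, ea, orient_true hab, ec, orient_true hcb, ea', orient_true hab', ec',
      orient_true hcb']
  · split_ifs at * <;> omega
  · split_ifs at * <;> omega
  · intro h
    rw [← List.length_eq_zero_iff, List.length_reverse]
    split_ifs at * <;> omega
  · simp only [seq, cond_true, cond_false, List.reverse_reverse] at e1 e2 e3 e4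
    rw [List.append_assoc, e4, ← List.append_assoc, e3, List.append_assoc, e2, ← List.append_assoc,
      e1]

/-- The result `d` of restructuring the levels `ls` and the bottom buffer `b` so that it starts with
a green level. -/
def Fixed (i : ℕ) (ls : List (Lvl M)) (b : Buf) (d : Dq M) : Prop :=
  Good False d.1 ∧ d.2.length ≤ 6 ∧ WF i (lv d.1) d.2 ∧ toL i (lv d.1) d.2 = toL i ls b

theorem bottomFix_spec {i : ℕ} {l : Lvl M} {b : Buf} (hl : Small l) (hb : b.length ≤ 6)
    (h : WF i [l] b) : Fixed i [l] b (bottomFix (l.2, b)) := by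
  obtain ⟨m, p, s⟩ := l
  obtain ⟨hp, hs, -, hb'⟩ := h
  obtain ⟨p', s', b', e, op, os, ob, lp, ls, lb, hz, hseq⟩ :=
    balance_spec hp hs hb' hl.1 hl.2 hb
  simp only [bottomFix, e]
  split_ifs with hc
  · unfold withBottom
    split_ifs with h6
    · refine ⟨⟨.inl ⟨⟨hc.1, lp⟩, ⟨hc.2, ls⟩⟩, by simp, trivial⟩, h6, ?_, ?_⟩
      · exact ⟨op, os, total_false ob lb, ob⟩
      · simpa [toL, lv] using hseq
    -- The bottom buffer has length 7 or 8 and is split into the buffers of a yellow level.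
    · simp only at h6
      have h4 : (b'.drop 4).length ≤ 8 := by simp; omega
      have t4 : OkAll M (i + 1) (b'.take 4) := fun e he => ob e (List.mem_of_mem_take he)
      have d4 : OkAll M (i + 1) (b'.drop 4).reverse := fun e he =>
        ob e (List.mem_of_mem_drop (List.mem_reverse.1 he))
      have ht : toL (i + 1) [((1 : M), b'.take 4, (b'.drop 4).reverse)] [] =
          b'.flatMap (flat (i + 1)) := by
        simp [toL, ← List.flatMap_append]
      rw [orient_true h4]
      refine ⟨⟨.inl ⟨⟨hc.1, lp⟩, ⟨hc.2, ls⟩⟩, ?_, trivial⟩, by simp, ?_, ?_⟩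
      · simp only [List.mem_singleton, Yellow, Safe, Green, forall_eq, List.length_take,
          List.length_reverse, List.length_drop]; omega
      · refine ⟨op, os, ?_, t4, d4, rfl, fun e he => by simp at he⟩
        rw [total_false ob lb, ← ht]; rfl
      · simp only [lv, List.flatMap_cons, List.flatMap_nil, List.append_nil]
        rw [toL, ht]
        exact hseq
  -- One of the buffers is short, so that all elements fit into a bottom buffer.
  · have h0 := hz (by omega)
    subst h0
    rw [orient_true (by omega), List.take_of_length_le (by omega)]
    refine ⟨trivial, ?_, ?_, ?_⟩
    · simp; omega
    · intro e he
      rcases List.mem_append.1 he with he | he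
      exacts [op e he, os e (List.mem_reverse.1 he)]
    · simpa [toL, lv] using hseq

theorem fixed_assemble {i : ℕ} {l n : Lvl M} {ys : List (Lvl M)} {b : Buf}
    {rest : List (Lvl M × List (Lvl M))} (hl : Small l) (hn : Safe n) (hys : ∀ y ∈ ys, Yellow y)
    (hrest : Good (Green n) rest) (hb : b.length ≤ 6) (h : WF i (l :: n :: (ys ++ lv rest)) b) :
    Fixed i (l :: n :: (ys ++ lv rest)) b (assemble (xfer (l, n), ys, rest, b)) := by
  obtain ⟨h1, h2, h3, h4, h5⟩ := xfer_spec h hl hn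
  obtain ⟨h6, h7⟩ := lv_assemble (xfer (l, n)) ys rest b
  unfold Fixed
  rw [h6, h7]
  exact ⟨good_assemble b h3 h4 hys (hrest.mono h5), hb, h1, h2⟩

/-- A red level at the head of the first packet becomes green, at the expense of the next level, which
is yellow, or is green because it is preceded by a red one, or does not exist. -/
theorem fixHead_spec {i : ℕ} {l : Lvl M} {ys : List (Lvl M)} {b : Buf}
    {rest : List (Lvl M × List (Lvl M))} (hl : Small l) (hys : ∀ y ∈ ys, Yellow y)
    (hrest : Good False rest) (hb : b.length ≤ 6) (h : WF i (lv ((l, ys) :: rest)) b) :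
    Fixed i (lv ((l, ys) :: rest)) b (fixHead l ys rest b) := by
  match ys, rest with
  | y :: ys, rest =>
    exact fixed_assemble hl (hys y (by simp)).1 (fun y hy => hys y (by simp [hy]))
      (hrest.mono False.elim) hb (by simpa [lv] using h)
  | [], (n, ys) :: rest =>
    obtain ⟨hn, hy, hr⟩ := hrest
    exact fixed_assemble hl (hn.resolve_right fun h => h.1).safe hy hr hb h
  | [], [] => exact bottomFix_spec hl hb h

/-- The first packet may start with a yellow level. -/
def TopGood : List (Lvl M × List (Lvl M)) → Prop
  | [] => True
  | p :: rest => Safe p.1 ∧ (∀ y ∈ p.2, Yellow y) ∧ Good (Green p.1) rest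

omit [Monoid M] [Finite M] in
theorem Good.topGood {ch : List (Lvl M × List (Lvl M))} (h : Good False ch) : TopGood ch := by
  cases ch with
  | nil => trivial
  | cons p rest => exact ⟨(h.1.resolve_right fun h => h.1).safe, h.2⟩

/-- The deque `d` contains the elements `xs`, in this order from left to right. -/
def Rep (d : Dq M) (xs : List SExp) : Prop :=
  TopGood d.1 ∧ d.2.length ≤ 6 ∧ WF 0 (lv d.1) d.2 ∧ toL 0 (lv d.1) d.2 = xs

/-- Only one level has to be fixed after an operation: the top level if it has become red, and
otherwise the next level that is not yellow. -/
theorem restore_spec {l : Lvl M} {ys : List (Lvl M)} {b : Buf}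
    {rest : List (Lvl M × List (Lvl M))} (hl : Small l) (hys : ∀ y ∈ ys, Yellow y)
    (hrest : Good (Safe l) rest) (hb : b.length ≤ 6) (h : WF 0 (lv ((l, ys) :: rest)) b) :
    Rep (restore l ys b rest) (toL 0 (lv ((l, ys) :: rest)) b) := by
  match rest with
  | [] =>
    simp only [restore]
    split_ifs with hs
    · exact ⟨⟨hs, hys, trivial⟩, hb, h, rfl⟩
    · obtain ⟨h1, h2, h3, h4⟩ := fixHead_spec (rest := []) hl hys trivial hb h
      exact ⟨h1.topGood, h2, h3, h4⟩
  | p :: rest =>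
    simp only [restore]
    split_ifs with hs hp
    · exact ⟨⟨hs, hys, .inl (hrest.1.resolve_right fun h => h.2.1 hp), hrest.2⟩, hb, h, rfl⟩
    · have hg : ¬Green p.1 := fun hg => hp hg.safe
      have hf : ∀ i, WF i (lv (p :: rest)) b →
          Fixed i (lv (p :: rest)) b (fixHead p.1 p.2 rest b) := fun i =>
        fixHead_spec (hrest.1.resolve_left hg).2.2 hrest.2.1 (hrest.2.2.mono hg) hb
      have hsame := Same.append (fun i hi => (hf i hi).2.2) 0 (l :: ys)
      have hlv : lv ((l, ys) :: p :: rest) = l :: ys ++ lv (p :: rest) := rfl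
      rw [hlv] at h ⊢
      obtain ⟨j, hj⟩ := WF.tail h
      obtain ⟨h3, h4⟩ := hsame h
      exact ⟨⟨hs, hys, (hf j hj).1.mono False.elim⟩, (hf j hj).2.1, h3, h4⟩
    · obtain ⟨h1, h2, h3, h4⟩ := fixHead_spec hl hys (hrest.mono hs) hb h
      exact ⟨h1.topGood, h2, h3, h4⟩

end Deque

namespace Deque

open SExp Enc

variable {M : Type*} [Monoid M] [Finite M]

/-- The element `x` added to the left or, for true `o`, to the right end of a list. -/
def snoc (o : Bool) (x : SExp) (xs : List SExp) : List SExp := bif o then xs ++ [x] else x :: xs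

theorem flat_zero (e : SExp) : flat 0 e = [e] := rfl

theorem flatMap_flat_zero (b : Buf) : b.flatMap (flat 0) = b := by
  induction b with
  | nil => rfl
  | cons e b ih => rw [List.flatMap_cons, ih]; rfl

theorem okAll_zero (b : Buf) : OkAll M 0 b := fun _ _ => trivial

theorem rep_ofBuf {b : Buf} (hb : b.length ≤ 7) : Rep (ofBuf b : Dq M) b := by
  unfold ofBuf
  split_ifs with h
  · exact ⟨trivial, h, okAll_zero b, flatMap_flat_zero b⟩
  · have hl : (b.drop 4).length ≤ 8 := by rw [List.length_drop]; omega
    rw [orient_true hl]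
    refine ⟨⟨?_, by simp, trivial⟩, by simp, ⟨okAll_zero _, okAll_zero _, rfl, ?_⟩, ?_⟩
    · simp only [Safe, List.length_take, List.length_reverse, List.length_drop]; omega
    · simp [WF, OkAll]
    · simp [lv, toL, flatMap_flat_zero]

theorem modify_spec {o : Bool} {f : Buf → Buf} {l : Lvl M} {ls : List (Lvl M)} {b : Buf}
    (h : WF 0 (l :: ls) b) : WF 0 (modify o f l :: ls) b := by
  cases o <;> exact ⟨okAll_zero _, okAll_zero _, h.2.2.1, h.2.2.2⟩

theorem rep_push (o : Bool) (x : SExp) {d : Dq M} {xs : List SExp} (h : Rep d xs) :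
    Rep (push o x d.2 d.1) (snoc o x xs) := by
  obtain ⟨ch, b⟩ := d
  obtain ⟨h1, h2, h3, rfl⟩ := h
  simp only at h1 h2 h3 ⊢
  cases ch with
  | nil =>
    have : orient o (x :: orient o b) =
        snoc o x (toL 0 (lv ([] : List (Lvl M × List (Lvl M)))) b) := by
      cases o
      · simp [orient, snoc, lv, toL, flatMap_flat_zero]
      · rw [orient_true (b := b) (by omega), orient_true (by simp; omega)]
        simp [snoc, lv, toL, flatMap_flat_zero]
    rw [push, ← this]
    refine rep_ofBuf ?_
    rw [this]
    cases o <;> simp [snoc, lv, toL, flatMap_flat_zero] <;> omega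
  | cons p rest =>
    obtain ⟨⟨m, p, s⟩, ys⟩ := p
    obtain ⟨hs, hy, hg⟩ := h1
    have := restore_spec (l := modify o (x :: ·) (m, p, s)) (ys := ys) (rest := rest) ?_ hy
      (hg.mono ?_) h2 (modify_spec h3)
    · rw [push]
      convert this using 1
      cases o <;> simp [snoc, lv, toL, modify, flat]
    · cases o <;> simp only [Safe, Small, modify, cond_true, cond_false,
        List.length_cons] at hs ⊢ <;> omega
    · cases o <;> simp only [Safe, Green, modify, cond_true, cond_false, List.length_cons] <;> omega

theorem rep_pop (o : Bool) {x : SExp} {d : Dq M} {xs : List SExp} (h : Rep d (snoc o x xs)) :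
    Rep (pop o d.2 d.1) xs ∧ peek o d.2 d.1 = x := by
  obtain ⟨ch, b⟩ := d
  obtain ⟨h1, h2, h3, h4⟩ := h
  simp only at h1 h2 h3 h4 ⊢
  cases ch with
  | nil =>
    simp only [lv, toL, List.flatMap_nil, flatMap_flat_zero] at h4
    subst h4
    cases o
    · refine ⟨⟨trivial, ?_, okAll_zero _, flatMap_flat_zero _⟩, rfl⟩
      simpa [pop, orient, snoc] using h2.trans' (Nat.pred_le _)
    · have hx : xs.length ≤ 5 := by simpa [snoc, Nat.lt_succ_iff] using h2
      have h8 : (snoc true x xs).length ≤ 8 := by omega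
      have ht : orient true (orient true (snoc true x xs)).tail = xs := by
        rw [orient_true h8, orient_true (by simp [snoc]; omega)]
        simp [snoc]
      simp only [pop, peek, ht]
      refine ⟨⟨trivial, by simp; omega, okAll_zero _, flatMap_flat_zero _⟩, ?_⟩
      rw [orient_true h8]
      simp [snoc]
  | cons p rest =>
    obtain ⟨⟨m, p, s⟩, ys⟩ := p
    obtain ⟨hs, hy, hg⟩ := h1
    have key : toL 0 (lv ((modify o List.tail (m, p, s), ys) :: rest)) b = xs ∧
        peek o b (((m, p, s), ys) :: rest) = x := by
      cases o
      · obtain ⟨e, p, rfl⟩ := List.exists_cons_of_length_pos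
          (Nat.pos_of_ne_zero fun h => hs.1.1 h.le)
        simp only [lv, toL, snoc, flatMap_flat_zero, List.flatMap_cons, List.cons_append, flat_zero,
          List.nil_append, cond_false, List.cons.injEq] at h4
        simp only [modify, cond_false, lv, toL, List.flatMap_cons, List.tail_cons, List.cons_append,
          flatMap_flat_zero, peek, List.headD_cons]
        exact ⟨h4.2, h4.1⟩
      · obtain ⟨e, s, rfl⟩ := List.exists_cons_of_length_pos
          (Nat.pos_of_ne_zero fun h => hs.2.1 h.le)
        simp only [lv, toL, snoc, flatMap_flat_zero, List.flatMap_cons, List.cons_append,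
          cond_true, List.reverse_cons, ← List.append_assoc] at h4
        simp only [modify, cond_true, lv, toL, List.flatMap_cons, List.tail_cons, List.cons_append,
          flatMap_flat_zero, peek, List.headD_cons]
        have := List.append_inj' h4 rfl
        exact ⟨this.1, by simpa using this.2⟩
    refine ⟨?_, key.2⟩
    have := restore_spec (l := modify o List.tail (m, p, s)) (ys := ys) (rest := rest) ?_ hy
      (hg.mono ?_) h2 (modify_spec h3)
    · rw [pop]
      convert this using 1
      exact key.1.symm
    · cases o <;> simp only [Safe, Small, modify, cond_true, cond_false,
        List.length_tail] at hs ⊢ <;> omega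
    · cases o <;> simp only [Safe, Green, modify, cond_true, cond_false, List.length_tail] <;> omega

theorem Rep.product {d : Dq M} {xs : List SExp} (h : Rep d xs) :
    product d.2 d.1 = (xs.map (val M)).prod := by
  obtain ⟨ch, b⟩ := d
  obtain ⟨h1, h2, h3, rfl⟩ := h
  simp only at h1 h2 h3 ⊢
  cases ch with
  | nil => exact total_false h3 (by omega)
  | cons p rest =>
    obtain ⟨⟨m, p, s⟩, ys⟩ := p
    obtain ⟨hs, -⟩ := h1
    obtain ⟨hp, hq, hm, -⟩ := h3
    simp only [Safe] at hs
    simp only at hm hp hq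
    simp only [Deque.product]
    rw [total_false hp (by omega), total_true hq (by omega), hm]
    simp only [lv, List.flatMap_cons, List.cons_append, toL, flatMap_flat_zero, List.map_append,
      List.prod_append]
    rfl

theorem Rep.empty {d : Dq M} {xs : List SExp} (h : Rep d xs) :
    empty d = decide (xs = []) := by
  obtain ⟨ch, b⟩ := d
  obtain ⟨h1, h2, h3, rfl⟩ := h
  simp only at h1 h2 h3 ⊢
  cases ch with
  | nil => simp [Deque.empty, lv, toL, flatMap_flat_zero]
  | cons p rest =>
    obtain ⟨⟨m, p, s⟩, ys⟩ := p
    obtain ⟨hs, -⟩ := h1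
    have : p ≠ [] := by rintro rfl; simp [Safe] at hs
    simp [Deque.empty, lv, toL, flatMap_flat_zero, this]

/-! ### The size of a deque -/

/-- The sum of the sizes of the elements, increased by a constant for each of them. -/
def weight (b : Buf) : ℕ := (b.map fun e => e.size + 12).sum

theorem weight_append (a b : Buf) : weight (a ++ b) = weight a + weight b := by simp [weight]

/-- The constant in `weight` is at least 3, so that forming pairs does not increase the weight. -/
theorem weight_flat {i : ℕ} {e : SExp} (h : Ok M i e) : e.size + 12 ≤ weight (flat i e) := by
  induction i generalizing e with
  | zero => simp [flat, weight]
  | succ i ih =>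
    obtain ⟨x, y, rfl, hx, hy⟩ := h
    have h1 := ih hx
    have h2 := ih hy
    simp only [flat, weight_append, outer_pair, inner_pair]
    simp only [pair, SExp.size, enc_finite]
    omega

theorem weight_flatMap {i : ℕ} {b : Buf} (h : OkAll M i b) :
    weight b ≤ weight (b.flatMap (flat i)) := by
  induction b with
  | nil => simp
  | cons e b ih =>
    have h1 := weight_flat (h e (by simp))
    have h2 := ih fun e he => h e (by simp [he])
    rw [List.flatMap_cons, weight_append]
    simp only [weight, List.map_cons, List.sum_cons] at *
    omega

theorem weight_toL {i : ℕ} {ls : List (Lvl M)} {b : Buf} (h : WF i ls b) :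
    (ls.map fun l => weight l.2.1 + weight l.2.2).sum + weight b ≤ weight (toL i ls b) := by
  induction ls generalizing i with
  | nil => simpa [toL] using weight_flatMap h
  | cons l ls ih =>
    obtain ⟨h1, h2, -, h3⟩ := h
    have h4 := ih h3
    have h5 := weight_flatMap h1
    have h6 := weight_flatMap (b := l.2.2.reverse) (i := i) fun e he => h2 e (by simpa using he)
    have h7 : weight l.2.2.reverse = weight l.2.2 := by simp [weight]
    simp only [toL, weight_append, List.map_cons, List.sum_cons]
    omega

theorem size_enc_buf (b : Buf) : (enc b).size + 11 * b.length = weight b + 1 := by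
  induction b with
  | nil => simp [weight, SExp.size]
  | cons e b ih =>
    simp only [weight, List.map_cons, List.sum_cons, enc_cons, SExp.size, List.length_cons] at *
    simp only [enc_sexp] at *
    omega

omit [Monoid M] in
theorem size_enc_lvl (l : Lvl M) :
    (enc l).size + 11 * (l.2.1.length + l.2.2.length) = weight l.2.1 + weight l.2.2 + 5 := by
  obtain ⟨m, p, s⟩ := l
  have h1 := size_enc_buf p
  have h2 := size_enc_buf s
  simp only [enc_prod, SExp.size, enc_finite]
  omega

omit [Monoid M] in
theorem size_enc_yellow {ys : List (Lvl M)} (h : ∀ y ∈ ys, Yellow y) :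
    (enc ys).size ≤ (ys.map fun l => weight l.2.1 + weight l.2.2).sum + 1 := by
  induction ys with
  | nil => simp [SExp.size]
  | cons y ys ih =>
    have h1 := size_enc_lvl y
    have h2 := (h y (by simp)).1
    have h3 := ih fun y hy => h y (by simp [hy])
    simp only [Safe] at h2
    simp only [enc_cons, SExp.size, List.map_cons, List.sum_cons]
    omega

omit [Monoid M] in
/-- The nodes that are used for the level structure are paid for by the elements in the buffers: a
green level has at least four elements, a yellow one at least two, and a red one, which may be empty,
is preceded by a green one. -/
theorem size_enc_good {ch : List (Lvl M × List (Lvl M))} :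
    (Good True ch → (enc ch).size ≤
      ((lv ch).map fun l => weight l.2.1 + weight l.2.2).sum + 10) ∧
    (Good False ch → (enc ch).size ≤
      ((lv ch).map fun l => weight l.2.1 + weight l.2.2).sum + 1) := by
  induction ch with
  | nil => simp [SExp.size]
  | cons p rest ih =>
    have key : ∀ k, (enc rest).size ≤
        ((lv rest).map fun l => weight l.2.1 + weight l.2.2).sum + k → (∀ y ∈ p.2, Yellow y) →
        (enc (p :: rest)).size + 11 * (p.1.2.1.length + p.1.2.2.length) ≤
        ((lv (p :: rest)).map fun l => weight l.2.1 + weight l.2.2).sum + k + 8 := by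
      intro k hk hy
      obtain ⟨l, ys⟩ := p
      have h1 := size_enc_lvl l
      have h2 := size_enc_yellow hy
      simp only [lv, List.flatMap_cons, List.cons_append, List.map_cons, List.sum_cons,
        List.map_append, List.sum_append, enc_cons, SExp.size, enc_prod l ys] at *
      omega
    have green : Green p.1 → (∀ y ∈ p.2, Yellow y) → Good (Green p.1) rest →
        (enc (p :: rest)).size ≤
        ((lv (p :: rest)).map fun l => weight l.2.1 + weight l.2.2).sum + 1 := by
      intro h1 h2 h3
      have := key _ (ih.1 (h3.mono fun _ => trivial)) h2
      simp only [Green] at h1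
      omega
    refine ⟨fun ⟨h1, h2, h3⟩ => ?_, fun ⟨h1, h2, h3⟩ => green (h1.resolve_right fun h => h.1) h2 h3⟩
    by_cases hg : Green p.1
    · exact (green hg h2 h3).trans (by omega)
    · have := key _ (ih.2 (h3.mono hg)) h2
      omega

/-- The size bound is additive: the constant factor does not grow when deques are nested. -/
theorem Rep.size_le {d : Dq M} {xs : List SExp} (h : Rep d xs) :
    (enc d).size ≤ weight xs + 3 := by
  obtain ⟨ch, b⟩ := d
  obtain ⟨h1, h2, h3, rfl⟩ := h
  have hw := weight_toL h3
  have hb := size_enc_buf b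
  simp only at h1 h2 h3 hw ⊢
  have key : (enc ch).size ≤ ((lv ch).map fun l => weight l.2.1 + weight l.2.2).sum + 1 := by
    cases ch with
    | nil => simp [SExp.size]
    | cons p rest =>
      obtain ⟨hs, hy, hg⟩ := h1
      have hr := size_enc_good.1 (hg.mono fun _ => trivial)
      obtain ⟨l, ys⟩ := p
      have h4 := size_enc_lvl l
      have h5 := size_enc_yellow hy
      simp only [Safe] at hs
      simp only [lv, List.flatMap_cons, List.cons_append, List.map_cons, List.sum_cons,
        List.map_append, List.sum_append, enc_cons, SExp.size, enc_prod l ys] at *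
      omega
  simp only [enc_prod, SExp.size]
  omega

end Deque

/-! ### Deques as S-expressions -/

/-- The expression with the free variables from `k` on replaced by `0`. -/
def Code.close : ℕ → Code → Code
  | k, .var i => if i < k then .var i else .atom 0
  | _, .atom a => .atom a
  | k, .cons e f => .cons (e.close k) (f.close k)
  | k, .car e => .car (e.close k)
  | k, .cdr e => .cdr (e.close k)
  | k, .ite e a f g => .ite (e.close k) a (f.close k) (g.close k)
  | k, .bind e f => .bind (e.close k) (f.close (k + 1))

theorem Code.eval_close (e : Code) (k : ℕ) (env : List SExp) :
    (e.close k).eval env = e.eval (env.take k) := by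
  induction e generalizing k env with
  | var i =>
    rw [close]
    split_ifs with h
    · simp only [eval, List.getD_eq_getElem?_getD, List.getElem?_take, if_pos h]
    · simp only [eval, List.getD_eq_getElem?_getD, List.getElem?_take, if_neg h, Option.getD_none]
  | atom a => rfl
  | cons e f ihe ihf => simp only [close, eval, ihe, ihf]
  | car e ihe => simp only [close, eval, ihe]
  | cdr e ihe => simp only [close, eval, ihe]
  | ite e a f g ihe ihf ihg => simp only [close, eval, ihe, ihf, ihg]
  | bind e f ihe ihf => simp only [close, eval, ihe, ihf, List.take_succ_cons]

section Lift

open Enc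

variable {X Y Z : Type*} [Enc X] [Enc Y] [Enc Z]

/-- Closing the expression makes its value independent of the rest of the environment, also for
arguments that do not represent anything. -/
theorem Comp.exists_lift {f : X → Y} (hf : Comp f) :
    ∃ g : SExp → SExp, Comp g ∧ ∀ x, g (Enc.enc x) = Enc.enc (f x) := by
  obtain ⟨e, he⟩ := hf
  refine ⟨fun t => e.eval [t], ⟨e.close 1, fun t env => ?_⟩, fun x => he x []⟩
  rw [Code.eval_close]
  rfl

open Classical in
/-- A function of S-expressions that represents the function `f`. (It is irrelevant for functions
that are not computed by expressions.) -/
noncomputable def lift (f : X → Y) : SExp → SExp :=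
  if hf : Comp f then hf.exists_lift.choose else id

theorem Comp.lift_enc {f : X → Y} (hf : Comp f) (x : X) : lift f (Enc.enc x) = Enc.enc (f x) := by
  rw [lift, dif_pos hf]
  exact hf.exists_lift.choose_spec.2 x

@[fun_prop]
theorem Comp.lift (f : X → Y) {g : Z → SExp} (hg : Comp g) : Comp (fun z => lift f (g z)) := by
  suffices Comp (_root_.lift f) from this.comp hg
  unfold _root_.lift
  split_ifs with hf
  · exact hf.exists_lift.choose_spec.1
  · exact Comp.id

end Lift

namespace Deque

open SExp Enc

variable (M : Type*) [Monoid M] [Finite M]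

/-- The S-expression `t` represents a deque with the elements `xs`. -/
def IsDq (t : SExp) (xs : List SExp) : Prop := ∃ d : Dq M, Rep d xs ∧ t = enc d

/-- The empty deque. -/
def nilS : SExp := cons (atom 0) (atom 0)

/-- Adding the element `x` to a deque. -/
noncomputable def pushS (o : Bool) (x t : SExp) : SExp :=
  lift (fun p : SExp × Dq M => push o p.1 p.2.2 p.2.1) (cons x t)

/-- Removing an element from a deque. -/
noncomputable def popS (o : Bool) (t : SExp) : SExp := lift (fun d : Dq M => pop o d.2 d.1) t

/-- The element at an end of a deque. -/
noncomputable def peekS (o : Bool) (t : SExp) : SExp := lift (fun d : Dq M => peek o d.2 d.1) t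

/-- The product of the elements of a deque. -/
noncomputable def prodS (t : SExp) : M := (lift (fun d : Dq M => product d.2 d.1) t).dec M

/-- Whether a deque is empty. -/
noncomputable def emptyS (t : SExp) : Bool := (lift (fun d : Dq M => empty d) t).dec Bool

variable {M}

section Comp

variable {X : Type*} [Enc X] {f g : X → SExp}

@[fun_prop]
theorem comp_pushS (o : Bool) (hf : Comp f) (hg : Comp g) :
    Comp (fun x => pushS M o (f x) (g x)) := by unfold pushS; fun_prop

@[fun_prop]
theorem comp_popS (o : Bool) (hf : Comp f) : Comp (fun x => popS M o (f x)) := by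
  unfold popS; fun_prop

omit [Monoid M] in
@[fun_prop]
theorem comp_peekS (o : Bool) (hf : Comp f) : Comp (fun x => peekS M o (f x)) := by
  unfold peekS; fun_prop

@[fun_prop]
theorem comp_prodS (hf : Comp f) : Comp (fun x => prodS M (f x)) := by
  unfold prodS; fun_prop

omit [Monoid M] in
@[fun_prop]
theorem comp_emptyS (hf : Comp f) : Comp (fun x => emptyS M (f x)) := by
  unfold emptyS; fun_prop

end Comp

theorem isDq_nilS : IsDq M nilS [] :=
  ⟨([], []), ⟨trivial, by simp, okAll_zero _, rfl⟩, rfl⟩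

variable {t x : SExp} {xs : List SExp}

theorem IsDq.push (h : IsDq M t xs) (o : Bool) (x : SExp) :
    IsDq M (pushS M o x t) (snoc o x xs) := by
  obtain ⟨d, hd, rfl⟩ := h
  exact ⟨_, rep_push o x hd,
    (comp_push o (X := SExp × Dq M) (by fun_prop) (by fun_prop)).lift_enc (x, d)⟩

theorem IsDq.pop {o : Bool} (h : IsDq M t (snoc o x xs)) : IsDq M (popS M o t) xs := by
  obtain ⟨d, hd, rfl⟩ := h
  exact ⟨_, (rep_pop o hd).1, (comp_pop o (X := Dq M) (by fun_prop)).lift_enc d⟩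

theorem IsDq.peek {o : Bool} (h : IsDq M t (snoc o x xs)) : peekS M o t = x := by
  obtain ⟨d, hd, rfl⟩ := h
  rw [peekS, (comp_peek o (X := Dq M) (by fun_prop)).lift_enc d, (rep_pop o hd).2]
  rfl

theorem IsDq.prod (h : IsDq M t xs) : prodS M t = (xs.map (val M)).prod := by
  obtain ⟨d, hd, rfl⟩ := h
  rw [prodS, (comp_product (X := Dq M) (by fun_prop)).lift_enc d, dec_enc, hd.product]

theorem IsDq.empty (h : IsDq M t xs) : emptyS M t = decide (xs = []) := by
  obtain ⟨d, hd, rfl⟩ := h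
  rw [emptyS, (comp_empty (X := Dq M) (by fun_prop)).lift_enc d, dec_enc, hd.empty]

theorem IsDq.size_le (h : IsDq M t xs) : t.size ≤ weight xs + 3 := by
  obtain ⟨d, hd, rfl⟩ := h
  exact hd.size_le

end Deque

/-! ### The window as a sequence of deques -/

namespace VisiblyPushdown

open SExp Enc Deque

/-- Transformations of the set of states, multiplied from left to right. -/
abbrev Trans (Q : Type*) := (Function.End Q)ᵐᵒᵖ

instance {Q : Type*} [Finite Q] : Finite (Trans Q) :=
  have : Finite (Function.End Q) := inferInstanceAs (Finite (Q → Q))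
  .of_equiv _ MulOpposite.opEquiv

instance {C R I : Type*} [Finite C] [Finite R] [Finite I] : Finite (Letter C R I) :=
  .of_surjective (fun x : C ⊕ R ⊕ I => match x with
    | .inl a => Letter.call a
    | .inr (.inl a) => Letter.ret a
    | .inr (.inr a) => Letter.internal a) fun a => by
      cases a with
      | call a => exact ⟨.inl a, rfl⟩
      | ret a => exact ⟨.inr (.inl a), rfl⟩
      | internal a => exact ⟨.inr (.inr a), rfl⟩

/-- The optional letters before and after the forest in a deque element. -/
def Label (C R I : Type*) := Option (Letter C R I) × Option (Letter C R I)

instance {C R I : Type*} [Finite C] [Finite R] [Finite I] : Finite (Label C R I) :=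
  inferInstanceAs (Finite (Option (Letter C R I) × Option (Letter C R I)))

instance {C R I : Type*} : Nonempty (Label C R I) := ⟨(none, none)⟩

variable {C R I Q Γ : Type*} [Finite C] [Finite R] [Finite I] [Finite Q]

/-- Whether a letter that is added at the left or, for true `o`, at the right end may be matched by
a letter that is added at the same end later. -/
def opens : Bool → Letter C R I → Bool
  | true, .call _ => true
  | false, .ret _ => true
  | _, _ => false

/-- The label `(x, y)`, or `(y, x)` if `o` is false. -/
def label (o : Bool) (x y : Option (Letter C R I)) : Label C R I := bif o then (x, y) else (y, x)

/-- The letter of a label at the left or, for true `o`, at the right end. -/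
def Label.side (o : Bool) (k : Label C R I) : Option (Letter C R I) := bif o then k.2 else k.1

omit [Finite C] [Finite R] [Finite I] in
theorem side_label (o : Bool) (x y : Option (Letter C R I)) :
    (label o x y).side o = y ∧ (label o x y).side (!o) = x := by
  cases o <;> exact ⟨rfl, rfl⟩

variable (A : VPA C R I Q Γ)

/-- The transformation of the states by the letters of a label, around a well-matched word with the
transformation `m`. A single return letter is assumed to find the empty stack. -/
def trans (k : Label C R I) (m : Trans Q) : Trans Q :=
  match k with
  | (some (.internal a), none) => .op fun q => A.internalStep q a
  | (some (.call a), none) => .op fun q => m.unop (A.callStep q a).2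
  | (none, some (.ret b)) => .op fun q => A.retStep (m.unop q) b A.bot
  | (some (.call a), some (.ret b)) => .op fun q =>
      A.retStep (m.unop (A.callStep q a).2) b (A.callStep q a).1
  | _ => 1

/-- The deque element with the label `k` and the forest `d`. -/
noncomputable def item (k : Label C R I) (d : SExp) : SExp :=
  cons (enc (trans A k (prodS (Trans Q) d))) (cons (enc k) d)

/-- The label of a deque element. -/
noncomputable def lab (C R I : Type*) [Finite C] [Finite R] [Finite I] (e : SExp) : Label C R I :=
  e.cdr.car.dec _

/-- The forest in a deque element. -/
def sub (e : SExp) : SExp := e.cdr.cdr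

@[simp] theorem lab_item (k : Label C R I) (d : SExp) : lab C R I (item A k d) = k := dec_enc k

@[simp] theorem sub_item (k : Label C R I) (d : SExp) : sub (item A k d) = d := rfl

theorem val_item (k : Label C R I) (d : SExp) :
    val (Trans Q) (item A k d) = trans A k (prodS (Trans Q) d) := dec_enc _

theorem size_item (k : Label C R I) (d : SExp) : (item A k d).size = d.size + 4 := by
  simp only [item, SExp.size, enc_finite]; omega

/-- The words `u` and `w`, concatenated such that `u` is on the left or, for true `o`, on the
right. -/
def app {α : Type*} (o : Bool) (u w : List α) : List α := bif o then w ++ u else u ++ w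

@[simp] theorem app_nil {α : Type*} (o : Bool) (u : List α) : app o u [] = u := by
  cases o <;> simp [app]

@[simp] theorem nil_app {α : Type*} (o : Bool) (u : List α) : app o [] u = u := by
  cases o <;> simp [app]

theorem app_assoc {α : Type*} (o : Bool) (u v w : List α) :
    app o (app o u v) w = app o u (app o v w) := by
  cases o <;> simp [app]

theorem app_comm {α : Type*} (o : Bool) (u v w : List α) :
    app o u (app (!o) v w) = app (!o) v (app o u w) := by
  cases o <;> simp [app]

/-- The S-expression `t` is a deque whose elements represent words, in the sense of `P`, with the
concatenation `w`. -/
def Row (P : SExp → List (Letter C R I) → Prop) (t : SExp) (w : List (Letter C R I)) : Prop :=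
  ∃ ts : List (SExp × List (Letter C R I)), IsDq (Trans Q) t (ts.map Prod.fst) ∧
    (∀ p ∈ ts, P p.1 p.2) ∧ w = ts.flatMap Prod.snd

/-- The deque element is a tree: an internal letter, or a forest between a call letter and the
return letter that matches it. -/
inductive Tree : SExp → List (Letter C R I) → Prop
  | leaf (a : I) : Tree (item A (label true (some (.internal a)) none) nilS) [.internal a]
  | node (a : C) (b : R) (d : SExp) (ts : List (SExp × List (Letter C R I))) :
      IsDq (Trans Q) d (ts.map Prod.fst) → (∀ p ∈ ts, Tree p.1 p.2) →
      Tree (item A (label true (some (.call a)) (some (.ret b))) d)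
        (.call a :: ts.flatMap Prod.snd ++ [.ret b])

/-- The deque element is a forest after a call letter without matching return letter (for true
`o`), or a forest before a return letter without matching call letter (for false `o`). -/
def Seg (o : Bool) (e : SExp) (w : List (Letter C R I)) : Prop :=
  ∃ a d u, opens o a = true ∧ e = item A (label o (some a) none) d ∧ Row (Q := Q) (Tree A) d u ∧
    w = app (!o) [a] u

section Row

variable {A} {P : SExp → List (Letter C R I) → Prop} {e t : SExp} {u w : List (Letter C R I)}

omit [Finite C] [Finite R] [Finite I] in
theorem Row.nil : Row (Q := Q) P nilS [] := ⟨[], isDq_nilS, by simp, rfl⟩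

omit [Finite C] [Finite R] [Finite I] in
theorem Row.push (h : Row (Q := Q) P t w) (o : Bool) (he : P e u) :
    Row (Q := Q) P (pushS (Trans Q) o e t) (app o u w) := by
  obtain ⟨ts, h1, h2, rfl⟩ := h
  cases o
  · exact ⟨(e, u) :: ts, h1.push false e, by simpa using ⟨he, fun a b => h2 (a, b)⟩, by simp [app]⟩
  · refine ⟨ts ++ [(e, u)], by simpa [snoc] using h1.push true e, fun p hp => ?_, by simp [app]⟩
    rcases List.mem_append.1 hp with hp | hp
    · exact h2 p hp
    · obtain rfl := List.mem_singleton.1 hp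
      exact he

omit [Finite C] [Finite R] [Finite I] in
theorem Row.of_empty (h : Row (Q := Q) P t w) (ht : emptyS (Trans Q) t = true) : w = [] := by
  obtain ⟨ts, h1, h2, rfl⟩ := h
  rw [h1.empty] at ht
  simp only [List.map_eq_nil_iff, decide_eq_true_eq] at ht
  simp [ht]

omit [Finite C] [Finite R] [Finite I] in
theorem Row.pop (h : Row (Q := Q) P t w) (o : Bool) (ht : ¬emptyS (Trans Q) t = true) :
    ∃ u w', P (peekS (Trans Q) o t) u ∧ Row (Q := Q) P (popS (Trans Q) o t) w' ∧
      w = app o u w' := by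
  obtain ⟨ts, h1, h2, rfl⟩ := h
  rw [h1.empty] at ht
  simp only [List.map_eq_nil_iff, decide_eq_true_eq] at ht
  cases o
  · obtain ⟨⟨e, u⟩, ts, rfl⟩ := List.exists_cons_of_ne_nil ht
    have h3 : IsDq (Trans Q) t (snoc false e (ts.map Prod.fst)) := h1
    rw [h3.peek]
    exact ⟨u, _, h2 (e, u) (by simp), ⟨ts, h3.pop, fun p hp => h2 p (by simp [hp]), rfl⟩,
      by simp [app]⟩
  · obtain ⟨ts, ⟨e, u⟩, rfl⟩ := (List.eq_nil_or_concat ts).resolve_left ht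
    have h3 : IsDq (Trans Q) t (snoc true e (ts.map Prod.fst)) := by simpa [snoc] using h1
    rw [h3.peek]
    exact ⟨u, _, h2 (e, u) (by simp), ⟨ts, h3.pop, fun p hp => h2 p (by simp [hp]), rfl⟩,
      by simp [app]⟩

end Row

/-- A tree from a forest between two matching letters. -/
theorem tree_node {o : Bool} {a b : Letter C R I} {d : SExp} {u : List (Letter C R I)}
    (ha : opens o a = true) (hb : opens (!o) b = true) (hd : Row (Q := Q) (Tree A) d u) :
    Tree A (item A (label o (some a) (some b)) d) (app o [b] (app (!o) [a] u)) := by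
  obtain ⟨ts, h1, h2, rfl⟩ := hd
  cases o <;> cases a <;> simp [opens] at ha <;> cases b <;> simp [opens] at hb
  · exact .node _ _ d ts h1 h2
  · exact .node _ _ d ts h1 h2

/-- The shape of a tree, as seen from one side. The second letter of the label tells internal letters
from pairs of matching letters. -/
theorem Tree.cases {o : Bool} {e : SExp} {w : List (Letter C R I)} (h : Tree A e w) :
    (∃ a, w = [a] ∧ (lab C R I e).side true = none) ∨
    ∃ a b d u, opens o a = true ∧ e = item A (label o (some a) (some b)) d ∧
      Row (Q := Q) (Tree A) d u ∧ w = app o [b] (app (!o) [a] u) := by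
  cases h with
  | leaf a => exact .inl ⟨_, rfl, by rw [lab_item]; rfl⟩
  | node a b d ts h1 h2 =>
    right
    cases o
    · exact ⟨.ret b, .call a, d, _, rfl, rfl, ⟨ts, h1, h2, rfl⟩, rfl⟩
    · exact ⟨.call a, .ret b, d, _, rfl, rfl, ⟨ts, h1, h2, rfl⟩, by simp [app]⟩

/-! ### The operations on the window -/

/-- A state consists of three deques: the forests after unmatched call letters, a forest, and the
forests before unmatched return letters. In the window, these parts follow each other from right to
left. In the functions below, the state is reversed if `o` is false. -/
abbrev State := SExp × SExp × SExp

/-- The state `s`, reversed if `o` is false. -/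
def swap (o : Bool) (s : State) : State := bif o then s else (s.2.2, s.2.1, s.1)

/-- The state represents the word `w`. -/
def Inv (o : Bool) (s : State) (w : List (Letter C R I)) : Prop :=
  ∃ x y z, Row (Q := Q) (Seg A o) s.1 x ∧ Row (Q := Q) (Tree A) s.2.1 y ∧
    Row (Q := Q) (Seg A (!o)) s.2.2 z ∧ w = app o x (app o y z)

/-- Adding a tree to the outermost forest. -/
noncomputable def addTree (o : Bool) (t : SExp) (s : State) : State :=
  if emptyS (Trans Q) s.1 = true then (s.1, pushS (Trans Q) o t s.2.1, s.2.2)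
  else (pushS (Trans Q) o (item A (lab C R I (peekS (Trans Q) o s.1))
      (pushS (Trans Q) o t (sub (peekS (Trans Q) o s.1)))) (popS (Trans Q) o s.1), s.2)

/-- Adding a letter. A letter that can be matched from the same side later starts a new segment. A
letter of the opposite kind closes the outermost segment to a tree; if there is none, the middle
forest becomes part of a segment of the other kind. -/
noncomputable def addLetter (o : Bool) (a : Letter C R I) (s : State) : State :=
  if opens o a = true then (pushS (Trans Q) o (item A (label o (some a) none) nilS) s.1, s.2)
  else if opens (!o) a = true then
    if emptyS (Trans Q) s.1 = true then
      (s.1, nilS, pushS (Trans Q) o (item A (label o none (some a)) s.2.1) s.2.2)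
    else addTree A o (item A (label o ((lab C R I (peekS (Trans Q) o s.1)).side (!o)) (some a))
      (sub (peekS (Trans Q) o s.1))) (popS (Trans Q) o s.1, s.2)
  else addTree A o (item A (label true (some a) none) nilS) s

/-- Adding the tree `t` without its last (or, for false `o`, its first) letter. -/
noncomputable def addRest (o : Bool) (t : SExp) (s : State) : State :=
  if (lab C R I t).side true = none then s
  else (pushS (Trans Q) o (item A (label o ((lab C R I t).side (!o)) none) (sub t)) s.1, s.2)

/-- Removing a letter, which reverses `addLetter`. -/
noncomputable def removeLetter (o : Bool) (s : State) : State :=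
  if emptyS (Trans Q) s.1 = true then
    if emptyS (Trans Q) s.2.1 = true then
      if emptyS (Trans Q) s.2.2 = true then s
      else (s.1, sub (peekS (Trans Q) o s.2.2), popS (Trans Q) o s.2.2)
    else addRest A o (peekS (Trans Q) o s.2.1) (s.1, popS (Trans Q) o s.2.1, s.2.2)
  else if emptyS (Trans Q) (sub (peekS (Trans Q) o s.1)) = true then (popS (Trans Q) o s.1, s.2)
  else addRest A o (peekS (Trans Q) o (sub (peekS (Trans Q) o s.1)))
    (pushS (Trans Q) o (item A (lab C R I (peekS (Trans Q) o s.1))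
      (popS (Trans Q) o (sub (peekS (Trans Q) o s.1)))) (popS (Trans Q) o s.1), s.2)

section Comp

variable {X : Type*} [Enc X]

@[fun_prop]
theorem comp_item {k : X → Label C R I} {f : X → SExp} (hk : Comp k) (hf : Comp f) :
    Comp (fun x => item A (k x) (f x)) := by
  unfold item
  have := Comp.of_finite₂ (f := trans A) hk (comp_prodS (M := Trans Q) hf)
  fun_prop

@[fun_prop]
theorem comp_lab {f : X → SExp} (hf : Comp f) : Comp (fun x => lab C R I (f x)) := by
  unfold lab; fun_prop

@[fun_prop]
theorem comp_sub {f : X → SExp} (hf : Comp f) : Comp (fun x => sub (f x)) := by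
  unfold sub; fun_prop

@[fun_prop]
theorem comp_label (o : Bool) {f g : X → Option (Letter C R I)} (hf : Comp f) (hg : Comp g) :
    Comp (fun x => label o (f x) (g x)) := Comp.of_finite₂ hf hg

@[fun_prop]
theorem comp_side (o : Bool) {k : X → Label C R I} (hk : Comp k) :
    Comp (fun x => (k x).side o) := Comp.of_finite.comp hk

@[fun_prop]
theorem comp_swap (o : Bool) {f : X → State} (hf : Comp f) : Comp (fun x => swap o (f x)) := by
  cases o <;> simp only [swap, cond_true, cond_false] <;> fun_prop

@[fun_prop]
theorem comp_addTree (o : Bool) {f : X → SExp} {g : X → State} (hf : Comp f) (hg : Comp g) :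
    Comp (fun x => addTree A o (f x) (g x)) := by
  unfold addTree
  refine Comp.ite ?_ (by fun_prop) (by fun_prop)
  simp only [Bool.decide_eq_true]
  fun_prop

@[fun_prop]
theorem comp_addLetter (o : Bool) (a : Letter C R I) {f : X → State} (hf : Comp f) :
    Comp (fun x => addLetter A o a (f x)) := by
  unfold addLetter
  refine Comp.ite (by fun_prop) (by fun_prop) (Comp.ite (by fun_prop) (Comp.ite ?_ ?_ ?_) ?_)
  · simp only [Bool.decide_eq_true]
    fun_prop
  all_goals fun_prop

@[fun_prop]
theorem comp_addRest (o : Bool) {f : X → SExp} {g : X → State} (hf : Comp f) (hg : Comp g) :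
    Comp (fun x => addRest A o (f x) (g x)) := by
  classical
  have h : Comp fun x => decide ((lab C R I (f x)).side true = none) :=
    (Comp.of_finite (f := fun k : Label C R I => decide (k.side true = none))).comp (comp_lab hf)
  have h1 := Comp.ite (p := fun x => (lab C R I (f x)).side true = none) h hg
    (g := fun x => (pushS (Trans Q) o (item A (label o ((lab C R I (f x)).side (!o)) none)
      (sub (f x))) (g x).1, (g x).2)) (by fun_prop)
  convert h1 using 2 with x
  unfold addRest
  congr

@[fun_prop]
theorem comp_removeLetter (o : Bool) {f : X → State} (hf : Comp f) :
    Comp (fun x => removeLetter A o (f x)) := by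
  have h {t : X → SExp} (ht : Comp t) : Comp fun x => decide (emptyS (Trans Q) (t x) = true) := by
    simp only [Bool.decide_eq_true]
    fun_prop
  unfold removeLetter
  exact Comp.ite (h (by fun_prop)) (Comp.ite (h (by fun_prop)) (Comp.ite (h (by fun_prop))
    (by fun_prop) (by fun_prop)) (by fun_prop)) (Comp.ite (h (by fun_prop)) (by fun_prop)
    (by fun_prop))

end Comp


section Inv

variable {A} {o : Bool} {s : State} {e t : SExp} {u w : List (Letter C R I)}

theorem Inv.swap (h : Inv A o s w) (o' : Bool) : Inv A (o == o') (swap o' s) w := by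
  obtain ⟨x, y, z, hx, hy, hz, rfl⟩ := h
  cases o' <;> cases o
  · exact ⟨z, y, x, hz, hy, hx, by simp [app]⟩
  · exact ⟨z, y, x, hz, hy, hx, by simp [app]⟩
  · exact ⟨x, y, z, hx, hy, hz, rfl⟩
  · exact ⟨x, y, z, hx, hy, hz, rfl⟩

theorem Seg.push_sub (h : Seg A o e w) (ht : Tree A t u) :
    Seg A o (item A (lab C R I e) (pushS (Trans Q) o t (sub e))) (app o u w) := by
  obtain ⟨a, d, v, ha, rfl, hd, rfl⟩ := h
  rw [lab_item, sub_item]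
  exact ⟨a, _, _, ha, rfl, hd.push o ht, app_comm o u [a] v⟩

theorem Inv.addTree (h : Inv A o s w) (ht : Tree A t u) :
    Inv A o (addTree A o t s) (app o u w) := by
  obtain ⟨x, y, z, hx, hy, hz, rfl⟩ := h
  unfold VisiblyPushdown.addTree
  split_ifs with h1
  · obtain rfl := hx.of_empty h1
    exact ⟨[], _, z, hx, hy.push o ht, hz, by simp [app_assoc]⟩
  · obtain ⟨v, x', hv, hx', rfl⟩ := hx.pop o h1
    exact ⟨_, y, z, hx'.push o (hv.push_sub ht), hy, hz, by simp [app_assoc]⟩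

theorem Inv.addLetter (h : Inv A o s w) (a : Letter C R I) :
    Inv A o (addLetter A o a s) (app o [a] w) := by
  unfold VisiblyPushdown.addLetter
  split_ifs with h1 h2 h3
  · obtain ⟨x, y, z, hx, hy, hz, rfl⟩ := h
    refine ⟨_, y, z, hx.push o ⟨a, nilS, [], h1, rfl, .nil, rfl⟩, hy, hz, ?_⟩
    simp [app_assoc]
  · obtain ⟨x, y, z, hx, hy, hz, rfl⟩ := h
    obtain rfl := hx.of_empty h3
    refine ⟨[], [], _, hx, .nil, hz.push o ⟨a, s.2.1, y, h2, ?_, hy, rfl⟩, ?_⟩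
    · cases o <;> rfl
    · simp [app_assoc]
  · obtain ⟨x, y, z, hx, hy, hz, rfl⟩ := h
    obtain ⟨v, x', ⟨b, d, v', hb, he, hd, rfl⟩, hx', rfl⟩ := hx.pop o h3
    rw [he, lab_item, sub_item, (side_label o _ _).2]
    have := Inv.addTree (s := (popS (Trans Q) o s.1, s.2)) ⟨x', y, z, hx', hy, hz, rfl⟩
      (tree_node A hb h2 hd)
    simpa only [app_assoc] using this
  · have ht : Tree A (item A (label true (some a) none) nilS) [a] := by
      cases a with
      | internal a => exact .leaf a
      | call a => cases o <;> simp [opens] at h1 h2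
      | ret a => cases o <;> simp [opens] at h1 h2
    exact h.addTree ht

theorem Inv.addRest (h : Inv A o s w) (ht : Tree A t u) :
    ∃ a u', u = app o [a] u' ∧ Inv A o (addRest A o t s) (app o u' w) := by
  unfold VisiblyPushdown.addRest
  rcases ht.cases A (o := o) with ⟨a, rfl, h1⟩ | ⟨a, b, d, u, ha, rfl, hd, rfl⟩
  · rw [if_pos h1]
    exact ⟨a, [], by simp, by simpa⟩
  · have h1 : ¬(lab C R I (item A (label o (some a) (some b)) d)).side true = none := by
      rw [lab_item]
      cases o <;> exact Option.some_ne_none _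
    rw [if_neg h1, lab_item, sub_item, (side_label o _ _).2]
    obtain ⟨x, y, z, hx, hy, hz, rfl⟩ := h
    refine ⟨b, _, rfl, _, y, z, hx.push o ⟨a, d, u, ha, rfl, hd, rfl⟩, hy, hz, ?_⟩
    simp [app_assoc]

theorem Inv.removeLetter (h : Inv A o s w) :
    w = [] ∧ Inv A o (removeLetter A o s) [] ∨
      ∃ a w', w = app o [a] w' ∧ Inv A o (removeLetter A o s) w' := by
  obtain ⟨x, y, z, hx, hy, hz, rfl⟩ := h
  unfold VisiblyPushdown.removeLetter
  split_ifs with h1 h2 h3 h4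
  · obtain rfl := hx.of_empty h1
    obtain rfl := hy.of_empty h2
    obtain rfl := hz.of_empty h3
    exact .inl ⟨by simp, [], [], [], hx, hy, hz, by simp⟩
  · obtain rfl := hx.of_empty h1
    obtain rfl := hy.of_empty h2
    obtain ⟨v, z', ⟨b, d, v', hb, he, hd, rfl⟩, hz', rfl⟩ := hz.pop o h3
    refine .inr ⟨b, app o v' z', by simp [app_assoc], [], v', z', hx, ?_, hz', by simp⟩
    rwa [he, sub_item]
  · obtain rfl := hx.of_empty h1
    obtain ⟨v, y', hv, hy', rfl⟩ := hy.pop o h2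
    obtain ⟨a, u', rfl, h5⟩ := Inv.addRest (s := (s.1, popS (Trans Q) o s.2.1, s.2.2))
      ⟨[], y', z, hx, hy', hz, rfl⟩ hv
    exact .inr ⟨a, _, by simp [app_assoc], h5⟩
  · obtain ⟨v, x', ⟨b, d, v', hb, he, hd, rfl⟩, hx', rfl⟩ := hx.pop o h1
    rw [he, sub_item] at h4
    obtain rfl := hd.of_empty h4
    exact .inr ⟨b, _, by simp [app_assoc], x', y, z, hx', hy, hz, rfl⟩
  · obtain ⟨v, x', ⟨b, d, v', hb, he, hd, rfl⟩, hx', rfl⟩ := hx.pop o h1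
    rw [he, sub_item] at h4 ⊢
    rw [lab_item]
    obtain ⟨v, u, hv, hu, rfl⟩ := hd.pop o h4
    obtain ⟨a, u', rfl, h5⟩ := Inv.addRest (s := (pushS (Trans Q) o (item A (label o (some b) none)
      (popS (Trans Q) o d)) (popS (Trans Q) o s.1), s.2))
      ⟨_, y, z, hx'.push o ⟨b, _, u, hb, rfl, hu, rfl⟩, hy, hz, rfl⟩ hv
    refine .inr ⟨a, _, ?_, h5⟩
    rw [← app_comm]
    simp only [app_assoc]

end Inv

end VisiblyPushdown

/-! ### The run of the automaton on the window -/

namespace VisiblyPushdown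

open SExp Enc Deque

variable {C R I Q Γ : Type*} [Finite C] [Finite R] [Finite I] [Finite Q] {A : VPA C R I Q Γ}

/-- A run on the word `w` that starts with a stack `α` such that `X α α` transforms the state by
`m`, and the stack into some `β` such that `X α β`. Equality as `X` means that the stack is restored,
whatever it was. -/
def Runs (A : VPA C R I Q Γ)
    (X : List {γ : Γ // γ ≠ A.bot} → List {γ : Γ // γ ≠ A.bot} → Prop) (m : Trans Q)
    (w : List (Letter C R I)) : Prop :=
  ∀ q α, X α α → ∃ β, X α β ∧ w.foldl A.step ⟨q, α⟩ = ⟨m.unop q, β⟩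

omit [Finite C] [Finite R] [Finite I] in
theorem Row.runs {X : List {γ : Γ // γ ≠ A.bot} → List {γ : Γ // γ ≠ A.bot} → Prop}
    [Std.Symm X] [IsTrans _ X] {P : SExp → List (Letter C R I) → Prop}
    (hP : ∀ e w, P e w → Runs A X (val (Trans Q) e) w) {t : SExp} {w : List (Letter C R I)}
    (h : Row (Q := Q) P t w) : Runs A X (prodS (Trans Q) t) w := by
  obtain ⟨ts, h1, h2, rfl⟩ := h
  rw [h1.prod]
  clear h1
  induction ts with
  | nil => exact fun q α hα => ⟨α, hα, rfl⟩
  | cons p ts ih =>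
    intro q α hα
    obtain ⟨β, h3, h4⟩ := hP _ _ (h2 p (by simp)) q α hα
    obtain ⟨β', h5, h6⟩ := ih (fun p hp => h2 p (by simp [hp])) ((val (Trans Q) p.1).unop q) β
      (_root_.trans (symm h3) h3)
    refine ⟨β', _root_.trans h3 h5, ?_⟩
    rw [List.flatMap_cons, List.foldl_append, h4, h6, List.map_cons, List.map_cons, List.prod_cons]
    rfl

theorem Tree.runs {e : SExp} {w : List (Letter C R I)} (h : Tree A e w) :
    Runs A Eq (val (Trans Q) e) w := by
  induction h with
  | leaf a => exact fun q α _ => ⟨α, rfl, by rw [val_item]; rfl⟩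
  | node a b d ts h1 h2 ih =>
    have h3 := Row.runs (P := fun e w => Runs A Eq (val (Trans Q) e) w) (fun _ _ h => h)
      ⟨ts, h1, ih, rfl⟩
    intro q α _
    obtain ⟨_, rfl, h4⟩ := h3 (A.callStep q a).2 ((A.callStep q a).1 :: α) rfl
    refine ⟨α, rfl, ?_⟩
    rw [val_item, List.foldl_append]
    exact congrArg (A.step · (.ret b)) h4

/-- A forest before an unmatched return letter preserves the empty stack. -/
theorem Seg.runs_false {e : SExp} {w : List (Letter C R I)} (h : Seg A false e w) :
    Runs A (fun α β => α = [] ∧ β = []) (val (Trans Q) e) w := by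
  obtain ⟨a, d, u, ha, rfl, hd, rfl⟩ := h
  cases a <;> simp [opens] at ha
  rintro q _ ⟨rfl, -⟩
  obtain ⟨_, rfl, h4⟩ := hd.runs (fun _ _ h => h.runs) q [] rfl
  refine ⟨[], ⟨rfl, rfl⟩, ?_⟩
  rw [val_item, show app (!false) _ u = u ++ _ from rfl, List.foldl_append, h4]
  rfl

/-- After a call letter without matching return letter, the stack is never read below the symbol that
is pushed by this letter. -/
theorem Seg.runs_true {e : SExp} {w : List (Letter C R I)} (h : Seg A true e w) :
    Runs A (fun _ _ => True) (val (Trans Q) e) w := by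
  obtain ⟨a, d, u, ha, rfl, hd, rfl⟩ := h
  cases a <;> simp [opens] at ha
  rename_i a
  intro q α _
  obtain ⟨β, -, h4⟩ :=
    hd.runs (fun _ _ h => h.runs) (A.callStep q a).2 ((A.callStep q a).1 :: α) rfl
  refine ⟨β, trivial, ?_⟩
  rw [val_item]
  exact h4

/-- The transformation of the states by the window, for the empty stack. -/
noncomputable def total (Q : Type*) [Finite Q] (s : State) : Trans Q :=
  prodS (Trans Q) s.2.2 * prodS (Trans Q) s.2.1 * prodS (Trans Q) s.1

theorem Inv.total {s : State} {w : List (Letter C R I)} (h : Inv A true s w) (q : Q) :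
    (w.foldl A.step ⟨q, []⟩).state = (total Q s).unop q := by
  obtain ⟨x, y, z, hx, hy, hz, rfl⟩ := h
  have : Std.Symm fun α β : List {γ : Γ // γ ≠ A.bot} => α = [] ∧ β = [] := ⟨fun _ _ h => h.symm⟩
  have : IsTrans _ fun α β : List {γ : Γ // γ ≠ A.bot} => α = [] ∧ β = [] :=
    ⟨fun _ _ _ h h' => ⟨h.1, h'.2⟩⟩
  have : Std.Symm fun _ _ : List {γ : Γ // γ ≠ A.bot} => True := ⟨fun _ _ h => h⟩
  have : IsTrans _ fun _ _ : List {γ : Γ // γ ≠ A.bot} => True := ⟨fun _ _ _ _ h => h⟩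
  obtain ⟨_, ⟨-, rfl⟩, h1⟩ := hz.runs (fun _ _ h => h.runs_false) q [] ⟨rfl, rfl⟩
  obtain ⟨_, rfl, h2⟩ := hy.runs (fun _ _ h => h.runs) ((prodS (Trans Q) s.2.2).unop q) [] rfl
  obtain ⟨β, -, h3⟩ := hx.runs (fun _ _ h => h.runs_true) ((prodS (Trans Q) s.2.1).unop
    ((prodS (Trans Q) s.2.2).unop q)) [] trivial
  rw [show app true x (app true y z) = (z ++ y) ++ x from rfl, List.foldl_append, List.foldl_append,
    h1, h2, h3]
  rfl

/-! ### The size of the representation -/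

omit [Finite C] [Finite R] [Finite I] in
theorem Row.size_le {P : SExp → List (Letter C R I) → Prop} {t : SExp} {w : List (Letter C R I)}
    (h : Row (Q := Q) P t w) (hP : ∀ e w, P e w → e.size + 12 ≤ 20 * w.length) :
    t.size ≤ 20 * w.length + 3 := by
  obtain ⟨ts, h1, h2, rfl⟩ := h
  refine h1.size_le.trans (Nat.add_le_add_right ?_ 3)
  clear h1
  induction ts with
  | nil => simp [weight]
  | cons p ts ih =>
    have h3 := hP _ _ (h2 p (by simp))
    have h4 := ih fun p hp => h2 p (by simp [hp])
    simp only [weight, List.map_cons, List.sum_cons, List.flatMap_cons, List.length_append] at *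
    omega

theorem Tree.size_le {e : SExp} {w : List (Letter C R I)} (h : Tree A e w) :
    e.size + 12 ≤ 20 * w.length := by
  induction h with
  | leaf a => simp [size_item, nilS, SExp.size]
  | node a b d ts h1 h2 ih =>
    have := Row.size_le (Q := Q) (P := fun e w => e.size + 12 ≤ 20 * w.length)
      ⟨ts, h1, ih, rfl⟩ (fun _ _ h => h)
    simp only [size_item, List.length_append, List.length_cons, List.length_nil]
    omega

theorem Seg.size_le {o : Bool} {e : SExp} {w : List (Letter C R I)} (h : Seg A o e w) :
    e.size + 12 ≤ 20 * w.length := by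
  obtain ⟨a, d, u, ha, rfl, hd, rfl⟩ := h
  have := hd.size_le fun _ _ h => h.size_le
  cases o <;> simp [size_item, app] <;> omega

theorem Inv.size_le {o : Bool} {s : State} {w : List (Letter C R I)} (h : Inv A o s w) :
    (enc s).size ≤ 20 * (w.length + 1) := by
  obtain ⟨x, y, z, hx, hy, hz, rfl⟩ := h
  have h1 := hx.size_le fun _ _ h => h.size_le
  have h2 := hy.size_le fun _ _ h => h.size_le
  have h3 := hz.size_le fun _ _ h => h.size_le
  obtain ⟨s1, s2, s3⟩ := s
  cases o <;> simp [app, SExp.size] at * <;> omega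

/-! ### The algorithm -/

/-- The state that is represented by an S-expression. The atom `0` stands for the empty window. -/
noncomputable def toState (t : SExp) : State :=
  if t.isAtom 0 = true then (nilS, nilS, nilS) else (t.car, t.cdr.car, t.cdr.cdr)

@[fun_prop]
theorem comp_toState {X : Type*} [Enc X] {f : X → SExp} (hf : Comp f) :
    Comp (fun x => toState (f x)) := by
  unfold toState
  refine Comp.ite ?_ (by fun_prop) (by fun_prop)
  simp only [Bool.decide_eq_true]
  obtain ⟨e, he⟩ := hf
  refine ⟨.ite e 0 (enc true).toCode (enc false).toCode, fun x env => ?_⟩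
  rw [Code.eval, he, eval_toCode, eval_toCode]
  change (bif (f x).isAtom 0 then _ else _) = enc ((f x).isAtom 0)
  cases (f x).isAtom 0 <;> rfl

open SlidingWindow

variable (A)

/-- The effect of an operation on the state. -/
noncomputable def next (s : State) : Op (Letter C R I) → State
  | .rightpush a => addLetter A true a s
  | .leftpush a => swap false (addLetter A false a (swap false s))
  | .rightpop => removeLetter A true s
  | .leftpop => swap false (removeLetter A false (swap false s))
  | .query => s

variable {A}

theorem Inv.next {s : State} {w : List (Letter C R I)} (h : Inv A true s w)
    (op : Op (Letter C R I)) : Inv A true (next A s op) (op.apply w) := by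
  cases op with
  | rightpush a => exact h.addLetter a
  | leftpush a => exact ((h.swap false).addLetter a).swap false
  | rightpop =>
    rcases h.removeLetter with ⟨rfl, h1⟩ | ⟨a, w', rfl, h1⟩
    · exact h1
    · rw [show Op.apply _ _ = (w' ++ [a]).dropLast from rfl, List.dropLast_concat]
      exact h1
  | leftpop =>
    rcases (h.swap false).removeLetter with ⟨rfl, h1⟩ | ⟨a, w', rfl, h1⟩
    · exact h1.swap false
    · exact h1.swap false
  | query => exact h

variable (A)

open Classical in
/-- The S-expression that is computed for an operation: the answer to a query, and the new state
otherwise. -/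
noncomputable def out (op : Op (Letter C R I)) (t : SExp) : SExp :=
  match op with
  | .query => if (total Q (toState t)).unop A.start ∈ A.final then atom 1 else atom 0
  | op => enc (next A (toState t) op)

theorem comp_out (op : Op (Letter C R I)) : Comp (out A op) := by
  classical
  cases op with
  | query =>
    exact (Comp.of_finite (f := fun m : Trans Q =>
      if m.unop A.start ∈ A.final then atom 1 else atom 0)).comp (f := fun t : SExp =>
        total Q (toState t)) (by unfold total; fun_prop)
  | rightpush a => exact Comp.enc (f := fun t => next A (toState t) _) (by unfold next; fun_prop)
  | leftpush a => exact Comp.enc (f := fun t => next A (toState t) _) (by unfold next; fun_prop)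
  | rightpop => exact Comp.enc (f := fun t => next A (toState t) _) (by unfold next; fun_prop)
  | leftpop => exact Comp.enc (f := fun t => next A (toState t) _) (by unfold next; fun_prop)

/-- The expression that handles an operation. -/
noncomputable def code (op : Op (Letter C R I)) : Code := (comp_out A op).choose

theorem eval_code (op : Op (Letter C R I)) (t : SExp) : (code A op).eval [t] = out A op t :=
  (comp_out A op).choose_spec t []

theorem inv_stateAfter (ops : List (Op (Letter C R I))) :
    Inv A true (toState (stateAfter (code A) ops)) (window ops) ∧
      (stateAfter (code A) ops = atom 0 ∨ ∃ s : State, stateAfter (code A) ops = enc s) := by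
  induction ops using List.reverseRecOn with
  | nil => exact ⟨⟨[], [], [], .nil, .nil, .nil, rfl⟩, .inl rfl⟩
  | append_singleton ops op ih =>
    obtain ⟨h1, h2⟩ := ih
    have h3 := h1.next op
    simp only [stateAfter, window, List.foldl_append, List.foldl_cons, List.foldl_nil] at *
    generalize List.foldl (Op.evalCode (code A)) (atom 0) ops = t at *
    cases op with
    | query => exact ⟨h3, h2⟩
    | rightpush a => rw [Op.evalCode, eval_code]; exacts [⟨h3, .inr ⟨_, rfl⟩⟩, nofun]
    | leftpush a => rw [Op.evalCode, eval_code]; exacts [⟨h3, .inr ⟨_, rfl⟩⟩, nofun]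
    | rightpop => rw [Op.evalCode, eval_code]; exacts [⟨h3, .inr ⟨_, rfl⟩⟩, nofun]
    | leftpop => rw [Op.evalCode, eval_code]; exacts [⟨h3, .inr ⟨_, rfl⟩⟩, nofun]

end VisiblyPushdown

theorem mainTheorem1 {C R I : Type*} [Finite C] [Finite R] [Finite I]
    (L : Language (VisiblyPushdown.Letter C R I)) (hL : VisiblyPushdown.IsVPL L) :
    ∃ A : SlidingWindow.Algorithm (VisiblyPushdown.Letter C R I), A.Solves L ∧
      ∃ T S b : ℕ → ℕ, A.HasLatency T ∧ A.HasWordSizeAndSpace b S ∧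
        (fun n => (T n : ℝ)) =O[atTop] (fun _ => (1 : ℝ)) ∧
        (fun n => (S n : ℝ)) =O[atTop] (fun n => (n : ℝ) * (Nat.clog 2 n : ℝ)) ∧
        (fun n => (b n : ℝ)) =O[atTop] (fun n => (Nat.clog 2 n : ℝ)) := by
  obtain ⟨Q, Γ, hQ, -, A, rfl⟩ := hL
  refine SlidingWindow.exists_algorithm_of_code _ (VisiblyPushdown.code A) (fun ops => ?_) 20
    fun ops => ?_
  · have h : SlidingWindow.window ops ∈ A.accepts ↔ _ :=
      Iff.of_eq (congrArg (· ∈ A.final) ((VisiblyPushdown.inv_stateAfter A ops).1.total A.start))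
    rw [VisiblyPushdown.eval_code]
    exact ⟨fun hw => if_pos (h.1 hw), fun hw => if_neg fun h' => hw (h.2 h')⟩
  · obtain ⟨h1, h2 | ⟨s, h2⟩⟩ := VisiblyPushdown.inv_stateAfter A ops
    · rw [h2]
      simp only [SExp.size]
      omega
    · rw [h2] at h1 ⊢
      exact h1.size_le
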